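/- **Setting.** Let $\mathcal D$ be a pointed closed symmetric monoidal model category (smash product $\wedge$, unit $S^0$, symmetry $t$) whose smash product preserves weak equivalences, so that $\mathrm{Ho}(\mathcal D)$ is symmetric monoidal; $[-,-]$ denotes morphisms in $\mathrm{Ho}(\mathcal D)$. Let $T\in\mathcal D$ be a cofibrant object with the structure of a cogroup object in $\mathrm{Ho}(\mathcal D)$. Let $T$ have a sign, i.e. an automorphism $(-1)_T$ of $T$ in $\mathrm{Ho}(\mathcal D)$ with $(-1)_T^2=1$ such that every $\tau\in\Sigma_n$ ($n\ge 1$) acts on $T^n$ as $|\tau|_T\wedge T^{n-1}$, where $|\tau|_T=\mathrm{id}$ or $(-1)_T$ according to the signature of $\tau$, and such that $(-1)_T\wedge 1=1\wedge(-1)_T$ on $T\wedge T$. Let $N$ be a commutative monoid, and let $\mathbb S^r$ $(r\in N)$ be cofibrant objects of $\mathcal D$ with isomorphisms $\mathbb S^0\cong S^0$ and $s_{r,r'}:\mathbb S^{r+r'}\cong\mathbb S^r\wedge\mathbb S^{r'}$ that are associative and unital. Let $\mathcal B'$ be a class of cofibrant objects of $\mathcal D$, and let $U\in\mathcal B'$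 be a commutative comonoid in $\mathcal D$ with comultiplication $diag:U\to U\wedge U$. For a $T$-spectrum $E$, an object $V$ and $q\in\mathbb Z$ put $\pi_q^V(E)=\operatorname{colim}_{m}[V\wedge T^{q+m},E_m]$ (over $m\ge 0$ with $q+m\ge1$), the colimit being taken along $\sigma_*\circ(-\wedge T)$, with the group structure given by the cogroup structure of the first factor $T$. A symmetric $T$-ring spectrum $R$ has levels $R_n$ with $\Sigma_n$-actions, equivariant associative multiplications $\mu_{n,m}:R_n\wedge R_m\to R_{n+m}$ and units $\iota_0:S^0\to R_0$, $\iota_1:T\to R_1$ satisfying the unit axioms and the centrality of $\iota_1$; it is a $T$-spectrum by $\sigma_n=\mu_{n,1}(1\wedge\iota_1)$. Write $\chi_{n,m}\in\Sigma_{n+m}$ for the block permutation moving the first $n$ elements past the last $m$, and also for the induced map $R_{n+m}\to R_{m+n}$. $R$ is commutative if $\chi_{n,m}\mu_{n,m}=\mu_{m,n}t$ for all $n,m$. A map $f:A\to R_n$ in $\mathcal D$ is central if $\chi_{n,m}\mu_{n,m}(f\wedge1)=\mu_{m,n}(1\wedge f)t_{A,R_m}$ for all $m$. The monoid of injections $h:\mathbb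 N\to\mathbb N$ acts on $\pi^V_q(R)$ by $h\cdot[g]=[\gamma_*\circ\sigma^{j}(g\wedge T^{j})\circ(V\wedge|\gamma|_T\wedge 1)]$ for $g\in[V\wedge T^{q+m},R_m]$, $q+m\ge 2$, and any $\gamma\in\Sigma_{m+j}$ that agrees with $h$ on the first $m$ elements. $R$ is semistable if this action is trivial on $\pi_q^{\mathbb S^r\wedge W}(R)$ for all $W\in\mathcal B'$, $r\in N$, $q\in\mathbb Z$. Put $\pi^U_{r,q}(R)=\pi_q^{\mathbb S^r\wedge U}(R)$, and let $t_{r',r}:\pi^U_{r'+r,q}(R)\to\pi^U_{r+r',q}(R)$ be induced by $s_{r',r}^{-1}\,t_{\mathbb S^r,\mathbb S^{r'}}\,s_{r,r'}:\mathbb S^{r+r'}\to\mathbb S^{r'+r}$. The automorphism $(-1)_T$ acts on $\pi^U_{r,q}(R)$ by precomposition on the first factor $T$. For $f\in[\mathbb S^r\wedge U\wedge T^{q+n},R_n]$ and $g\in[\mathbb S^{r'}\wedge U\wedge T^{q'+n'},R_{n'}]$ with $q+n,\,q'+n'\ge1$ let $f\cdot g\in[\mathbb S^{r+r'}\wedge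 U\wedge T^{q+q'+n+n'},R_{n+n'}]$ be the composition $$\mu_{n,n'}\circ(f\wedge g)\circ\bigl(\mathbb S^r\wedge t_{\mathbb S^{r'}\wedge U,\,U\wedge T^{q+n}}\wedge T^{q'+n'}\bigr)\circ\bigl(s_{r,r'}\wedge diag\wedge(-1)_T^{q'n}\wedge1\bigr).$$ **Proposition.** One can equip $\pi^U_{*,*}(R)=\bigoplus_{(r,q)\in N\times\mathbb Z}\pi^U_{r,q}(R)$, for all semistable symmetric $T$-ring spectra $R$, with the structure of an $N\times\mathbb Z$-graded (associative, unital) ring such that the following hold. 1. The maps $(f,g)\mapsto f\cdot g$ above are biadditive and induce the product: $[f]\cdot[g]=[f\cdot g]$. 2. The product is compatible with the signs: $(-1)_T(x\cdot y)=((-1)_Tx)\cdot y=x\cdot((-1)_Ty)$. 3. If $R$ is commutative, then $x\cdot y=(-1)_T^{qq'}\,t_{r',r}(y\cdot x)$ for all $x\in\pi^U_{r,q}(R)$ and $y\in\pi^U_{r',q'}(R)$. For arbitrary semistable $R$ the same equality holds for all $y$ whenever $x=[f]$ for a central map $f:\mathbb S^r\wedge U\wedge T^{q+n}\to R_n$ in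 $\mathcal D$ with $q+n\ge1$. 4. The structure is natural: every morphism $R\to R'$ of semistable symmetric $T$-ring spectra induces a homomorphism of graded rings $\pi^U_{*,*}(R)\to\pi^U_{*,*}(R')$. -/

import Mathlib

open CategoryTheory MonoidalCategory Limits HomotopicalAlgebra

universe w v u

noncomputable section

namespace StableHtpy

/-- A model category with a monoidal structure satisfying the pushout product axiom and the unit
axiom. -/
class MonoidalModelCategory (D : Type u) [Category.{v} D] [MonoidalCategory D]
    [ModelCategory D] : Prop where
  cofibration_pushoutProduct {A B X Y : D} (i : A ⟶ B) (j : X ⟶ Y)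
    [Cofibration i] [Cofibration j] :
    Cofibration (pushout.desc (B ◁ j) (i ▷ Y) (whisker_exchange i j).symm :
      pushout (i ▷ X) (A ◁ j) ⟶ B ⊗ Y)
  weakEquivalence_pushoutProduct {A B X Y : D} (i : A ⟶ B) (j : X ⟶ Y)
    [Cofibration i] [Cofibration j] (h : WeakEquivalence i ∨ WeakEquivalence j) :
    WeakEquivalence (pushout.desc (B ◁ j) (i ▷ Y) (whisker_exchange i j).symm :
      pushout (i ▷ X) (A ◁ j) ⟶ B ⊗ Y)
  unit_left {Q : D} (p : Q ⟶ 𝟙_ D) [IsCofibrant Q] [Fibration p] [WeakEquivalence p]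
    (X : D) [IsCofibrant X] : WeakEquivalence (p ▷ X)
  unit_right {Q : D} (p : Q ⟶ 𝟙_ D) [IsCofibrant Q] [Fibration p] [WeakEquivalence p]
    (X : D) [IsCofibrant X] : WeakEquivalence (X ◁ p)

section

variable {C : Type u} [Category.{v} C]

def isColimitOfIso {A B P A' B' P' : C} {f : A ⟶ P} {g : B ⟶ P} {f' : A' ⟶ P'} {g' : B' ⟶ P'}
    (h : IsColimit (BinaryCofan.mk f g)) (eA : A' ≅ A) (eB : B' ≅ B) (eP : P' ≅ P)
    (hf : f' ≫ eP.hom = eA.hom ≫ f) (hg : g' ≫ eP.hom = eB.hom ≫ g) :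
    IsColimit (BinaryCofan.mk f' g') := by
  have key : ∀ (Z : C) (a : A' ⟶ Z) (b : B' ⟶ Z), ∃ m : P ⟶ Z, f ≫ m = eA.inv ≫ a ∧
      g ≫ m = eB.inv ≫ b := fun Z a b =>
    ⟨(BinaryCofan.IsColimit.desc' h (eA.inv ≫ a) (eB.inv ≫ b)).1,
      (BinaryCofan.IsColimit.desc' h (eA.inv ≫ a) (eB.inv ≫ b)).2⟩
  refine BinaryCofan.IsColimit.mk _ (fun a b => eP.hom ≫ (key _ a b).choose) ?_ ?_ ?_
  · intro Z a b
    have := (key _ a b).choose_spec.1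
    change f' ≫ eP.hom ≫ _ = a
    rw [reassoc_of% hf, this, Iso.hom_inv_id_assoc]
  · intro Z a b
    have := (key _ a b).choose_spec.2
    change g' ≫ eP.hom ≫ _ = b
    rw [reassoc_of% hg, this, Iso.hom_inv_id_assoc]
  · intro Z a b (m : P' ⟶ Z) (h1 : f' ≫ m = a) (h2 : g' ≫ m = b)
    refine (Iso.inv_comp_eq _).1 ?_
    have e1 : f ≫ eP.inv = eA.inv ≫ f' := by
      rw [Iso.comp_inv_eq, Category.assoc, hf, Iso.inv_hom_id_assoc]
    have e2 : g ≫ eP.inv = eB.inv ≫ g' := by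
      rw [Iso.comp_inv_eq, Category.assoc, hg, Iso.inv_hom_id_assoc]
    refine BinaryCofan.IsColimit.hom_ext h ?_ ?_
    · change f ≫ eP.inv ≫ m = f ≫ _
      rw [(key _ a b).choose_spec.1, reassoc_of% e1, h1]
    · change g ≫ eP.inv ≫ m = g ≫ _
      rw [(key _ a b).choose_spec.2, reassoc_of% e2, h2]

lemma preservesBinaryCoproducts_of_cofan (G : C ⥤ C)
    (H : ∀ A B : C, ∃ (A' B' P : C) (_ : Nonempty (A' ≅ A)) (_ : Nonempty (B' ≅ B))
      (f : A' ⟶ P) (g : B' ⟶ P) (_ : Nonempty (IsColimit (BinaryCofan.mk f g))),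
      Nonempty (IsColimit (BinaryCofan.mk (G.map f) (G.map g)))) :
    PreservesColimitsOfShape (Discrete WalkingPair) G := by
  refine ⟨fun {K} => ?_⟩
  obtain ⟨A', B', P, ⟨eA⟩, ⟨eB⟩, f, g, ⟨h⟩, ⟨h'⟩⟩ := H (K.obj ⟨.left⟩) (K.obj ⟨.right⟩)
  have : PreservesColimit (pair A' B') G :=
    preservesColimit_of_preserves_colimit_cocone h
      ((isColimitMapCoconeBinaryCofanEquiv _ _ _).symm h')
  exact preservesColimit_of_iso_diagram G
    ((mapPairIso eA eB : pair A' B' ≅ pair _ _) ≪≫ (diagramIsoPair K).symm)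

end

section

variable {D : Type u} [Category.{v} D] [MonoidalCategory D] [ModelCategory D]
  [SymmetricCategory D] [MonoidalClosed D]

lemma isCofibrant_tensor [MonoidalModelCategory D]
    (V X : D) [IsCofibrant V] [IsCofibrant X] : IsCofibrant (V ⊗ X) := by
  have h1 (Y : D) : IsInitial (Y ⊗ ⊥_ D) :=
    IsInitial.isInitialObj (tensorLeft Y) _ initialIsInitial
  have h2 (Y : D) : IsInitial ((⊥_ D) ⊗ Y) := IsInitial.ofIso (h1 Y) (β_ _ _)
  let i := initial.to V
  let j := initial.to X
  have hP : IsInitial (pushout (i ▷ ⊥_ D) ((⊥_ D) ◁ j)) :=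
    IsInitial.ofUniqueHom
      (fun Z => pushout.desc ((h1 _).to Z) ((h2 _).to Z) ((h1 _).hom_ext _ _))
      (fun Z m => pushout.hom_ext ((h1 _).hom_ext _ _) ((h2 _).hom_ext _ _))
  exact (isCofibrant_iff_of_isInitial _ hP).2
    (MonoidalModelCategory.cofibration_pushoutProduct i j)

end

section

variable (D : Type u) [Category.{v} D] [MonoidalCategory D] [ModelCategory D]
  [(weakEquivalences D).IsMonoidal]

/-- The homotopy category, with the monoidal structure induced by the one of `D`, whose tensor
product preserves weak equivalences. -/
abbrev Ho : Type u :=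
  LocalizedMonoidal (weakEquivalences D).Q (weakEquivalences D)
    (Iso.refl ((weakEquivalences D).Q.obj (𝟙_ D)))

/-- The (strong monoidal) localisation functor. -/
abbrev toHo : D ⥤ Ho D :=
  Localization.Monoidal.toMonoidalCategory (weakEquivalences D).Q (weakEquivalences D) (Iso.refl _)


variable {D}

lemma exists_iso_cofibrant (A : Ho D) : ∃ (X : D) (_ : IsCofibrant X), Nonempty (A ≅ (toHo D).obj X) := by
  have : (toHo D).EssSurj := Localization.essSurj (toHo D) (weakEquivalences D)
  let X := (toHo D).objPreimage A
  obtain ⟨X', h, p, _, hp⟩ := CofibrantObject.HoCat.exists_resolution X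
  have := Localization.inverts (toHo D) (weakEquivalences D) p (by rwa [← weakEquivalence_iff])
  exact ⟨X', h, ⟨((toHo D).objObjPreimageIso A).symm ≪≫ (asIso ((toHo D).map p)).symm⟩⟩

lemma exists_iso_fibrant (A : Ho D) : ∃ (X : D) (_ : IsFibrant X), Nonempty (A ≅ (toHo D).obj X) := by
  have : (toHo D).EssSurj := Localization.essSurj (toHo D) (weakEquivalences D)
  let X := (toHo D).objPreimage A
  have := Localization.inverts (toHo D) (weakEquivalences D) (FibrantObject.HoCat.iResolutionObj X)
    (by rw [← weakEquivalence_iff]; infer_instance)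
  exact ⟨_, inferInstance, ⟨((toHo D).objObjPreimageIso A).symm ≪≫
    asIso ((toHo D).map (FibrantObject.HoCat.iResolutionObj X))⟩⟩

def isColimitHo {X Y : D} [IsCofibrant X] [IsCofibrant Y] :
    IsColimit (BinaryCofan.mk ((toHo D).map (coprod.inl : X ⟶ X ⨿ Y)) ((toHo D).map coprod.inr)) := by
  have hc : IsCofibrant (X ⨿ Y) := isCofibrant_of_cofibration (coprod.inl : X ⟶ X ⨿ Y)
  apply Nonempty.some
  have key : ∀ (A : Ho D), Function.Bijective (fun (h : (toHo D).obj (X ⨿ Y) ⟶ A) =>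
      ((toHo D).map (coprod.inl : X ⟶ X ⨿ Y) ≫ h, (toHo D).map (coprod.inr : Y ⟶ X ⨿ Y) ≫ h)) := by
    intro A
    obtain ⟨Z, _, ⟨e⟩⟩ := exists_iso_fibrant A
    constructor
    · intro a b hab
      obtain ⟨f, hf⟩ := map_surjective_of_isLocalization (toHo D) _ _ (a ≫ e.hom)
      obtain ⟨g, hg⟩ := map_surjective_of_isLocalization (toHo D) _ _ (b ≫ e.hom)
      simp only [Prod.mk.injEq] at hab
      obtain ⟨P, _⟩ := PathObject.exists_very_good Z
      have h1 : RightHomotopyRel (coprod.inl ≫ f) (coprod.inl ≫ g) := by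
        rw [RightHomotopyRel.iff_map_eq (toHo D)]
        simp [hf, hg, reassoc_of% hab.1]
      have h2 : RightHomotopyRel (coprod.inr ≫ f) (coprod.inr ≫ g) := by
        rw [RightHomotopyRel.iff_map_eq (toHo D)]
        simp [hf, hg, reassoc_of% hab.2]
      have h : RightHomotopyRel f g :=
        ⟨P, ⟨{ h := coprod.desc (h1.rightHomotopy P).h (h2.rightHomotopy P).h
               h₀ := by
                 apply coprod.hom_ext
                 · rw [coprod.inl_desc_assoc, PrepathObject.RightHomotopy.h₀]
                 · rw [coprod.inr_desc_assoc, PrepathObject.RightHomotopy.h₀]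
               h₁ := by
                 apply coprod.hom_ext
                 · rw [coprod.inl_desc_assoc, PrepathObject.RightHomotopy.h₁]
                 · rw [coprod.inr_desc_assoc, PrepathObject.RightHomotopy.h₁] }⟩⟩
      rw [RightHomotopyRel.iff_map_eq (toHo D), hf, hg] at h
      exact (cancel_mono e.hom).1 h
    · rintro ⟨a, b⟩
      obtain ⟨f, hf⟩ := map_surjective_of_isLocalization (toHo D) _ _ (a ≫ e.hom)
      obtain ⟨g, hg⟩ := map_surjective_of_isLocalization (toHo D) _ _ (b ≫ e.hom)
      refine ⟨(toHo D).map (coprod.desc f g) ≫ e.inv, ?_⟩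
      ext
      · dsimp only
        rw [← Functor.map_comp_assoc, coprod.inl_desc, hf, Category.assoc, e.hom_inv_id, Category.comp_id]
      · dsimp only
        rw [← Functor.map_comp_assoc, coprod.inr_desc, hg, Category.assoc, e.hom_inv_id, Category.comp_id]
  refine ⟨BinaryCofan.IsColimit.mk _ (fun {A} a b => ((key A).2 (a, b)).choose) ?_ ?_ ?_⟩
  · intro A a b
    exact congrArg Prod.fst ((key A).2 (a, b)).choose_spec
  · intro A a b
    exact congrArg Prod.snd ((key A).2 (a, b)).choose_spec
  · intro A a b m h1 h2
    apply (key A).1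
    rw [((key A).2 (a, b)).choose_spec]
    exact Prod.ext h1 h2


variable (D) in
instance : HasBinaryCoproducts (Ho D) := by
  have : ∀ {A B : Ho D}, HasColimit (pair A B) := by
    intro A B
    obtain ⟨X, _, ⟨e⟩⟩ := exists_iso_cofibrant A
    obtain ⟨Y, _, ⟨e'⟩⟩ := exists_iso_cofibrant B
    have : HasColimit (pair ((toHo D).obj X) ((toHo D).obj Y)) := ⟨⟨⟨_, isColimitHo⟩⟩⟩
    exact hasColimit_of_iso (show pair A B ≅ pair ((toHo D).obj X) ((toHo D).obj Y) from mapPairIso e e')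
  exact hasBinaryCoproducts_of_hasColimit_pair _


lemma isZero_toHo {O : D} (hO : IsZero O) : IsZero ((toHo D).obj O) where
  unique_to A := by
    obtain ⟨Z, _, ⟨e⟩⟩ := exists_iso_fibrant A
    have : IsCofibrant O := (isCofibrant_iff_of_isInitial (𝟙 O) hO.isInitial).2 inferInstance
    refine ⟨⟨⟨(toHo D).map (hO.to_ Z) ≫ e.inv⟩, fun a => ?_⟩⟩
    obtain ⟨f, hf⟩ := map_surjective_of_isLocalization (toHo D) _ _ (a ≫ e.hom)
    rw [hO.eq_of_src f (hO.to_ Z)] at hf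
    exact (Iso.eq_comp_inv _).2 hf.symm
  unique_from A := by
    obtain ⟨Z, _, ⟨e⟩⟩ := exists_iso_cofibrant A
    have : IsFibrant O := (isFibrant_iff_of_isTerminal (𝟙 O) hO.isTerminal).2 inferInstance
    refine ⟨⟨⟨e.hom ≫ (toHo D).map (hO.from_ Z)⟩, fun a => ?_⟩⟩
    obtain ⟨f, hf⟩ := map_surjective_of_isLocalization (toHo D) _ _ (e.inv ≫ a)
    rw [hO.eq_of_tgt f (hO.from_ Z)] at hf
    exact (Iso.inv_comp_eq _).1 hf.symm

instance [HasZeroObject D] : HasZeroObject (Ho D) :=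
  ⟨⟨_, isZero_toHo (Classical.choose_spec (HasZeroObject.zero (C := D)))⟩⟩

instance [HasZeroObject D] : HasZeroMorphisms (Ho D) := HasZeroObject.zeroMorphismsOfZeroObject

section

variable [SymmetricCategory D] [MonoidalClosed D]

variable [MonoidalModelCategory D]

instance (P : Ho D) : PreservesColimitsOfShape (Discrete WalkingPair) (tensorLeft P) := by
  obtain ⟨V, _, ⟨e⟩⟩ := exists_iso_cofibrant P
  have : PreservesColimitsOfShape (Discrete WalkingPair) (tensorLeft ((toHo D).obj V)) := by
    refine preservesBinaryCoproducts_of_cofan _ fun A B => ?_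
    obtain ⟨X, _, ⟨eX⟩⟩ := exists_iso_cofibrant A
    obtain ⟨Y, _, ⟨eY⟩⟩ := exists_iso_cofibrant B
    have := isCofibrant_tensor V X
    have := isCofibrant_tensor V Y
    refine ⟨_, _, _, ⟨eX.symm⟩, ⟨eY.symm⟩, _, _, ⟨isColimitHo (X := X) (Y := Y)⟩, ⟨?_⟩⟩
    let φ : V ⊗ (X ⨿ Y) ≅ (V ⊗ X) ⨿ (V ⊗ Y) := (PreservesColimitPair.iso (tensorLeft V) X Y).symm
    have h1 : V ◁ coprod.inl ≫ φ.hom = coprod.inl := (Iso.comp_inv_eq _).2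
      (coprodComparison_inl (tensorLeft V)).symm
    have h2 : V ◁ coprod.inr ≫ φ.hom = coprod.inr := (Iso.comp_inv_eq _).2
      (coprodComparison_inr (tensorLeft V)).symm
    let L := toHo D
    let ψ : L.obj V ⊗ L.obj (X ⨿ Y) ≅ L.obj ((V ⊗ X) ⨿ (V ⊗ Y)) :=
      Functor.Monoidal.μIso L V (X ⨿ Y) ≪≫ L.mapIso φ
    have h3 : (L.obj V ◁ L.map coprod.inl) ≫ ψ.hom =
        (Functor.Monoidal.μIso L V X).hom ≫ L.map coprod.inl := by
      simp [ψ, ← Functor.map_comp, h1]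
    have h4 : (L.obj V ◁ L.map coprod.inr) ≫ ψ.hom =
        (Functor.Monoidal.μIso L V Y).hom ≫ L.map coprod.inr := by
      simp [ψ, ← Functor.map_comp, h2]
    exact isColimitOfIso (isColimitHo (X := V ⊗ X) (Y := V ⊗ Y))
      (Functor.Monoidal.μIso L V X) (Functor.Monoidal.μIso L V Y) ψ h3 h4
  exact preservesColimitsOfShape_of_natIso ((tensoringLeft (Ho D)).mapIso e.symm)

instance (P : Ho D) : PreservesColimitsOfShape (Discrete WalkingPair) (tensorRight P) :=
  preservesColimitsOfShape_of_natIso (BraidedCategory.tensorLeftIsoTensorRight P)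

end
end

section Cogroups

section

variable {C : Type u} [Category.{v} C] [HasBinaryCoproducts C]
  (F : C ⥤ C) [PreservesColimitsOfShape (Discrete WalkingPair) F]

lemma inv_coprodComparison_desc {A B Z X : C} (u : A ⟶ Z) (v : B ⟶ Z) (m : F.obj Z ⟶ X) :
    inv (coprodComparison F A B) ≫ coprod.desc (F.map u ≫ m) (F.map v ≫ m) =
      F.map (coprod.desc u v) ≫ m := by
  rw [IsIso.inv_comp_eq]
  ext
  · rw [coprod.inl_desc, reassoc_of% (coprodComparison_inl F (A := A) (B := B)),
      ← Functor.map_comp_assoc, coprod.inl_desc]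
  · rw [coprod.inr_desc, reassoc_of% (coprodComparison_inr F (A := A) (B := B)),
      ← Functor.map_comp_assoc, coprod.inr_desc]

lemma exists_factor {A B X : C} (a : F.obj A ⟶ X) (b : F.obj B ⟶ X) :
    ∃ m : F.obj (A ⨿ B) ⟶ X, F.map coprod.inl ≫ m = a ∧ F.map coprod.inr ≫ m = b :=
  ⟨inv (coprodComparison F A B) ≫ coprod.desc a b, by
    rw [← coprodComparison_inl (B := B), Category.assoc, IsIso.hom_inv_id_assoc,
      coprod.inl_desc], by
    rw [← coprodComparison_inr (A := A), Category.assoc, IsIso.hom_inv_id_assoc,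
      coprod.inr_desc]⟩

end

variable {C : Type u} [Category.{v} C] [HasZeroMorphisms C] [HasBinaryCoproducts C]

/-- A cogroup object in a pointed category with binary coproducts. -/
structure Cogroup (T : C) where
  comul : T ⟶ T ⨿ T
  neg : T ⟶ T
  counit_left : comul ≫ coprod.desc 0 (𝟙 T) = 𝟙 T
  counit_right : comul ≫ coprod.desc (𝟙 T) 0 = 𝟙 T
  coassoc : comul ≫ coprod.map comul (𝟙 T) ≫ (coprod.associator T T T).hom =
    comul ≫ coprod.map (𝟙 T) comul
  neg_left : comul ≫ coprod.desc neg (𝟙 T) = 0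

variable {T : C} (c : Cogroup T)

/-- If `T` is a cogroup and `F` preserves binary coproducts, then `F T` is a cogroup as well; this
is the resulting addition of morphisms `F T ⟶ X`. -/
def homAdd (F : C ⥤ C) [PreservesColimitsOfShape (Discrete WalkingPair) F] {X : C}
    (a b : F.obj T ⟶ X) : F.obj T ⟶ X :=
  F.map c.comul ≫ inv (coprodComparison F T T) ≫ coprod.desc a b

section

variable (F G : C ⥤ C) [PreservesColimitsOfShape (Discrete WalkingPair) F]
  [PreservesColimitsOfShape (Discrete WalkingPair) G]

lemma homAdd_map {Z X : C} (u v : T ⟶ Z) (m : F.obj Z ⟶ X) :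
    homAdd c F (F.map u ≫ m) (F.map v ≫ m) = F.map (c.comul ≫ coprod.desc u v) ≫ m := by
  rw [homAdd, inv_coprodComparison_desc, Functor.map_comp, Category.assoc]

lemma map_zero_comp {X : C} (a : F.obj T ⟶ X) : F.map (0 : T ⟶ T) ≫ a = 0 := by
  obtain ⟨m, h1, h2⟩ := exists_factor F a 0
  rw [← h1, ← Functor.map_comp_assoc, zero_comp,
    ← (zero_comp : (0 : T ⟶ T) ≫ (coprod.inr : T ⟶ T ⨿ T) = 0), Functor.map_comp_assoc, h2,
    comp_zero]

/-- The group of morphisms out of `F T`, for a cogroup `T`. -/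
@[reducible] def homAddGroup (X : C) : AddGroup (F.obj T ⟶ X) :=
  letI : Add (F.obj T ⟶ X) := ⟨homAdd c F⟩
  letI : Zero (F.obj T ⟶ X) := ⟨0⟩
  letI : Neg (F.obj T ⟶ X) := ⟨fun a => F.map c.neg ≫ a⟩
  have hid (a : F.obj T ⟶ X) : F.map (𝟙 T) ≫ a = a := by
    rw [CategoryTheory.Functor.map_id, Category.id_comp]
  AddGroup.ofLeftAxioms
    (fun x y z => by
      obtain ⟨m₁, h1, h2⟩ := exists_factor F y z
      obtain ⟨m, h3, h4⟩ := exists_factor F x m₁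
      have hx := h3
      have hy : F.map ((coprod.inl : T ⟶ T ⨿ T) ≫ (coprod.inr : _ ⟶ T ⨿ T ⨿ T)) ≫ m = y := by
        rw [Functor.map_comp_assoc, h4, h1]
      have hz : F.map ((coprod.inr : T ⟶ T ⨿ T) ≫ (coprod.inr : _ ⟶ T ⨿ T ⨿ T)) ≫ m = z := by
        rw [Functor.map_comp_assoc, h4, h2]
      change homAdd c F (homAdd c F x y) z = homAdd c F x (homAdd c F y z)
      rw [← hx, ← hy, ← hz, homAdd_map, homAdd_map, homAdd_map, homAdd_map]
      congr 2
      have e1 : coprod.map c.comul (𝟙 T) ≫ (coprod.associator T T T).hom =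
          coprod.desc (c.comul ≫ coprod.desc coprod.inl (coprod.inl ≫ coprod.inr))
            (coprod.inr ≫ coprod.inr) := by
        ext <;> simp
      have e2 : coprod.map (𝟙 T) c.comul = coprod.desc (coprod.inl : T ⟶ T ⨿ T ⨿ T)
            (c.comul ≫ coprod.desc (coprod.inl ≫ coprod.inr) (coprod.inr ≫ coprod.inr)) := by
        have e3 : coprod.desc (coprod.inl ≫ coprod.inr) (coprod.inr ≫ coprod.inr) =
          (coprod.inr : T ⨿ T ⟶ T ⨿ T ⨿ T) := by
            apply coprod.hom_ext
            · rw [coprod.inl_desc]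
            · rw [coprod.inr_desc]
        rw [e3]
        apply coprod.hom_ext
        · rw [coprod.inl_map, coprod.inl_desc, Category.id_comp]
        · rw [coprod.inr_map, coprod.inr_desc]
      rw [← e1, ← e2, c.coassoc])
    (fun x => by
      change homAdd c F 0 x = x
      conv_lhs => rw [← map_zero_comp F x]
      nth_rw 2 [← hid x]
      rw [homAdd_map, c.counit_left, hid])
    (fun x => by
      change homAdd c F (F.map c.neg ≫ x) x = 0
      nth_rw 2 [← hid x]
      rw [homAdd_map, c.neg_left, map_zero_comp])

lemma homAdd_comp {X Y : C} (a b : F.obj T ⟶ X) (f : X ⟶ Y) :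
    homAdd c F a b ≫ f = homAdd c F (a ≫ f) (b ≫ f) := by
  obtain ⟨m, rfl, rfl⟩ := exists_factor F a b
  simp only [homAdd_map, Category.assoc]

variable {F G} in
lemma comp_homAdd (φ : F ⟶ G) {X : C} (a b : G.obj T ⟶ X) :
    φ.app T ≫ homAdd c G a b = homAdd c F (φ.app T ≫ a) (φ.app T ≫ b) := by
  obtain ⟨m, rfl, rfl⟩ := exists_factor G a b
  simp only [homAdd_map, ← NatTrans.naturality_assoc]

lemma map_homAdd {X : C} (a b : F.obj T ⟶ X) :
    G.map (homAdd c F a b) = homAdd c (F ⋙ G) (G.map a) (G.map b) := by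
  obtain ⟨m, rfl, rfl⟩ := exists_factor F a b
  simp only [homAdd_map, Functor.map_comp, ← Functor.comp_map]

end

end Cogroups

section Powers

variable {C : Type u} [Category.{v} C] [MonoidalCategory C]

/-- The smash powers `T ⊗ (T ⊗ (⋯ ⊗ 𝟙_ C))`. -/
def tpow (T : C) : ℕ → C
  | 0 => 𝟙_ C
  | k + 1 => T ⊗ tpow T k

/-- The associativity isomorphism splitting off the last factor. -/
def snoc (T : C) : ∀ k, tpow T k ⊗ T ≅ tpow T (k + 1)
  | 0 => λ_ T ≪≫ (ρ_ T).symm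
  | k + 1 => α_ T (tpow T k) T ≪≫ whiskerLeftIso T (snoc T k)

/-- The associativity isomorphism concatenating two powers. -/
def append (T : C) (k' : ℕ) : ∀ k, tpow T k ⊗ tpow T k' ≅ tpow T (k' + k)
  | 0 => λ_ (tpow T k')
  | k + 1 => α_ T (tpow T k) (tpow T k') ≪≫ whiskerLeftIso T (append T k' k)

/-- The stabilisation of `f : V ⊗ T^k ⟶ X` along `σ : X ⊗ T ⟶ Y`. -/
def stab {T V X Y : C} (σ : X ⊗ T ⟶ Y) {k : ℕ} (f : V ⊗ tpow T k ⟶ X) :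
    V ⊗ tpow T (k + 1) ⟶ Y :=
  V ◁ (snoc T k).inv ≫ (α_ V (tpow T k) T).inv ≫ f ▷ T ≫ σ

lemma stab_natural {T V V' X X' Y Y' : C} (σ : X ⊗ T ⟶ Y) (σ' : X' ⊗ T ⟶ Y') (α : V' ⟶ V)
    (φ : X ⟶ X') (φ' : Y ⟶ Y') (h : σ ≫ φ' = φ ▷ T ≫ σ') {k : ℕ} (f : V ⊗ tpow T k ⟶ X) :
    α ▷ tpow T (k + 1) ≫ stab σ f ≫ φ' = stab σ' (α ▷ tpow T k ≫ f ≫ φ) := by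
  simp only [stab, Category.assoc, comp_whiskerRight, h]
  rw [← whisker_exchange_assoc, associator_inv_naturality_left_assoc]

/-- The endomorphism of `T^k` given by `u` on the first factor (and the identity for `k = 0`). -/
def onFirst {T : C} (u : T ⟶ T) : ∀ k, tpow T k ⟶ tpow T k
  | 0 => 𝟙 _
  | k + 1 => u ▷ tpow T k

lemma stab_onFirst {T V X Y : C} (σ : X ⊗ T ⟶ Y) (u : T ⟶ T) {k : ℕ}
    (f : V ⊗ (T ⊗ tpow T k) ⟶ X) :
    stab σ (k := k + 1) (V ◁ onFirst u (k + 1) ≫ f) =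
      V ◁ onFirst u (k + 2) ≫ stab σ (k := k + 1) f := by
  have h : u ▷ tpow T (k + 1) ≫ T ◁ (snoc T k).inv ≫ (α_ T (tpow T k) T).inv =
      T ◁ (snoc T k).inv ≫ (α_ T (tpow T k) T).inv ≫ (u ▷ tpow T k) ▷ T := by
    rw [← whisker_exchange_assoc, associator_inv_naturality_left]
  have h' : V ◁ (u ▷ tpow T (k + 1)) ≫ V ◁ (T ◁ (snoc T k).inv ≫ (α_ T (tpow T k) T).inv) ≫
      (α_ V (T ⊗ tpow T k) T).inv =
      V ◁ (T ◁ (snoc T k).inv ≫ (α_ T (tpow T k) T).inv) ≫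
      (α_ V (T ⊗ tpow T k) T).inv ≫ (V ◁ (u ▷ tpow T k)) ▷ T := by
    rw [← whiskerLeft_comp_assoc, h]
    simp
  change V ◁ (T ◁ (snoc T k).inv ≫ (α_ T (tpow T k) T).inv) ≫
    (α_ V (T ⊗ tpow T k) T).inv ≫ (V ◁ (u ▷ tpow T k) ≫ f) ▷ T ≫ σ =
    V ◁ (u ▷ tpow T (k + 1)) ≫ V ◁ (T ◁ (snoc T k).inv ≫ (α_ T (tpow T k) T).inv) ≫
    (α_ V (T ⊗ tpow T k) T).inv ≫ f ▷ T ≫ σ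
  rw [reassoc_of% h', comp_whiskerRight, Category.assoc]

/-- Transport of a map `V ⊗ T^k ⟶ X n` along equalities of indices. -/
def reindex {T V : C} {X : ℕ → C} {k k' n n' : ℕ} (hk : k' = k) (hn : n = n')
    (f : V ⊗ tpow T k ⟶ X n) : V ⊗ tpow T k' ⟶ X n' :=
  V ◁ eqToHom (congrArg (tpow T) hk) ≫ f ≫ eqToHom (congrArg X hn)

/-- A `T`-spectrum. -/
structure TSpectrum (C : Type u) [Category.{v} C] [MonoidalCategory C] (T : C) where
  X : ℕ → C
  σ : ∀ n, X n ⊗ T ⟶ X (n + 1)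

/-- A morphism of `T`-spectra. -/
@[ext]
structure TSpectrum.Hom {T : C} (E F : TSpectrum C T) where
  app : ∀ n, E.X n ⟶ F.X n
  comm : ∀ n, E.σ n ≫ app (n + 1) = app n ▷ T ≫ F.σ n

/-- The image of a `T`-spectrum under a lax monoidal functor. -/
def TSpectrum.mapLax {C' : Type*} [Category* C'] [MonoidalCategory C'] {T : C}
    (E : TSpectrum C T) (L : C ⥤ C') [L.LaxMonoidal] : TSpectrum C' (L.obj T) where
  X n := L.obj (E.X n)
  σ n := Functor.LaxMonoidal.μ L (E.X n) T ≫ L.map (E.σ n)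

def TSpectrum.Hom.mapLax {C' : Type*} [Category* C'] [MonoidalCategory C'] {T : C}
    {E F : TSpectrum C T} (φ : E.Hom F) (L : C ⥤ C') [L.LaxMonoidal] :
    (E.mapLax L).Hom (F.mapLax L) where
  app n := L.map (φ.app n)
  comm n := by
    simp [TSpectrum.mapLax, ← Functor.map_comp, φ.comm]

end Powers

section StableGroups

variable {C : Type u} [Category.{v} C] [MonoidalCategory C]
  [HasZeroMorphisms C] [HasBinaryCoproducts C]
  [∀ P : C, PreservesColimitsOfShape (Discrete WalkingPair) (tensorLeft P)]
  [∀ P : C, PreservesColimitsOfShape (Discrete WalkingPair) (tensorRight P)]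

/-- The functor `B ↦ V ⊗ (B ⊗ A)`. -/
abbrev sandwich (V A : C) : C ⥤ C := tensorRight A ⋙ tensorLeft V

variable {T : C} (c : Cogroup T)

/-- The set of morphisms `V ⊗ T^(a+1) ⟶ X`. -/
def Stage (_ : Cogroup T) (V X : C) (a : ℕ) : Type v := V ⊗ tpow T (a + 1) ⟶ X

/-- The group structure coming from the cogroup structure on the first factor `T`. -/
instance (V X : C) (a : ℕ) : AddGroup (Stage c V X a) :=
  homAddGroup c (sandwich V (tpow T a)) X

variable {c} in
lemma Stage.add_def {V X : C} {a : ℕ} (x y : Stage c V X a) :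
    x + y = homAdd c (sandwich V (tpow T a)) (X := X) x y := rfl

lemma homAdd_interchange {V A X : C} (x y z w : V ⊗ (T ⊗ (T ⊗ A)) ⟶ X) :
    homAdd c (sandwich V (T ⊗ A)) (homAdd c (sandwich T A ⋙ tensorLeft V) x y)
        (homAdd c (sandwich T A ⋙ tensorLeft V) z w) =
      homAdd c (sandwich T A ⋙ tensorLeft V) (homAdd c (sandwich V (T ⊗ A)) x z)
        (homAdd c (sandwich V (T ⊗ A)) y w) := by
  let φ {B B' : C} (u : B ⟶ B') :
      sandwich B A ⋙ tensorLeft V ⟶ sandwich B' A ⋙ tensorLeft V :=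
    { app Y := V ◁ (u ▷ (Y ⊗ A))
      naturality Y Y' g := by
        change V ◁ B ◁ g ▷ A ≫ V ◁ (u ▷ (Y' ⊗ A)) = V ◁ (u ▷ (Y ⊗ A)) ≫ V ◁ B' ◁ g ▷ A
        rw [← whiskerLeft_comp, whisker_exchange, whiskerLeft_comp] }
  obtain ⟨m, h1, h2⟩ := exists_factor (sandwich V (T ⊗ A)) x z
  obtain ⟨n, h3, h4⟩ := exists_factor (sandwich V (T ⊗ A)) y w
  have e (i : T ⟶ T ⨿ T) : homAdd c (sandwich T A ⋙ tensorLeft V)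
      ((sandwich V (T ⊗ A)).map i ≫ m) ((sandwich V (T ⊗ A)).map i ≫ n) =
      (sandwich V (T ⊗ A)).map i ≫ homAdd c (sandwich (T ⨿ T) A ⋙ tensorLeft V) m n :=
    (comp_homAdd c (φ i) m n).symm
  have e' (i : T ⟶ T ⨿ T) : (sandwich V (T ⊗ A)).map i ≫
      homAdd c (sandwich (T ⨿ T) A ⋙ tensorLeft V) m n =
      homAdd c (sandwich T A ⋙ tensorLeft V)
      ((sandwich V (T ⊗ A)).map i ≫ m) ((sandwich V (T ⊗ A)).map i ≫ n) :=
    (comp_homAdd c (φ i) m n)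
  rw [← h1, ← h2, ← h3, ← h4, e, e, homAdd_map, homAdd_map, homAdd_map]
  exact e' _

instance (V X : C) (a : ℕ) : AddCommGroup (Stage c V X (a + 1)) where
  add_comm x y := by
    have h1 := EckmannHilton.AddZeroClass.IsUnital (X := Stage c V X (a + 1))
    have h2 := EckmannHilton.AddZeroClass.IsUnital (_G := (homAddGroup c
      (sandwich T (tpow T a) ⋙ tensorLeft V) X).toSubNegMonoid.toAddMonoid.toAddZeroClass)
    exact (EckmannHilton.mul_comm h2 h1 (fun a b c d =>
      (homAdd_interchange _ _ _ _ _).symm)).comm x y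

lemma stab_homAdd {V X Y : C} (σ : X ⊗ T ⟶ Y) (a : ℕ)
    (f g : (sandwich V (tpow T a)).obj T ⟶ X) :
    stab σ (k := a + 1) (homAdd c (sandwich V (tpow T a)) f g) =
      homAdd c (sandwich V (tpow T (a + 1))) (stab σ (k := a + 1) f) (stab σ (k := a + 1) g) := by
  let φ : sandwich V (tpow T (a + 1)) ⟶ sandwich V (tpow T a) ⋙ tensorRight T :=
    { app B := V ◁ (B ◁ (snoc T a).inv ≫ (α_ B (tpow T a) T).inv) ≫
        (α_ V (B ⊗ tpow T a) T).inv
      naturality B B' u := by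
        change V ◁ (u ▷ _) ≫ V ◁ (B' ◁ (snoc T a).inv ≫ _) ≫ _ =
          (V ◁ (B ◁ (snoc T a).inv ≫ _) ≫ _) ≫ (V ◁ (u ▷ _)) ▷ T
        simp only [whiskerLeft_comp, Category.assoc, whisker_assoc, Iso.inv_hom_id_assoc]
        rw [← whiskerLeft_comp_assoc, ← whisker_exchange, whiskerLeft_comp_assoc]
        simp }
  have h (f : V ⊗ tpow T (a + 1) ⟶ X) : stab σ f = φ.app T ≫ (tensorRight T).map f ≫ σ := by
    change V ◁ (T ◁ (snoc T a).inv ≫ (α_ T (tpow T a) T).inv) ≫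
      (α_ V (T ⊗ tpow T a) T).inv ≫ f ▷ T ≫ σ =
      (V ◁ (T ◁ (snoc T a).inv ≫ (α_ T (tpow T a) T).inv) ≫ (α_ V (T ⊗ tpow T a) T).inv) ≫
      f ▷ T ≫ σ
    rw [Category.assoc]
  refine (h _).trans ?_
  rw [map_homAdd, homAdd_comp, comp_homAdd]
  exact congrArg₂ (homAdd c (sandwich V (tpow T (a + 1)))) (h f).symm (h g).symm

/-- The stabilisation map as a group homomorphism. -/
def stabHom {V X Y : C} (σ : X ⊗ T ⟶ Y) (a : ℕ) : Stage c V X a →+ Stage c V Y (a + 1) :=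
  AddMonoidHom.mk' (fun f => stab σ f) (fun f g => stab_homAdd c σ a f g)

section

variable (V : C) (E : TSpectrum C T) (q : ℤ)

/-- The groups `[V ⊗ T^(q+m), E_m]`, with `m = (2 - q).toNat + j`. -/
abbrev piStage (j : ℕ) : Type v :=
  Stage c V (E.X ((2 - q).toNat + j)) ((q - 2).toNat + j + 1)

def piStep {i j : ℕ} (h : i ≤ j) : piStage c V E q i →+ piStage c V E q j :=
  Nat.leRec (motive := fun j _ => piStage c V E q i →+ piStage c V E q j) (AddMonoidHom.id _)
    (fun j _ f => (stabHom c (E.σ ((2 - q).toNat + j)) _).comp f) h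

lemma piStep_succ {i j : ℕ} (h : i ≤ j) : piStep c V E q (h.trans j.le_succ) =
    (stabHom c (E.σ ((2 - q).toNat + j)) _).comp (piStep c V E q h) :=
  Nat.leRec_succ _ _ _

/-- The stable homotopy group `π_q^V(E) = colim_m [V ⊗ T^(q+m), E_m]`. The colimit is taken over
those `m` with `q + m ≥ 2`, which are cofinal. -/
abbrev StablePi : Type v :=
  AddCommGroup.DirectLimit (piStage c V E q) (fun _ _ h => piStep c V E q h)

variable {V E q}

/-- The class of `f : V ⊗ T^k ⟶ E_n` in `π_q^V(E)`, where `k = q + n ≥ 1`. -/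
def cls {k n : ℕ} (hq : (k : ℤ) = q + n) (hk : 1 ≤ k) (f : V ⊗ tpow T k ⟶ E.X n) :
    StablePi c V E q :=
  AddCommGroup.DirectLimit.of _ _ (n + 1 - (2 - q).toNat)
    (reindex (X := E.X) (by omega) (by omega) (stab (E.σ n) f) :
      piStage c V E q (n + 1 - (2 - q).toNat))

lemma map_piStep {V' : C} {E' : TSpectrum C T}
    (g : ∀ j, piStage c V E q j →+ piStage c V' E' q j)
    (hg : ∀ j x, g (j + 1) (stabHom c (E.σ _) _ x) = stabHom c (E'.σ _) _ (g j x))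
    (i j : ℕ) (h : i ≤ j) :
    (g j).comp (piStep c V E q h) = (piStep c V' E' q h).comp (g i) := by
  induction j, h using Nat.le_induction with
  | base => ext x; simp [piStep]
  | succ j h ih =>
    ext x
    have e1 := piStep_succ c V E q h
    have e2 := piStep_succ c V' E' q h
    have := DFunLike.congr_fun ih x
    simp only [AddMonoidHom.comp_apply] at this ⊢
    rw [e1, e2]
    exact (hg j _).trans (congrArg (stabHom c (E'.σ ((2 - q).toNat + j)) _) this)

/-- The homomorphism induced by a map `α : V' ⟶ V` and a morphism of spectra. -/
def piMap {V' : C} {E' : TSpectrum C T} (α : V' ⟶ V) (φ : E.Hom E') (q : ℤ) :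
    StablePi c V E q →+ StablePi c V' E' q :=
  AddCommGroup.DirectLimit.map (fun j => AddMonoidHom.mk'
      (fun (x : V ⊗ tpow T _ ⟶ _) => (α ▷ tpow T _ ≫ x ≫ φ.app _ : V' ⊗ tpow T _ ⟶ _))
      (fun x y => by
        let ψ : sandwich V' (tpow T ((q - 2).toNat + j + 1)) ⟶
            sandwich V (tpow T ((q - 2).toNat + j + 1)) :=
          { app B := α ▷ (B ⊗ tpow T _)
            naturality B B' u := (whisker_exchange _ _) }
        exact (congrArg (ψ.app T ≫ ·) (homAdd_comp c (sandwich V (tpow T _)) _ _ _)).trans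
          (comp_homAdd c ψ _ _)))
    (map_piStep c _ (fun j x => by
      change α ▷ tpow T _ ≫ stab (E.σ _) x ≫ φ.app _ =
        stab (E'.σ _) (α ▷ tpow T _ ≫ x ≫ φ.app _)
      exact stab_natural _ _ α _ _ (φ.comm _) x))

/-- The action of an endomorphism `u` of `T` that satisfies `u ⊗ 1 = 1 ⊗ u` on `T ⊗ T`, by
precomposition on the first factor `T`. -/
def piTwist (u : T ⟶ T) (hu : u ▷ T = T ◁ u) : StablePi c V E q →+ StablePi c V E q :=
  AddCommGroup.DirectLimit.map (fun j => AddMonoidHom.mk'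
      (fun (x : V ⊗ tpow T _ ⟶ _) => (V ◁ onFirst u _ ≫ x : V ⊗ tpow T _ ⟶ _))
      (fun x y => by
        let A := tpow T ((q - 2).toNat + j)
        let ψ : sandwich V (T ⊗ A) ⟶ sandwich V (T ⊗ A) :=
          { app B := V ◁ (B ◁ (u ▷ A))
            naturality B B' f := by
              change V ◁ (f ▷ _) ≫ V ◁ (B' ◁ (u ▷ A)) = V ◁ (B ◁ (u ▷ A)) ≫ V ◁ (f ▷ _)
              rw [← whiskerLeft_comp, ← whisker_exchange, whiskerLeft_comp] }
        have h : V ◁ (u ▷ (T ⊗ A)) = V ◁ (T ◁ (u ▷ A)) := by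
          rw [← cancel_mono (V ◁ (α_ T T A).inv), ← whiskerLeft_comp, ← whiskerLeft_comp,
            associator_inv_naturality_left, hu, associator_inv_naturality_middle]
        change V ◁ (u ▷ (T ⊗ A)) ≫ homAdd c (sandwich V (T ⊗ A)) x y =
          homAdd c (sandwich V (T ⊗ A)) (V ◁ (u ▷ (T ⊗ A)) ≫ x) (V ◁ (u ▷ (T ⊗ A)) ≫ y)
        rw [h]
        exact comp_homAdd c ψ _ _))
    (map_piStep c _ (fun j x => (stab_onFirst _ u _).symm))

end

end StableGroups

section Signs

variable {C : Type u} [Category.{v} C] [MonoidalCategory C]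

/-- The graph of the action of the symmetric groups on the powers of `T`: `PermMap T k τ g` says
that `g` is the automorphism of `T^k` given by the permutation `τ` of the factors. -/
inductive PermMap [SymmetricCategory C] (T : C) :
    ∀ k : ℕ, Equiv.Perm (Fin k) → (tpow T k ⟶ tpow T k) → Prop
  | one (k : ℕ) : PermMap T k 1 (𝟙 (tpow T k))
  | mul {k : ℕ} {τ τ' : Equiv.Perm (Fin k)} {g g' : tpow T k ⟶ tpow T k} :
      PermMap T k τ g → PermMap T k τ' g' → PermMap T k (τ * τ') (g' ≫ g)
  | swap (k : ℕ) : PermMap T (k + 2) (Equiv.swap 0 1)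
      ((α_ T T (tpow T k)).inv ≫ (β_ T T).hom ▷ tpow T k ≫ (α_ T T (tpow T k)).hom)
  | cons {k : ℕ} {τ : Equiv.Perm (Fin k)} {g : tpow T k ⟶ tpow T k} :
      PermMap T k τ g → PermMap T (k + 1) (Equiv.Perm.decomposeFin.symm (0, τ)) (T ◁ g)

/-- A sign `(-1)_T` of `T`. -/
structure TSign [SymmetricCategory C] (T : C) where
  aut : Aut T
  mul_self : aut * aut = 1
  perm {k : ℕ} {τ : Equiv.Perm (Fin (k + 1))} {g : tpow T (k + 1) ⟶ tpow T (k + 1)} :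
    PermMap T (k + 1) τ g →
      g = onFirst (if Equiv.Perm.sign τ = 1 then 𝟙 T else aut.hom) (k + 1)
  whisker : aut.hom ▷ T = T ◁ aut.hom

namespace TSign

variable [SymmetricCategory C] {T : C} (s : TSign T)

/-- The power `(-1)_T^m`. -/
def pow (m : ℤ) : T ⟶ T := (s.aut ^ m).hom

lemma pow_whisker (m : ℤ) : s.pow m ▷ T = T ◁ s.pow m := by
  have h : s.aut ^ (2 : ℤ) = 1 := by rw [zpow_two, s.mul_self]
  rcases Int.even_or_odd' m with ⟨n, rfl | rfl⟩
  · rw [pow, zpow_mul, h, one_zpow]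
    exact (id_whiskerRight T T).trans (whiskerLeft_id T T).symm
  · rw [pow, zpow_add, zpow_mul, h, one_zpow, one_mul, zpow_one, s.whisker]

/-- The sign `|τ|_T` of a permutation. -/
def ofPerm {k : ℕ} (τ : Equiv.Perm (Fin k)) : T ⟶ T :=
  if Equiv.Perm.sign τ = 1 then 𝟙 T else s.aut.hom

end TSign

end Signs

section MonoidAction

variable {C : Type u} [Category.{v} C] [MonoidalCategory C]

/-- The iterated stabilisation. -/
def stabIter {T V : C} (E : TSpectrum C T) {k n : ℕ} (f : V ⊗ tpow T k ⟶ E.X n) :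
    ∀ j, V ⊗ tpow T (k + j) ⟶ E.X (n + j)
  | 0 => f
  | j + 1 => stab (E.σ (n + j)) (stabIter E f j)

variable [SymmetricCategory C]
  [HasZeroMorphisms C] [HasBinaryCoproducts C]
  [∀ P : C, PreservesColimitsOfShape (Discrete WalkingPair) (tensorLeft P)]
  [∀ P : C, PreservesColimitsOfShape (Discrete WalkingPair) (tensorRight P)]

/-- The graph of the action of an injection `f : ℕ → ℕ` on the stable homotopy groups of a spectrum
`E` whose levels carry actions `p` of the symmetric groups. It sends the class `x` of
`g : V ⊗ T^k ⟶ E_m` to the class `y` of the composition of the sign `|γ|_T`, the stabilisation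
`V ⊗ T^(k+j) ⟶ E_(m+j)` of `g` and `γ`, where `γ` is any permutation of `m + j` elements that agrees
with `f` on the first `m` elements. -/
def InjActsTo {T : C} (c : Cogroup T) (s : TSign T) (V : C) (E : TSpectrum C T)
    (p : ∀ n, Equiv.Perm (Fin n) →* End (E.X n)) (q : ℤ) (f : ℕ → ℕ)
    (x y : StablePi c V E q) : Prop :=
  ∃ (k m j : ℕ) (hq : (k : ℤ) = q + m) (hk : 2 ≤ k) (g : V ⊗ tpow T k ⟶ E.X m)
    (γ : Equiv.Perm (Fin (m + j))),
    (∀ i : Fin m, (γ (Fin.castAdd j i) : ℕ) = f i) ∧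
    x = cls c hq (by omega) g ∧
    y = cls c (k := k + j) (n := m + j) (by omega) (by omega)
      (V ◁ onFirst (s.ofPerm γ) (k + j) ≫ stabIter E g j ≫ p (m + j) γ)

end MonoidAction

section RingSpectra

variable {C : Type u} [Category.{v} C] [MonoidalCategory C] [SymmetricCategory C]

/-- The block permutation moving the first `n` elements past the last `m` elements. -/
def blockPerm (n m : ℕ) : Equiv.Perm (Fin (n + m)) :=
  finAddFlip.trans (finCongr (Nat.add_comm m n))

/-- The inclusion of `Σ_n × Σ_m` in `Σ_(n+m)`. -/
def permSum {n m : ℕ} (γ : Equiv.Perm (Fin n)) (δ : Equiv.Perm (Fin m)) :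
    Equiv.Perm (Fin (n + m)) :=
  finSumFinEquiv.permCongr (Equiv.sumCongr γ δ)

/-- A symmetric `T`-ring spectrum. -/
structure SymRingSpectrum (C : Type u) [Category.{v} C] [MonoidalCategory C]
    [SymmetricCategory C] (T : C) where
  X : ℕ → C
  perm : ∀ n, Equiv.Perm (Fin n) →* End (X n)
  mul : ∀ n m, X n ⊗ X m ⟶ X (n + m)
  ι₀ : 𝟙_ C ⟶ X 0
  ι₁ : T ⟶ X 1
  equivariant (n m : ℕ) (γ : Equiv.Perm (Fin n)) (δ : Equiv.Perm (Fin m)) :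
    ((perm n γ : X n ⟶ X n) ⊗ₘ (perm m δ : X m ⟶ X m)) ≫ mul n m =
      mul n m ≫ perm (n + m) (permSum γ δ)
  assoc (n m l : ℕ) : mul n m ▷ X l ≫ mul (n + m) l =
    (α_ (X n) (X m) (X l)).hom ≫ X n ◁ mul m l ≫ mul n (m + l) ≫
      eqToHom (congrArg X (Nat.add_assoc n m l).symm)
  mul_unit (n : ℕ) : X n ◁ ι₀ ≫ mul n 0 = (ρ_ (X n)).hom
  unit_mul (n : ℕ) : ι₀ ▷ X n ≫ mul 0 n =
    (λ_ (X n)).hom ≫ eqToHom (congrArg X (Nat.zero_add n).symm)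
  central (n : ℕ) : X n ◁ ι₁ ≫ mul n 1 ≫ perm (n + 1) (blockPerm n 1) ≫
      eqToHom (congrArg X (Nat.add_comm n 1)) =
    (β_ (X n) T).hom ≫ ι₁ ▷ X n ≫ mul 1 n

namespace SymRingSpectrum

variable {T : C} (R : SymRingSpectrum C T)

/-- Commutativity of a symmetric ring spectrum. -/
def IsCommutative : Prop := ∀ n m : ℕ,
  R.mul n m ≫ R.perm (n + m) (blockPerm n m) ≫ eqToHom (congrArg R.X (Nat.add_comm n m)) =
    (β_ (R.X n) (R.X m)).hom ≫ R.mul m n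

/-- Central maps. -/
def IsCentral {A : C} {n : ℕ} (f : A ⟶ R.X n) : Prop := ∀ m : ℕ,
  f ▷ R.X m ≫ R.mul n m ≫ R.perm (n + m) (blockPerm n m) ≫
      eqToHom (congrArg R.X (Nat.add_comm n m)) =
    (β_ A (R.X m)).hom ≫ R.X m ◁ f ≫ R.mul m n

/-- The underlying `T`-spectrum. -/
def spectrum : TSpectrum C T where
  X := R.X
  σ n := R.X n ◁ R.ι₁ ≫ R.mul n 1

/-- A morphism of symmetric ring spectra. -/
@[ext]
structure Hom (R R' : SymRingSpectrum C T) where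
  app : ∀ n, R.X n ⟶ R'.X n
  perm (n : ℕ) (γ : Equiv.Perm (Fin n)) :
    (R.perm n γ : R.X n ⟶ R.X n) ≫ app n = app n ≫ R'.perm n γ
  mul (n m : ℕ) : R.mul n m ≫ app (n + m) = (app n ⊗ₘ app m) ≫ R'.mul n m
  unit₀ : R.ι₀ ≫ app 0 = R'.ι₀
  unit₁ : R.ι₁ ≫ app 1 = R'.ι₁

/-- The underlying morphism of `T`-spectra. -/
def Hom.spectrum {R R' : SymRingSpectrum C T} (φ : R.Hom R') : R.spectrum.Hom R'.spectrum where
  app := φ.app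
  comm n := by
    change (R.X n ◁ R.ι₁ ≫ R.mul n 1) ≫ φ.app (n + 1) =
      φ.app n ▷ T ≫ R'.X n ◁ R'.ι₁ ≫ R'.mul n 1
    rw [Category.assoc, φ.mul, MonoidalCategory.tensorHom_def', ← φ.unit₁,
      MonoidalCategory.whiskerLeft_comp]
    simp only [← MonoidalCategory.whiskerLeft_comp_assoc, Category.assoc,
      MonoidalCategory.whisker_exchange_assoc]

end SymRingSpectrum

/-- The product of `f : A ⊗ U ⊗ T^k ⟶ X` and `g : A' ⊗ U ⊗ T^k' ⟶ X'`: the composition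
`P ⊗ U ⊗ T^(k+k') ⟶ A ⊗ A' ⊗ U ⊗ U ⊗ T^k ⊗ T^k' ⟶ A ⊗ U ⊗ T^k ⊗ A' ⊗ U ⊗ T^k' ⟶ X ⊗ X' ⟶ Y`
of `s ⊗ d ⊗ e ⊗ 1`, where `e` acts on the first factor `T`, of the symmetry of `A' ⊗ U` and
`U ⊗ T^k`, of `f ⊗ g`, and of `μ`. -/
def prodRep {T U A A' P X X' Y : C} (s : P ⟶ A ⊗ A') (d : U ⟶ U ⊗ U) (e : T ⟶ T)
    (μ : X ⊗ X' ⟶ Y) {k k' : ℕ} (f : (A ⊗ U) ⊗ tpow T k ⟶ X) (g : (A' ⊗ U) ⊗ tpow T k' ⟶ X') :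
    (P ⊗ U) ⊗ tpow T (k' + k) ⟶ Y :=
  ((s ⊗ₘ d) ⊗ₘ (onFirst e (k' + k) ≫ (append T k' k).inv)) ⊗≫
    A ◁ ((β_ (A' ⊗ U) (U ⊗ tpow T k)).hom ▷ tpow T k') ⊗≫ (f ⊗ₘ g) ≫ μ

/-- The comparison `(L T)^k ⟶ L (T^k)` for a lax monoidal functor `L`. -/
def tpowComparison {C' : Type*} [Category* C'] [MonoidalCategory C'] (L : C ⥤ C')
    [L.LaxMonoidal] (T : C) : ∀ k, tpow (L.obj T) k ⟶ L.obj (tpow T k)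
  | 0 => Functor.LaxMonoidal.ε L
  | k + 1 => L.obj T ◁ tpowComparison L T k ≫ Functor.LaxMonoidal.μ L T (tpow T k)

end RingSpectra

section HomotopyRing

variable {D : Type u} [Category.{v} D] [MonoidalCategory D] [SymmetricCategory D]
  [MonoidalClosed D] [ModelCategory D] [HasZeroObject D] [MonoidalModelCategory D]
  [(weakEquivalences D).IsMonoidal]
  {T : D} (c : Cogroup ((toHo D).obj T)) (s : TSign ((toHo D).obj T))
  {N : Type w} [AddCommMonoid N] (S : Discrete N ⥤ D) [S.Monoidal]

/-- The object `𝕊^r ⊗ U` of the homotopy category. -/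
abbrev sphere (r : N) (U : D) : Ho D := (toHo D).obj (S.obj ⟨r⟩) ⊗ (toHo D).obj U

/-- The spectrum in the homotopy category underlying a symmetric ring spectrum. -/
abbrev hoSpectrum (R : SymRingSpectrum D T) : TSpectrum (Ho D) ((toHo D).obj T) :=
  R.spectrum.mapLax (toHo D)

/-- The stable homotopy group `π_{r,q}^U(R) = π_q^{𝕊^r ⊗ U}(R)`. -/
abbrev ringPi (U : D) (R : SymRingSpectrum D T) (r : N) (q : ℤ) : Type (max u v) :=
  StablePi c (sphere S r U) (hoSpectrum R) q

/-- Semistability: the monoid of injections `ℕ → ℕ` acts trivially on `π_q^{𝕊^r ⊗ U}(R)` for all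
`U` in `B'`. -/
def IsSemistable (B' : ObjectProperty D) (R : SymRingSpectrum D T) : Prop :=
  ∀ U, B' U → ∀ (r : N) (q : ℤ) (f : ℕ → ℕ), Function.Injective f →
    ∀ x y : ringPi c S U R r q,
      InjActsTo c s (sphere S r U) (hoSpectrum R)
        (fun n => ((toHo D).mapEnd (R.X n)).comp (R.perm n)) q f x y → y = x

/-- The product of representatives of elements of `π_{r,q}^U(R)` and `π_{r',q'}^U(R)`, with the
sign `(-1)_T^(q' n)`. -/
def unstableProd {U : D} [ComonObj U] (R : SymRingSpectrum D T) (q' : ℤ) {r r' : N}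
    {k n k' n' : ℕ} (f : sphere S r U ⊗ tpow ((toHo D).obj T) k ⟶ (hoSpectrum R).X n)
    (g : sphere S r' U ⊗ tpow ((toHo D).obj T) k' ⟶ (hoSpectrum R).X n') :
    sphere S (r + r') U ⊗ tpow ((toHo D).obj T) (k' + k) ⟶ (hoSpectrum R).X (n + n') :=
  prodRep
    ((toHo D).map (Functor.OplaxMonoidal.δ S ⟨r⟩ ⟨r'⟩) ≫ Functor.OplaxMonoidal.δ (toHo D) _ _)
    ((toHo D).map (ComonObj.comul (X := U)) ≫ Functor.OplaxMonoidal.δ (toHo D) _ _)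
    (s.pow (q' * n)) (Functor.LaxMonoidal.μ (toHo D) _ _ ≫ (toHo D).map (R.mul n n')) f g

/-- The map `t_{r',r} : π_{r'+r,q}^U(R) ⟶ π_{r+r',q}^U(R)` induced by the symmetry
`𝕊^(r+r') ≅ 𝕊^r ⊗ 𝕊^r' ≅ 𝕊^r' ⊗ 𝕊^r ≅ 𝕊^(r'+r)`. -/
def tMap {U : D} {R : SymRingSpectrum D T} (r' r : N) (q : ℤ) :
    ringPi c S U R (r' + r) q →+ ringPi c S U R (r + r') q :=
  piMap c ((toHo D).map (Functor.OplaxMonoidal.δ S ⟨r⟩ ⟨r'⟩ ≫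
    (β_ (S.obj ⟨r⟩) (S.obj ⟨r'⟩)).hom ≫ Functor.LaxMonoidal.μ S ⟨r'⟩ ⟨r⟩) ▷ (toHo D).obj U)
    ⟨fun _ => 𝟙 _, fun _ => by simp⟩ q

/-- The homomorphism induced by a morphism of symmetric ring spectra. -/
def ringPiMap {U : D} {R R' : SymRingSpectrum D T} (φ : R.Hom R') (r : N) (q : ℤ) :
    ringPi c S U R r q →+ ringPi c S U R' r q :=
  piMap c (𝟙 _) (φ.spectrum.mapLax (toHo D)) q

/-- The action of `(-1)_T^m` on the stable homotopy groups. -/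
def signMap {U : D} {R : SymRingSpectrum D T} (m : ℤ) {r : N} {q : ℤ} :
    ringPi c S U R r q →+ ringPi c S U R r q :=
  piTwist c (s.pow m) (s.pow_whisker m)

/-- The morphism `𝕊^r ⊗ U ⊗ T^k ⟶ R_n` in the homotopy category given by one in `D`. -/
def repOfHom {U : D} {R : SymRingSpectrum D T} {r : N} {k n : ℕ}
    (f : (S.obj ⟨r⟩ ⊗ U) ⊗ tpow T k ⟶ R.X n) :
    sphere S r U ⊗ tpow ((toHo D).obj T) k ⟶ (hoSpectrum R).X n :=
  (Functor.LaxMonoidal.μ (toHo D) _ _ ⊗ₘ tpowComparison (toHo D) T k) ≫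
    Functor.LaxMonoidal.μ (toHo D) _ _ ≫ (toHo D).map f

/-- `unstableProd` as an operation on the groups `[𝕊^r ⊗ U ⊗ T^k, R_n]` with `k ≥ 1`. -/
def stageProd {U : D} [ComonObj U] {R : SymRingSpectrum D T} (q' : ℤ) {r r' : N} {a n a' n' : ℕ}
    (f : Stage c (sphere S r U) ((hoSpectrum R).X n) a)
    (g : Stage c (sphere S r' U) ((hoSpectrum R).X n') a') :
    Stage c (sphere S (r + r') U) ((hoSpectrum R).X (n + n')) (a' + 1 + a) :=
  unstableProd s S R q' (k := a + 1) (k' := a' + 1) f g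

/-- The family of groups `π_{*,*}^U(R)`. -/
abbrev gradedPi (U : D) (R : SymRingSpectrum D T) (p : N × ℤ) : Type (max u v) :=
  ringPi c S U R p.1 p.2

variable {c S}

/-- The product of homogeneous elements in a graded ring structure on `π_{*,*}^U(R)`. -/
def piMul {U : D} {R : SymRingSpectrum D T} (G : DirectSum.GRing (gradedPi c S U R))
    {r r' : N} {q q' : ℤ} (x : ringPi c S U R r q) (y : ringPi c S U R r' q') :
    ringPi c S U R (r + r') (q + q') :=
  G.mul (i := (r, q)) (j := (r', q')) x y

/-- The unit of a graded ring structure on `π_{*,*}^U(R)`. -/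
def piOne {U : D} {R : SymRingSpectrum D T} (G : DirectSum.GRing (gradedPi c S U R)) :
    ringPi c S U R (0 : N) 0 :=
  G.one

end HomotopyRing

end StableHtpy

end

open StableHtpy

/-! Everything takes place in the homotopy category, on representatives `f : P ⊗ T^k ⟶ E_n` of
degree `q = k - n`. The unsigned external product `RingStructure.star` of such maps is strictly
associative and natural. Stabilisation is itself a product: `x.stab` is `x` times the map `T ⟶ E_1`
given by `ι₁` (`stab_eq_star`). Stabilising the right factor therefore stabilises the product, by
associativity.

Stabilising the left factor is the real issue, since it compares `x·ι₁·y` with `x·y·ι₁`. By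
centrality of `ι₁` these differ by a block permutation of `E`, of sign `(-1)^n'`, and by a
permutation of the factors `T`, which acts as `(-1)^k'` (`permRel_stab_star`), where `y` has indices
`k'` and `n'`. Semistability turns the permutation of `E` into its sign on classes
(`cls_eq_of_permRel`). As `k' = q' + n'`, the total discrepancy is `(-1)^q'`, which is the change of
the factor `(-1)^(q'n)` when `n` becomes `n + 1` (`cls_stab_prod`). This is why the sign is in the
definition and why the product descends to the colimits.

The other properties are further sign counts. Associativity is `q'n + q''(n + n') = (q' + q'')n +
q''n'`. Commuting two factors gives `nn'` from `E` and `kk'` from the powers of `T`; together with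
the built-in `q'n` and `qn'` this is `qq'` modulo 2 (`gMul_comm`). The unit is the class of `ι₁`,
because `ι₀` has exponent `k = 0`; it is a right unit since multiplying by it is stabilisation, and
a left unit by semistability.

Additivity in the first factor is naturality of the cogroup addition. In the second factor the
addition sits on a later factor `T` of the product and is moved to the first one by Eckmann–Hilton
(`homAdd_bifunctor`).

The objects `𝕊^r ⊗ U` carry a graded comultiplication built from `S` and the comonoid `U`
(`sphereComon`). Its coassociativity, counits and commutativity up to the symmetry of the spheres
supply the diagonal `Δ` in all these products. -/

set_option linter.unusedSectionVars false
set_option linter.unusedSimpArgs false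

noncomputable section
namespace StableHtpy

/-! ### Coherence for powers of `T` and for the middle-four interchange. -/

section Coherence

variable {C : Type u} [Category.{v} C] [MonoidalCategory C]

/-- Transport along an equality of exponents. -/
def tcast (T : C) {k k' : ℕ} (h : k = k') : tpow T k ⟶ tpow T k' :=
  eqToHom (congrArg (tpow T) h)

@[simp] lemma tcast_rfl (T : C) (k : ℕ) : tcast T (rfl : k = k) = 𝟙 _ := rfl

lemma tcast_succ (T : C) {k k' : ℕ} (h : k = k') (h' : k + 1 = k' + 1) :
    tcast T h' = T ◁ tcast T h := by
  subst h
  exact (whiskerLeft_id T (tpow T k)).symm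

lemma append_succ (T : C) (k' k : ℕ) : (append T k' (k + 1)).hom =
    (α_ T (tpow T k) (tpow T k')).hom ≫ T ◁ (append T k' k).hom := rfl

/-- Induction on the length of the first block, along which `append` recurses. The two exponents
agree only propositionally, hence the transport `tcast`. -/
lemma append_assoc (T : C) (k k' k'' : ℕ) :
    (append T k' k).hom ▷ tpow T k'' ≫ (append T k'' (k' + k)).hom ≫
        tcast T (Nat.add_assoc k'' k' k).symm =
      (α_ _ _ _).hom ≫ tpow T k ◁ (append T k'' k').hom ≫ (append T (k'' + k') k).hom := by
  induction k with
  | zero =>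
    change (λ_ (tpow T k')).hom ▷ tpow T k'' ≫ (append T k'' k').hom ≫ 𝟙 _ =
      (α_ (𝟙_ C) _ _).hom ≫ 𝟙_ C ◁ (append T k'' k').hom ≫ (λ_ _).hom
    rw [Category.comp_id, leftUnitor_naturality, leftUnitor_tensor_hom]
    simp
  | succ k ih =>
    rw [tcast_succ T (Nat.add_assoc k'' k' k).symm]
    change ((α_ T (tpow T k) (tpow T k')).hom ≫ T ◁ (append T k' k).hom) ▷ tpow T k'' ≫
      ((α_ T (tpow T (k' + k)) (tpow T k'')).hom ≫ T ◁ (append T k'' (k' + k)).hom) ≫ _ =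
      (α_ (T ⊗ tpow T k) _ _).hom ≫ (T ⊗ tpow T k) ◁ (append T k'' k').hom ≫
      (α_ T (tpow T k) (tpow T (k'' + k'))).hom ≫ T ◁ (append T (k'' + k') k).hom
    have h := congrArg (fun z => (α_ T (tpow T k) (tpow T k')).hom ▷ tpow T k'' ≫
      (α_ _ _ _).hom ≫ T ◁ z) ih
    simp only [whiskerLeft_comp] at h
    simp only [comp_whiskerRight, Category.assoc, associator_naturality_middle_assoc, h]
    simp

/-- A factor `T` standing between two blocks may be attached to either of them. In `append_swap`
this lets one `T` at a time pass a block. -/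
lemma snoc_append (T : C) (k k' : ℕ) :
    (snoc T k').hom ▷ tpow T k ≫ (append T k (k' + 1)).hom =
      (α_ _ _ _).hom ≫ (append T (k + 1) k').hom ≫ tcast T (by omega) := by
  induction k' with
  | zero =>
    change ((λ_ T).hom ≫ (ρ_ T).inv) ▷ tpow T k ≫ (α_ T (𝟙_ C) (tpow T k)).hom ≫
      T ◁ (λ_ (tpow T k)).hom = (α_ (𝟙_ C) T (tpow T k)).hom ≫ (λ_ (T ⊗ tpow T k)).hom ≫ 𝟙 _
    simp
  | succ k' ih =>
    rw [tcast_succ T (show k + 1 + k' = k + (k' + 1) by omega)]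
    change ((α_ T (tpow T k') T).hom ≫ T ◁ (snoc T k').hom) ▷ tpow T k ≫
      (α_ T (tpow T (k' + 1)) (tpow T k)).hom ≫ T ◁ (append T k (k' + 1)).hom =
      (α_ (T ⊗ tpow T k') T (tpow T k)).hom ≫
      ((α_ T (tpow T k') (tpow T (k + 1))).hom ≫ T ◁ (append T (k + 1) k').hom) ≫ _
    have h := congrArg (fun z => (α_ T (tpow T k') T).hom ▷ tpow T k ≫
      (α_ _ _ _).hom ≫ T ◁ z) ih
    simp only [whiskerLeft_comp] at h
    simp only [comp_whiskerRight, Category.assoc, associator_naturality_middle_assoc, h]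
    have e : (α_ T (tpow T k') T).hom ▷ tpow T k ≫ (α_ T (tpow T k' ⊗ T) (tpow T k)).hom ≫
        T ◁ (α_ (tpow T k') T (tpow T k)).hom = (α_ (T ⊗ tpow T k') T (tpow T k)).hom ≫
        (α_ T (tpow T k') (T ⊗ tpow T k)).hom := by simp
    erw [whiskerLeft_comp, Category.assoc]
    exact (reassoc_of% e) _

/-- Compares the two ways of adding one last factor: `stab` uses `snoc`, whereas products use
`append` with `tpow T 1 = T ⊗ 𝟙_ C`. -/
lemma append_one (T : C) (k : ℕ) :
    (append T 1 k).hom =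
      tpow T k ◁ (ρ_ T).hom ≫ (snoc T k).hom ≫ tcast T (Nat.add_comm k 1) := by
  induction k with
  | zero =>
    change (λ_ (T ⊗ 𝟙_ C)).hom = 𝟙_ C ◁ (ρ_ T).hom ≫ ((λ_ T).hom ≫ (ρ_ T).inv) ≫ 𝟙 _
    rw [Category.assoc, leftUnitor_naturality_assoc]
    simp
  | succ k ih =>
    rw [tcast_succ T (Nat.add_comm k 1)]
    change (α_ T (tpow T k) (T ⊗ 𝟙_ C)).hom ≫ T ◁ (append T 1 k).hom =
      (T ⊗ tpow T k) ◁ (ρ_ T).hom ≫ ((α_ T (tpow T k) T).hom ≫ T ◁ (snoc T k).hom) ≫ _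
    rw [ih]
    simp

variable [SymmetricCategory C]

lemma tensorμ_unit_right (X Y Z : C) :
    tensorμ X (𝟙_ C) Y Z = (ρ_ X).hom ▷ _ ≫ (α_ X Y Z).inv ≫ (X ⊗ Y) ◁ (λ_ Z).inv := by
  simp only [tensorμ, braiding_tensorUnit_left]
  monoidal

/-- The symmetry exchanges the two outputs of the middle-four interchange. -/
lemma tensorμ_braiding (X₁ X₂ Y₁ Y₂ : C) :
    tensorμ X₁ X₂ Y₁ Y₂ ≫ (β_ (X₁ ⊗ Y₁) (X₂ ⊗ Y₂)).hom =
      ((β_ X₁ X₂).hom ⊗ₘ (β_ Y₁ Y₂).hom) ≫ tensorμ X₂ X₁ Y₂ Y₁ := by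
  dsimp only [tensorμ]
  simp only [BraidedCategory.braiding_tensor_left_hom, BraidedCategory.braiding_tensor_right_hom,
    MonoidalCategory.tensorHom_def]
  -- `X₂` and `Y₁` cross twice on the left: once in the interchange, once back in the outer
  -- symmetry. Symmetry makes the two crossings cancel, and the remaining ones match up to
  -- coherence.
  have h : (β_ Y₁ X₂).hom = (β_ X₂ Y₁).inv := by
    rw [SymmetricCategory.braiding_swap_eq_inv_braiding]
  rw [h]
  calc
    _ = 𝟙 _ ⊗≫ X₁ ◁ ((β_ X₂ Y₁).hom ≫ (β_ X₂ Y₁).inv) ▷ Y₂ ⊗≫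
        ((β_ X₁ X₂).hom ▷ (Y₁ ⊗ Y₂) ≫ (X₂ ⊗ X₁) ◁ (β_ Y₁ Y₂).hom) ⊗≫
        X₂ ◁ (β_ X₁ Y₂).hom ▷ Y₁ ⊗≫ 𝟙 _ := by
      monoidal
    _ = _ := by
      rw [Iso.hom_inv_id]
      monoidal

/-- The shuffle used in `prodRep` in terms of the middle-four interchange. -/
lemma shuffle_eq (A A' U V K K' : C) :
    ((A ⊗ A') ◁ (β_ U V).hom) ▷ (K ⊗ K') ⊗≫
        A ◁ ((β_ (A' ⊗ V) (U ⊗ K)).hom ▷ K') ⊗≫ 𝟙 (((A ⊗ U) ⊗ K) ⊗ ((A' ⊗ V) ⊗ K')) =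
      tensorμ A A' U V ▷ (K ⊗ K') ≫ tensorμ (A ⊗ U) (A' ⊗ V) K K' := by
  dsimp only [tensorμ]
  simp only [BraidedCategory.braiding_tensor_left_hom, BraidedCategory.braiding_tensor_right_hom]
  -- On the left `U` and `V` are exchanged first and exchanged back inside the big symmetry; on the
  -- right they do not cross.
  have h : (β_ V U).hom = (β_ U V).inv := by
    rw [SymmetricCategory.braiding_swap_eq_inv_braiding]
  rw [h]
  calc
    _ = 𝟙 _ ⊗≫ (A ⊗ A') ◁ ((β_ U V).hom ≫ (β_ U V).inv) ▷ (K ⊗ K') ⊗≫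
        A ◁ ((β_ A' U).hom ▷ (V ⊗ K) ≫ (U ⊗ A') ◁ (β_ V K).hom) ▷ K' ⊗≫
        (A ⊗ U) ◁ (β_ A' K).hom ▷ (V ⊗ K') ⊗≫ 𝟙 _ := by
      monoidal
    _ = _ := by
      rw [Iso.hom_inv_id]
      monoidal

end Coherence

/-! ### The unsigned external product of maps out of powers of `T`. -/

section Star

variable {C : Type u} [Category.{v} C] [MonoidalCategory C]

/-- By `hu`, an endomorphism such as a sign may sit on the second factor instead of the first. For
`k = 0` there is no second factor, and `onFirst` is the identity by convention. -/
lemma whiskerLeft_onFirst {T : C} {u : T ⟶ T} (hu : u ▷ T = T ◁ u) {k : ℕ} (hk : 1 ≤ k) :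
    T ◁ onFirst u k = onFirst u (k + 1) := by
  obtain ⟨k, rfl⟩ := Nat.exists_eq_add_of_le' hk
  change T ◁ (u ▷ tpow T k) = u ▷ (T ⊗ tpow T k)
  rw [← cancel_mono (α_ T T (tpow T k)).inv, associator_inv_naturality_left, hu,
    associator_inv_naturality_middle]

lemma onFirst_append_left {T : C} (u : T ⟶ T) {k : ℕ} (hk : 1 ≤ k) (k' : ℕ) :
    (append T k' k).inv ≫ onFirst u k ▷ tpow T k' =
      onFirst u (k' + k) ≫ (append T k' k).inv := by
  rw [Iso.inv_comp_eq, ← Category.assoc, Iso.eq_comp_inv]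
  obtain ⟨k, rfl⟩ := Nat.exists_eq_add_of_le' hk
  change (u ▷ tpow T k) ▷ tpow T k' ≫ (α_ _ _ _).hom ≫ T ◁ (append T k' k).hom =
    ((α_ _ _ _).hom ≫ T ◁ (append T k' k).hom) ≫ u ▷ tpow T (k' + k)
  rw [associator_naturality_left_assoc, Category.assoc, whisker_exchange]

/-- The endomorphism `u` is moved past the first block one factor at a time. This is what lets signs
of the right factor be pulled out of a product. -/
lemma onFirst_append_right {T : C} {u : T ⟶ T} (hu : u ▷ T = T ◁ u) (k : ℕ) {k' : ℕ}
    (hk : 1 ≤ k') : (append T k' k).inv ≫ tpow T k ◁ onFirst u k' =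
      onFirst u (k' + k) ≫ (append T k' k).inv := by
  rw [Iso.inv_comp_eq, ← Category.assoc, Iso.eq_comp_inv]
  induction k with
  | zero => exact leftUnitor_naturality _
  | succ k ih =>
    change (T ⊗ tpow T k) ◁ onFirst u k' ≫ (α_ _ _ _).hom ≫ T ◁ (append T k' k).hom =
      ((α_ _ _ _).hom ≫ T ◁ (append T k' k).hom) ≫ onFirst u (k' + k + 1)
    rw [← whiskerLeft_onFirst hu (by omega), associator_naturality_right_assoc,
      ← whiskerLeft_comp, ih, whiskerLeft_comp]
    exact (Category.assoc _ _ _).symm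

lemma onFirst_id (T : C) (k : ℕ) : onFirst (𝟙 T) k = 𝟙 _ := by
  cases k with
  | zero => rfl
  | succ k => exact id_whiskerRight T _

lemma onFirst_comp {T : C} (u u' : T ⟶ T) (k : ℕ) :
    onFirst (u ≫ u') k = onFirst u k ≫ onFirst u' k := by
  cases k with
  | zero => exact (Category.id_comp _).symm
  | succ k => exact comp_whiskerRight _ _ _

variable [SymmetricCategory C]

/-- The external product of `f : P ⊗ T^k ⟶ X` and `g : Q ⊗ T^k' ⟶ X'`, without signs. -/
def starProd {T P Q W X X' Y : C} (Δ : W ⟶ P ⊗ Q) (μ : X ⊗ X' ⟶ Y) {k k' : ℕ}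
    (f : P ⊗ tpow T k ⟶ X) (g : Q ⊗ tpow T k' ⟶ X') : W ⊗ tpow T (k' + k) ⟶ Y :=
  (Δ ⊗ₘ (append T k' k).inv) ≫ tensorμ P Q (tpow T k) (tpow T k') ≫ (f ⊗ₘ g) ≫ μ

section

variable {T P Q W X X' Y : C} (Δ : W ⟶ P ⊗ Q) (μ : X ⊗ X' ⟶ Y) {k k' : ℕ}
    (f : P ⊗ tpow T k ⟶ X) (g : Q ⊗ tpow T k' ⟶ X')

lemma starProd_comp {Y' : C} (m : Y ⟶ Y') : starProd Δ μ f g ≫ m = starProd Δ (μ ≫ m) f g := by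
  simp [starProd]

lemma starProd_comp_comp {X₀ X₀' : C} (a : X ⟶ X₀) (b : X' ⟶ X₀') (μ : X₀ ⊗ X₀' ⟶ Y) :
    starProd Δ μ (f ≫ a) (g ≫ b) = starProd Δ ((a ⊗ₘ b) ≫ μ) f g := by
  simp only [starProd, MonoidalCategory.tensorHom_comp_tensorHom_assoc]

lemma whiskerRight_starProd {W' : C} (a : W' ⟶ W) :
    a ▷ tpow T (k' + k) ≫ starProd Δ μ f g = starProd (a ≫ Δ) μ f g := by
  simp only [starProd, ← MonoidalCategory.tensorHom_id,
    MonoidalCategory.tensorHom_comp_tensorHom_assoc, Category.id_comp]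

lemma starProd_whiskerRight {P' Q' : C} (a : P ⟶ P') (b : Q ⟶ Q') (Δ : W ⟶ P ⊗ Q)
    (f : P' ⊗ tpow T k ⟶ X) (g : Q' ⊗ tpow T k' ⟶ X') :
    starProd Δ μ (a ▷ _ ≫ f) (b ▷ _ ≫ g) = starProd (Δ ≫ (a ⊗ₘ b)) μ f g := by
  have h : (a ▷ tpow T k ≫ f) ⊗ₘ (b ▷ tpow T k' ≫ g) =
      ((a ⊗ₘ 𝟙 _) ⊗ₘ (b ⊗ₘ 𝟙 _)) ≫ (f ⊗ₘ g) := by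
    simp only [← MonoidalCategory.id_tensorHom, ← MonoidalCategory.tensorHom_id,
      MonoidalCategory.tensorHom_comp_tensorHom, MonoidalCategory.tensorHom_comp_tensorHom_assoc,
      MonoidalCategory.id_tensorHom_id, Category.id_comp, Category.comp_id, Category.assoc]
  have h' : (Δ ≫ (a ⊗ₘ b)) ⊗ₘ (append T k' k).inv =
      (Δ ⊗ₘ (append T k' k).inv) ≫ ((a ⊗ₘ b) ⊗ₘ (𝟙 _ ⊗ₘ 𝟙 _)) := by
    simp only [← MonoidalCategory.id_tensorHom, ← MonoidalCategory.tensorHom_id,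
      MonoidalCategory.tensorHom_comp_tensorHom, MonoidalCategory.tensorHom_comp_tensorHom_assoc,
      MonoidalCategory.id_tensorHom_id, Category.id_comp, Category.comp_id, Category.assoc]
  rw [starProd, starProd, h, h', Category.assoc, Category.assoc, ← tensorμ_natural_assoc]

lemma onFirst_starProd_left (u : T ⟶ T) (hk : 1 ≤ k) :
    starProd Δ μ (P ◁ onFirst u k ≫ f) g = W ◁ onFirst u (k' + k) ≫ starProd Δ μ f g := by
  have h : (P ◁ onFirst u k ≫ f) ⊗ₘ g =
      ((𝟙 _ ⊗ₘ onFirst u k) ⊗ₘ (𝟙 _ ⊗ₘ 𝟙 _)) ≫ (f ⊗ₘ g) := by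
    simp only [← MonoidalCategory.id_tensorHom, ← MonoidalCategory.tensorHom_id,
      MonoidalCategory.tensorHom_comp_tensorHom, MonoidalCategory.tensorHom_comp_tensorHom_assoc,
      MonoidalCategory.id_tensorHom_id, Category.id_comp, Category.comp_id, Category.assoc]
  have h' : (Δ ⊗ₘ (append T k' k).inv) ≫ ((𝟙 _ ⊗ₘ 𝟙 _) ⊗ₘ (onFirst u k ⊗ₘ 𝟙 _)) =
      W ◁ onFirst u (k' + k) ≫ (Δ ⊗ₘ (append T k' k).inv) := by
    rw [MonoidalCategory.tensorHom_comp_tensorHom, MonoidalCategory.tensorHom_id (onFirst u k),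
      onFirst_append_left u hk]
    simp only [← MonoidalCategory.id_tensorHom, ← MonoidalCategory.tensorHom_id,
      MonoidalCategory.tensorHom_comp_tensorHom, MonoidalCategory.tensorHom_comp_tensorHom_assoc,
      MonoidalCategory.id_tensorHom_id, Category.id_comp, Category.comp_id, Category.assoc]
  rw [starProd, starProd, h, Category.assoc, ← tensorμ_natural_assoc, ← reassoc_of% h']

lemma onFirst_starProd_right {u : T ⟶ T} (hu : u ▷ T = T ◁ u) (hk : 1 ≤ k') :
    starProd Δ μ f (Q ◁ onFirst u k' ≫ g) = W ◁ onFirst u (k' + k) ≫ starProd Δ μ f g := by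
  have h : f ⊗ₘ (Q ◁ onFirst u k' ≫ g) =
      ((𝟙 _ ⊗ₘ 𝟙 _) ⊗ₘ (𝟙 _ ⊗ₘ onFirst u k')) ≫ (f ⊗ₘ g) := by
    simp only [← MonoidalCategory.id_tensorHom, ← MonoidalCategory.tensorHom_id,
      MonoidalCategory.tensorHom_comp_tensorHom, MonoidalCategory.tensorHom_comp_tensorHom_assoc,
      MonoidalCategory.id_tensorHom_id, Category.id_comp, Category.comp_id, Category.assoc]
  have h' : (Δ ⊗ₘ (append T k' k).inv) ≫ ((𝟙 _ ⊗ₘ 𝟙 _) ⊗ₘ (𝟙 _ ⊗ₘ onFirst u k')) =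
      W ◁ onFirst u (k' + k) ≫ (Δ ⊗ₘ (append T k' k).inv) := by
    rw [MonoidalCategory.tensorHom_comp_tensorHom, MonoidalCategory.id_tensorHom (tpow T k),
      onFirst_append_right hu k hk]
    simp only [← MonoidalCategory.id_tensorHom, ← MonoidalCategory.tensorHom_id,
      MonoidalCategory.tensorHom_comp_tensorHom, MonoidalCategory.tensorHom_comp_tensorHom_assoc,
      MonoidalCategory.id_tensorHom_id, Category.id_comp, Category.comp_id, Category.assoc]
  rw [starProd, starProd, h, Category.assoc, ← tensorμ_natural_assoc, ← reassoc_of% h']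

/-- By `tensorμ_braiding`, exchanging the two factors exchanges separately the outputs of `Δ` and
the two blocks of `T`; `TSign.append_swap` later evaluates the block exchange as a sign. -/
lemma starProd_comm (μ' : X' ⊗ X ⟶ Y)
    (h : (f ⊗ₘ g) ≫ μ = (β_ _ _).hom ≫ (g ⊗ₘ f) ≫ μ') :
    starProd Δ μ f g = W ◁ ((append T k' k).inv ≫ (β_ _ _).hom ≫ (append T k k').hom) ≫
      starProd (Δ ≫ (β_ P Q).hom) μ' g f := by
  have e : W ◁ ((append T k' k).inv ≫ (β_ _ _).hom ≫ (append T k k').hom) ≫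
      ((Δ ≫ (β_ P Q).hom) ⊗ₘ (append T k k').inv) =
      (Δ ⊗ₘ (append T k' k).inv) ≫ ((β_ P Q).hom ⊗ₘ (β_ _ _).hom) := by
    simp only [← MonoidalCategory.id_tensorHom, ← MonoidalCategory.tensorHom_id,
      MonoidalCategory.tensorHom_comp_tensorHom, MonoidalCategory.tensorHom_comp_tensorHom_assoc,
      MonoidalCategory.id_tensorHom_id, Category.id_comp, Category.comp_id, Category.assoc]
    rw [Iso.hom_inv_id, Category.comp_id]
  rw [starProd, starProd, h, reassoc_of% e, ← reassoc_of% tensorμ_braiding]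

/-- Four associativities combine: that of the diagonals (`hΔ`), of the multiplications (`hμ`), of
concatenation (`append_assoc`), and of the interchange (`associator_monoidal`). -/
lemma starProd_assoc {Q' W' Z X'' Y' Z' : C} {Δ' : W' ⟶ W ⊗ Q'} {Δ₂ : W' ⟶ P ⊗ Z}
    {Δ₃ : Z ⟶ Q ⊗ Q'} (hΔ : Δ' ≫ Δ ▷ Q' ≫ (α_ _ _ _).hom = Δ₂ ≫ P ◁ Δ₃)
    {μ' : Y ⊗ X'' ⟶ Y'} {μ₂ : X ⊗ Z' ⟶ Y'} {μ₃ : X' ⊗ X'' ⟶ Z'}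
    (hμ : μ ▷ X'' ≫ μ' = (α_ _ _ _).hom ≫ X ◁ μ₃ ≫ μ₂) {k'' : ℕ}
    (h : Q' ⊗ tpow T k'' ⟶ X'') :
    starProd Δ' μ' (starProd Δ μ f g) h =
      W' ◁ tcast T (Nat.add_assoc k'' k' k).symm ≫ starProd Δ₂ μ₂ f (starProd Δ₃ μ₃ g h) := by
  have e : (append T k'' (k' + k)).inv ≫ (append T k' k).inv ▷ tpow T k'' ≫ (α_ _ _ _).hom =
      tcast T (Nat.add_assoc k'' k' k).symm ≫ (append T (k'' + k') k).inv ≫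
        tpow T k ◁ (append T k'' k').inv := by
    have := append_assoc T k k' k''
    rw [Iso.inv_comp_eq, ← whiskerRightIso_inv, Iso.inv_comp_eq, whiskerRightIso_hom,
      reassoc_of% this]
    simp
  have e1 : (starProd Δ μ f g) ⊗ₘ h =
      ((Δ ⊗ₘ (append T k' k).inv) ⊗ₘ (𝟙 _ ⊗ₘ 𝟙 _)) ≫
        tensorμ P Q (tpow T k) (tpow T k') ▷ (Q' ⊗ tpow T k'') ≫ ((f ⊗ₘ g) ⊗ₘ h) ≫ μ ▷ X'' := by
    simp only [starProd]
    simp only [← MonoidalCategory.id_tensorHom, ← MonoidalCategory.tensorHom_id,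
      MonoidalCategory.tensorHom_comp_tensorHom, MonoidalCategory.tensorHom_comp_tensorHom_assoc,
      MonoidalCategory.id_tensorHom_id, Category.id_comp, Category.comp_id, Category.assoc]
  have e2 : f ⊗ₘ (starProd Δ₃ μ₃ g h) =
      ((𝟙 _ ⊗ₘ 𝟙 _) ⊗ₘ (Δ₃ ⊗ₘ (append T k'' k').inv)) ≫
        (P ⊗ tpow T k) ◁ tensorμ Q Q' (tpow T k') (tpow T k'') ≫ (f ⊗ₘ (g ⊗ₘ h)) ≫ X ◁ μ₃ := by
    simp only [starProd]
    simp only [← MonoidalCategory.id_tensorHom, ← MonoidalCategory.tensorHom_id,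
      MonoidalCategory.tensorHom_comp_tensorHom, MonoidalCategory.tensorHom_comp_tensorHom_assoc,
      MonoidalCategory.id_tensorHom_id, Category.id_comp, Category.comp_id, Category.assoc]
  have e3 : (Δ' ⊗ₘ (append T k'' (k' + k)).inv) ≫ ((Δ ⊗ₘ 𝟙 _) ⊗ₘ ((append T k' k).inv ⊗ₘ 𝟙 _)) ≫
      ((α_ _ _ _).hom ⊗ₘ (α_ _ _ _).hom) =
      W' ◁ tcast T (Nat.add_assoc k'' k' k).symm ≫
      (Δ₂ ⊗ₘ (append T (k'' + k') k).inv) ≫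
        ((𝟙 _ ⊗ₘ Δ₃) ⊗ₘ (𝟙 _ ⊗ₘ (append T k'' k').inv)) := by
    rw [← MonoidalCategory.id_tensorHom]
    simp only [MonoidalCategory.tensorHom_comp_tensorHom, MonoidalCategory.tensorHom_id,
      MonoidalCategory.id_tensorHom, e, hΔ, Category.id_comp, Category.assoc]
    rw [← MonoidalCategory.id_tensorHom W', MonoidalCategory.tensorHom_comp_tensorHom,
      Category.id_comp]
  have e4 : ((f ⊗ₘ g) ⊗ₘ h) ≫ (α_ _ _ _).hom = (α_ _ _ _).hom ≫ (f ⊗ₘ (g ⊗ₘ h)) := by simp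
  rw [starProd, e1, starProd, e2]
  simp only [Category.assoc]
  rw [← tensorμ_natural_assoc, ← tensorμ_natural_assoc, ← reassoc_of% e3, hμ, reassoc_of% e4,
    ← reassoc_of% associator_monoidal]

/-- Stabilisation is multiplication by the canonical isomorphism `𝟙_ C ⊗ tpow T 1 ≅ T`, so all its
properties become properties of products. -/
lemma stab_eq_starProd {V : C} (σ : X ⊗ T ⟶ Y) (f : V ⊗ tpow T k ⟶ X) :
    stab σ f = V ◁ tcast T (Nat.add_comm k 1) ≫
      starProd (k' := 1) (ρ_ V).inv σ f ((λ_ _).hom ≫ (ρ_ T).hom) := by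
  let a : tpow T k ⊗ (T ⊗ 𝟙_ C) ≅ tpow T (1 + k) := append T 1 k
  have h : tcast T (Nat.add_comm k 1).symm ≫ (snoc T k).inv ≫ tpow T k ◁ (ρ_ T).inv = a.inv := by
    have h' : a.hom = tpow T k ◁ (ρ_ T).hom ≫ (snoc T k).hom ≫ tcast T (Nat.add_comm k 1) :=
      append_one T k
    rw [← cancel_epi a.hom, Iso.hom_inv_id, h']
    simp [tcast]
  have main : stab σ f = V ◁ tcast T (Nat.add_comm k 1) ≫ ((ρ_ V).inv ⊗ₘ
      (tcast T (Nat.add_comm k 1).symm ≫ (snoc T k).inv ≫ tpow T k ◁ (ρ_ T).inv)) ≫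
      tensorμ V (𝟙_ C) (tpow T k) (T ⊗ 𝟙_ C) ≫
        (f ⊗ₘ ((λ_ (T ⊗ 𝟙_ C)).hom ≫ (ρ_ T).hom)) ≫ σ := by
    rw [tensorμ_unit_right, stab]
    simp [MonoidalCategory.tensorHom_def', tcast, whisker_exchange_assoc]
  rw [h] at main
  exact main

end

/-- The shuffle in `prodRep` moves `A' ⊗ U` past `U ⊗ T^k`, so it sends the first copy of `U` to the
second factor, whereas the interchange sends it to the first. Cocommutativity `hd` absorbs the
difference. -/
lemma prodRep_eq {T U A A' P X X' Y : C} (s : P ⟶ A ⊗ A') (d : U ⟶ U ⊗ U)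
    (hd : d ≫ (β_ U U).hom = d) (e : T ⟶ T)
    (μ : X ⊗ X' ⟶ Y) {k k' : ℕ} (f : (A ⊗ U) ⊗ tpow T k ⟶ X) (g : (A' ⊗ U) ⊗ tpow T k' ⟶ X') :
    prodRep s d e μ f g = (P ⊗ U) ◁ onFirst e (k' + k) ≫
      starProd ((s ⊗ₘ d) ≫ tensorμ A A' U U) μ f g := by
  have h1 : (s ⊗ₘ d) ⊗ₘ (onFirst e (k' + k) ≫ (append T k' k).inv) =
      (P ⊗ U) ◁ onFirst e (k' + k) ≫ ((s ⊗ₘ d) ⊗ₘ (append T k' k).inv) ≫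
        ((A ⊗ A') ◁ (β_ U U).hom) ▷ (tpow T k ⊗ tpow T k') := by
    conv_lhs => rw [← hd]
    simp only [← MonoidalCategory.id_tensorHom, ← MonoidalCategory.tensorHom_id,
      MonoidalCategory.tensorHom_comp_tensorHom, MonoidalCategory.tensorHom_comp_tensorHom_assoc,
      MonoidalCategory.id_tensorHom_id, Category.id_comp, Category.comp_id, Category.assoc]
  have h2 := shuffle_eq A A' U U (tpow T k) (tpow T k')
  simp only [monoidalComp, Category.comp_id] at h2
  rw [prodRep]
  simp only [monoidalComp, h1, Category.assoc, reassoc_of% h2]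
  rw [starProd]
  simp only [← MonoidalCategory.tensorHom_id, MonoidalCategory.tensorHom_comp_tensorHom_assoc,
    Category.comp_id]

end Star

instance {C : Type u} [Category.{v} C] [MonoidalCategory C] (T : C) {k k' : ℕ} (h : k = k') :
    IsIso (tcast T h) := inferInstanceAs (IsIso (eqToHom _))

/-! ### Signs of block permutations. -/

section Perms

lemma blockPerm_val (n m : ℕ) (i : Fin (n + m)) :
    (blockPerm n m i : ℕ) = if (i : ℕ) < n then (i : ℕ) + m else i - n := by
  induction i using Fin.addCases with
  | left i => simp [blockPerm, Nat.add_comm]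
  | right i => simp [blockPerm]

lemma finRotate_pow_val (N j : ℕ) (i : Fin (N + 1)) :
    (((finRotate (N + 1)) ^ j) i : ℕ) = (i + j) % (N + 1) := by
  induction j with
  | zero => simp [Nat.mod_eq_of_lt i.2]
  | succ j ih =>
    rw [pow_succ', Equiv.Perm.mul_apply, finRotate_apply, Fin.val_add, ih, Fin.val_one',
      ← Nat.add_mod, Nat.add_assoc]

/-- The block permutation is the `m`-th power of the rotation of `n + m` elements, so its sign is
`(-1)^((n + m - 1) m)`, and `m (m - 1)` is even. -/
lemma sign_blockPerm (n m : ℕ) : Equiv.Perm.sign (blockPerm n m) = (-1) ^ (n * m) := by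
  rcases Nat.eq_zero_or_pos (n + m) with h | h
  · obtain ⟨rfl, rfl⟩ : n = 0 ∧ m = 0 := by omega
    have : blockPerm 0 0 = 1 := Equiv.ext fun i => i.elim0
    rw [this]
    simp
  · obtain ⟨N, hN⟩ := Nat.exists_eq_add_of_le' h
    have key : (finCongr hN).permCongr (blockPerm n m) = finRotate (N + 1) ^ m := by
      ext i
      rw [finRotate_pow_val]
      simp only [Equiv.permCongr_apply, finCongr_apply, Fin.val_cast, blockPerm_val,
        finCongr_symm]
      split_ifs with h'
      · rw [Nat.mod_eq_of_lt (by omega)]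
      · have : (i : ℕ) + m = (i - n) + (N + 1) := by omega
        rw [this, Nat.add_mod_right, Nat.mod_eq_of_lt (by omega)]
    rw [← Equiv.Perm.sign_permCongr (finCongr hN), key, map_pow, sign_finRotate, ← pow_mul]
    have h2 : Even (m * (m - 1)) := Nat.even_mul_pred_self m
    rcases m with _ | m
    · simp
    · have : (N + 1 - 1) * (m + 1) = n * (m + 1) + (m + 1) * (m + 1 - 1) := by
        have : N = n + m := by omega
        subst this
        simp only [Nat.add_sub_cancel]
        ring
      rw [this, pow_add, h2.neg_one_pow, mul_one]

lemma sign_permSum {n m : ℕ} (γ : Equiv.Perm (Fin n)) (δ : Equiv.Perm (Fin m)) :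
    Equiv.Perm.sign (permSum γ δ) = Equiv.Perm.sign γ * Equiv.Perm.sign δ := by
  rw [permSum, Equiv.Perm.sign_permCongr, Equiv.Perm.sign_sumCongr]

end Perms

/-! ### Block exchanges of powers of `T` act by signs. -/

namespace TSign

variable {C : Type u} [Category.{v} C] [MonoidalCategory C] [SymmetricCategory C] {T : C}
  (s : TSign T)

/-- The endomorphism of `T` given by a sign. -/
def ofUnit (ε : ℤˣ) : T ⟶ T := if ε = 1 then 𝟙 T else s.aut.hom

lemma ofUnit_one : s.ofUnit 1 = 𝟙 T := if_pos rfl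

lemma ofUnit_neg_one : s.ofUnit (-1) = s.aut.hom := if_neg (by decide)

lemma ofUnit_mul (ε η : ℤˣ) : s.ofUnit (ε * η) = s.ofUnit ε ≫ s.ofUnit η := by
  have h : s.aut.hom ≫ s.aut.hom = 𝟙 T := congrArg Iso.hom s.mul_self
  rcases Int.units_eq_one_or ε with rfl | rfl <;> rcases Int.units_eq_one_or η with rfl | rfl <;>
    simp [ofUnit_one, ofUnit_neg_one, h]

lemma ofUnit_whisker (ε : ℤˣ) : s.ofUnit ε ▷ T = T ◁ s.ofUnit ε := by
  rcases Int.units_eq_one_or ε with rfl | rfl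
  · simp [ofUnit_one]
  · rw [ofUnit_neg_one, s.whisker]

lemma pow_eq_ofUnit (m : ℤ) : s.pow m = s.ofUnit m.negOnePow := by
  have h : s.aut ^ (2 : ℤ) = 1 := by rw [zpow_two, s.mul_self]
  rcases Int.even_or_odd' m with ⟨n, rfl | rfl⟩
  · rw [pow, zpow_mul, h, one_zpow, Int.negOnePow_two_mul, ofUnit_one]
    rfl
  · rw [pow, zpow_add, zpow_mul, h, one_zpow, one_mul, zpow_one, Int.negOnePow_two_mul_add_one,
      ofUnit_neg_one]

/-- The transposition of the first two factors is the only permutation to which `TSign.perm` is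
applied; the signs of all block exchanges are built from it. -/
lemma swap_eq (k : ℕ) :
    (α_ T T (tpow T k)).inv ≫ (β_ T T).hom ▷ tpow T k ≫ (α_ T T (tpow T k)).hom =
      s.ofUnit (-1) ▷ (T ⊗ tpow T k) := by
  refine (s.perm (PermMap.swap k)).trans ?_
  rw [Equiv.Perm.sign_swap (by simp)]
  rfl

lemma braiding_snoc (k : ℕ) : (β_ T (tpow T k)).hom ≫ (snoc T k).hom =
    s.ofUnit ((-1) ^ k) ▷ tpow T k := by
  -- Moving `T` past `T ⊗ K` is a transposition followed by moving it past `K`. A general `K` in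
  -- place of `tpow T k` leaves the rewriting free of unfolded powers.
  have step {K : C} (e e' : T ⟶ T) (f : K ⊗ T ⟶ T ⊗ K) (he : e' ▷ T = T ◁ e')
      (h : (α_ T T K).inv ≫ (β_ T T).hom ▷ K ≫ (α_ T T K).hom = e ▷ (T ⊗ K))
      (hf : (β_ T K).hom ≫ f = e' ▷ K) :
      (β_ T (T ⊗ K)).hom ≫ (α_ T K T).hom ≫ T ◁ f = (e ≫ e') ▷ (T ⊗ K) := by
    rw [BraidedCategory.braiding_tensor_right_hom]
    simp only [Category.assoc, Iso.inv_hom_id_assoc]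
    rw [← whiskerLeft_comp, hf, ← associator_naturality_middle, ← he,
      associator_naturality_left, reassoc_of% h, comp_whiskerRight]
  induction k with
  | zero =>
    rw [pow_zero, ofUnit_one, id_whiskerRight]
    change (β_ T (𝟙_ C)).hom ≫ (λ_ T).hom ≫ (ρ_ T).inv = 𝟙 (T ⊗ 𝟙_ C)
    simp
  | succ k ih =>
    rw [pow_succ', ofUnit_mul]
    exact step _ _ _ (s.ofUnit_whisker _) (s.swap_eq k) ih

/-- Induction on `k`: the factors of `T^k` pass the block `T^k'` one at a time, each contributing
`(-1)^k'` by `braiding_snoc`. -/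
lemma append_swap (k k' : ℕ) :
    (append T k' k).inv ≫ (β_ _ _).hom ≫ (append T k k').hom =
      onFirst (s.ofUnit ((-1) ^ (k * k'))) (k' + k) ≫ tcast T (Nat.add_comm k' k) := by
  have step {K K' M : C} (e : T ⟶ T) (f : K' ⊗ T ⟶ T ⊗ K') (hf : (β_ T K').hom ≫ f = e ▷ K')
      (a : K' ⊗ K ⟶ M) (a' : K' ⊗ (T ⊗ K) ⟶ T ⊗ M)
      (ha : f ▷ K ≫ (α_ _ _ _).hom ≫ T ◁ a = (α_ _ _ _).hom ≫ a') (b : K ⊗ K' ⟶ M)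
      (hb : (β_ K K').hom ≫ a = b) :
      (β_ (T ⊗ K) K').hom ≫ a' = (α_ _ _ _).hom ≫ T ◁ b ≫ e ▷ M := by
    rw [BraidedCategory.braiding_tensor_left_hom]
    simp only [Category.assoc]
    rw [← ha, ← comp_whiskerRight_assoc, hf, associator_naturality_left_assoc,
      Iso.inv_hom_id_assoc, ← whisker_exchange, ← whiskerLeft_comp_assoc, hb]
  rw [Iso.inv_comp_eq]
  induction k with
  | zero =>
    rw [Nat.zero_mul, pow_zero, ofUnit_one, onFirst_id, Category.id_comp]
    have h : (append T 0 k').hom = (ρ_ (tpow T k')).hom ≫ tcast T (Nat.zero_add k').symm := by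
      induction k' with
      | zero =>
        change (λ_ (𝟙_ C)).hom = (ρ_ (𝟙_ C)).hom ≫ 𝟙 _
        rw [Category.comp_id, unitors_equal]
      | succ k' ih =>
        rw [tcast_succ T (Nat.zero_add k').symm]
        change (α_ T (tpow T k') (𝟙_ C)).hom ≫ T ◁ (append T 0 k').hom =
          (ρ_ (T ⊗ tpow T k')).hom ≫ _
        rw [ih, whiskerLeft_comp, rightUnitor_tensor_hom, Category.assoc]
    rw [h]
    change (β_ (𝟙_ C) _).hom ≫ _ = (λ_ _).hom ≫ _
    rw [← Category.assoc]
    congr 1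
    simp
  | succ k ih =>
    have h := step (M := tpow T (k + k')) _ _ (s.braiding_snoc k') (append T k k').hom
      ((append T (k + 1) k').hom ≫ tcast T (show k + 1 + k' = k + k' + 1 by omega))
      (snoc_append T k k') _ ih
    have hc : k' + k + 1 = k + k' + 1 := by omega
    have e : T ◁ (onFirst (s.ofUnit ((-1) ^ (k * k'))) (k' + k) ≫ tcast T (Nat.add_comm k' k)) ≫
        s.ofUnit ((-1) ^ k') ▷ tpow T (k + k') =
        s.ofUnit ((-1) ^ ((k + 1) * k')) ▷ tpow T (k' + k) ≫ T ◁ tcast T (Nat.add_comm k' k) := by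
      rw [whiskerLeft_comp, Category.assoc, whisker_exchange, add_mul, one_mul, pow_add, ofUnit_mul,
        comp_whiskerRight]
      -- Moving the inductive sign to the front needs a factor `T` to carry it. Without one, all
      -- exponents vanish and the signs are trivial.
      rcases Nat.eq_zero_or_pos (k' + k) with h0 | h0
      · obtain ⟨rfl, rfl⟩ : k = 0 ∧ k' = 0 := by omega
        simp [ofUnit_one, onFirst_id]
      · have h1 : T ◁ onFirst (s.ofUnit ((-1) ^ (k * k'))) (k' + k) =
            s.ofUnit ((-1) ^ (k * k')) ▷ tpow T (k' + k) :=
          whiskerLeft_onFirst (s.ofUnit_whisker _) h0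
        rw [h1, Category.assoc]
    rw [← cancel_mono (tcast T (show k + 1 + k' = k + k' + 1 by omega)), Category.assoc]
    refine h.trans ?_
    rw [whiskerLeft_comp, Category.assoc]
    refine (congrArg (fun z => (α_ T (tpow T k) (tpow T k')).hom ≫ T ◁ (append T k' k).hom ≫ z)
      e).trans ?_
    rw [← tcast_succ T (Nat.add_comm k' k) hc, append_succ]
    have ht : tcast T hc = tcast T (Nat.add_comm k' (k + 1)) ≫
        tcast T (show k + 1 + k' = k + k' + 1 by omega) := (eqToHom_trans _ _).symm
    have re {A₀ A₁ A₂ A₃ A₄ A₅ : C} (a : A₀ ⟶ A₁) (b : A₁ ⟶ A₂) (c : A₂ ⟶ A₃) (d : A₃ ⟶ A₄)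
        (d' : A₄ ⟶ A₅) : a ≫ b ≫ c ≫ d ≫ d' = ((a ≫ b) ≫ c ≫ d) ≫ d' := by
      simp only [Category.assoc]
    rw [ht]
    exact re _ _ _ _ _

end TSign

/-! ### Representatives, their products, and the action of permutations. -/

section Representatives

variable {C : Type u} [Category.{v} C] [MonoidalCategory C]

/-- A map `V ⊗ T^k ⟶ E_n` for some `k` and `n`. -/
structure Rep {T : C} (E : TSpectrum C T) (V : C) where
  k : ℕ
  n : ℕ
  hom : V ⊗ tpow T k ⟶ E.X n

lemma onFirst_tcast {T : C} {k k' : ℕ} (h : k = k') (u : T ⟶ T) :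
    onFirst u k ≫ tcast T h = tcast T h ≫ onFirst u k' := by
  subst h
  simp

namespace Rep

variable {T : C} {E : TSpectrum C T} {V : C}

/-- As `k` and `n` are fields of `Rep`, associativity and commutation of indices become plain
equalities; the transports are dealt with here. -/
lemma mk_eq {k k' n n' : ℕ} (hk : k = k') (hn : n = n') {f : V ⊗ tpow T k ⟶ E.X n}
    {f' : V ⊗ tpow T k' ⟶ E.X n'}
    (h : f ≫ eqToHom (congrArg E.X hn) = V ◁ tcast T hk ≫ f') :
    (⟨k, n, f⟩ : Rep E V) = ⟨k', n', f'⟩ := by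
  subst hk hn
  simp at h
  rw [h]

/-- The stabilisation of a representative. -/
def stab (x : Rep E V) : Rep E V := ⟨x.k + 1, x.n + 1, StableHtpy.stab (E.σ x.n) x.hom⟩

/-- Precomposition with a map on the factor `V`. -/
def pre {V' : C} (a : V' ⟶ V) (x : Rep E V) : Rep E V' := ⟨x.k, x.n, a ▷ _ ≫ x.hom⟩

/-- The action of an endomorphism of the first factor `T`. -/
def onFirst (u : T ⟶ T) (x : Rep E V) : Rep E V :=
  ⟨x.k, x.n, V ◁ StableHtpy.onFirst u x.k ≫ x.hom⟩

lemma pre_id (x : Rep E V) : x.pre (𝟙 V) = x := by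
  simp [pre]

lemma onFirst_pre {V' : C} (a : V' ⟶ V) (u : T ⟶ T) (x : Rep E V) :
    (x.onFirst u).pre a = (x.pre a).onFirst u := by
  simp [pre, onFirst, whisker_exchange_assoc]

lemma stab_pre {V' : C} (a : V' ⟶ V) (x : Rep E V) : (x.pre a).stab = x.stab.pre a := by
  have := stab_natural (E.σ x.n) (E.σ x.n) a (𝟙 _) (𝟙 _) (by simp) x.hom
  simp only [Category.comp_id] at this
  simp [pre, stab, this]

lemma onFirst_comp (u u' : T ⟶ T) (x : Rep E V) :
    (x.onFirst u).onFirst u' = x.onFirst (u' ≫ u) := by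
  simp [onFirst, StableHtpy.onFirst_comp]

lemma onFirst_id (x : Rep E V) : x.onFirst (𝟙 T) = x := by
  simp [onFirst, StableHtpy.onFirst_id]

/-- False for `k = 0` in general: there `onFirst u` is the identity before stabilisation but not
after it. -/
lemma stab_onFirst (u : T ⟶ T) (x : Rep E V) (hk : 1 ≤ x.k) :
    (x.onFirst u).stab = x.stab.onFirst u := by
  obtain ⟨k, n, f⟩ := x
  obtain ⟨k, rfl⟩ := Nat.exists_eq_add_of_le' hk
  exact congrArg (Rep.mk _ _) (StableHtpy.stab_onFirst (E.σ n) u f)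

variable [SymmetricCategory C]

/-- The action of a sign. -/
def sgn (s : TSign T) (ε : ℤˣ) (x : Rep E V) : Rep E V := x.onFirst (s.ofUnit ε)

variable (s : TSign T)

lemma sgn_sgn (ε η : ℤˣ) (x : Rep E V) : (x.sgn s ε).sgn s η = x.sgn s (η * ε) := by
  rw [sgn, sgn, onFirst_comp, ← s.ofUnit_mul, sgn]

lemma sgn_one (x : Rep E V) : x.sgn s 1 = x := by
  rw [sgn, s.ofUnit_one, onFirst_id]

lemma sgn_pre {V' : C} (a : V' ⟶ V) (ε : ℤˣ) (x : Rep E V) :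
    (x.sgn s ε).pre a = (x.pre a).sgn s ε := onFirst_pre a _ x

lemma stab_sgn (ε : ℤˣ) (x : Rep E V) (hk : 1 ≤ x.k) : (x.sgn s ε).stab = x.stab.sgn s ε :=
  stab_onFirst _ x hk

end Rep

variable [SymmetricCategory C]

/-- The structure of a symmetric ring spectrum on a `T`-spectrum. -/
structure RingStructure {T : C} (E : TSpectrum C T) where
  perm : ∀ n, Equiv.Perm (Fin n) →* End (E.X n)
  mul : ∀ n m, E.X n ⊗ E.X m ⟶ E.X (n + m)
  ι₁ : T ⟶ E.X 1
  σ_eq (n : ℕ) : E.σ n = E.X n ◁ ι₁ ≫ mul n 1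
  equivariant (n m : ℕ) (γ : Equiv.Perm (Fin n)) (δ : Equiv.Perm (Fin m)) :
    ((perm n γ : E.X n ⟶ E.X n) ⊗ₘ (perm m δ : E.X m ⟶ E.X m)) ≫ mul n m =
      mul n m ≫ perm (n + m) (permSum γ δ)
  assoc (n m l : ℕ) : mul n m ▷ E.X l ≫ mul (n + m) l =
    (α_ (E.X n) (E.X m) (E.X l)).hom ≫ E.X n ◁ mul m l ≫ mul n (m + l) ≫
      eqToHom (congrArg E.X (Nat.add_assoc n m l).symm)
  central (n : ℕ) : E.X n ◁ ι₁ ≫ mul n 1 ≫ perm (n + 1) (blockPerm n 1) ≫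
      eqToHom (congrArg E.X (Nat.add_comm n 1)) =
    (β_ (E.X n) T).hom ≫ ι₁ ▷ E.X n ≫ mul 1 n

namespace RingStructure

variable {T : C} {E : TSpectrum C T} (R : RingStructure E) {P Q W : C}

/-- The unsigned product of representatives. -/
def star (Δ : W ⟶ P ⊗ Q) (x : Rep E P) (y : Rep E Q) : Rep E W :=
  ⟨y.k + x.k, x.n + y.n, starProd Δ (R.mul x.n y.n) x.hom y.hom⟩

/-- The representative given by the unit map `T ⟶ E_1`. -/
def unitRep : Rep E (𝟙_ C) := ⟨1, 1, ((λ_ (T ⊗ 𝟙_ C)).hom ≫ (ρ_ T).hom) ≫ R.ι₁⟩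

/-- The relation given by the action of permutations of a given sign. -/
def PermRel {V : C} (ε : ℤˣ) (x y : Rep E V) : Prop :=
  ∃ γ : Equiv.Perm (Fin x.n), Equiv.Perm.sign γ = ε ∧ y = ⟨x.k, x.n, x.hom ≫ R.perm x.n γ⟩

/-- Two representatives commute up to the action of a block permutation. -/
def Commutes (x : Rep E P) (y : Rep E Q) : Prop :=
  (x.hom ⊗ₘ y.hom) ≫ R.mul x.n y.n ≫ R.perm (x.n + y.n) (blockPerm x.n y.n) ≫
      eqToHom (congrArg E.X (Nat.add_comm x.n y.n)) =
    (β_ _ _).hom ≫ (y.hom ⊗ₘ x.hom) ≫ R.mul y.n x.n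

lemma pre_star {W' : C} (a : W' ⟶ W) (Δ : W ⟶ P ⊗ Q) (x : Rep E P) (y : Rep E Q) :
    (R.star Δ x y).pre a = R.star (a ≫ Δ) x y :=
  congrArg (Rep.mk _ _) (whiskerRight_starProd Δ _ _ _ a)

lemma star_pre {P' Q' : C} (a : P ⟶ P') (b : Q ⟶ Q') (Δ : W ⟶ P ⊗ Q) (x : Rep E P')
    (y : Rep E Q') : R.star Δ (x.pre a) (y.pre b) = R.star (Δ ≫ (a ⊗ₘ b)) x y :=
  congrArg (Rep.mk _ _) (starProd_whiskerRight _ a b Δ _ _)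

lemma sgn_star (s : TSign T) (ε : ℤˣ) (Δ : W ⟶ P ⊗ Q) (x : Rep E P) (y : Rep E Q)
    (hk : 1 ≤ x.k) : R.star Δ (x.sgn s ε) y = (R.star Δ x y).sgn s ε :=
  congrArg (Rep.mk _ _) (onFirst_starProd_left Δ _ _ _ _ hk)

lemma star_sgn (s : TSign T) (ε : ℤˣ) (Δ : W ⟶ P ⊗ Q) (x : Rep E P) (y : Rep E Q)
    (hk : 1 ≤ y.k) : R.star Δ x (y.sgn s ε) = (R.star Δ x y).sgn s ε :=
  congrArg (Rep.mk _ _) (onFirst_starProd_right Δ _ _ _ (s.ofUnit_whisker ε) hk)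

lemma star_assoc {Q' W' Z : C} {Δ : W ⟶ P ⊗ Q} {Δ' : W' ⟶ W ⊗ Q'} {Δ₂ : W' ⟶ P ⊗ Z}
    {Δ₃ : Z ⟶ Q ⊗ Q'} (hΔ : Δ' ≫ Δ ▷ Q' ≫ (α_ _ _ _).hom = Δ₂ ≫ P ◁ Δ₃)
    (x : Rep E P) (y : Rep E Q) (z : Rep E Q') :
    R.star Δ' (R.star Δ x y) z = R.star Δ₂ x (R.star Δ₃ y z) := by
  refine Rep.mk_eq (Nat.add_assoc _ _ _).symm (Nat.add_assoc _ _ _) ?_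
  refine (congrArg (· ≫ _)
    (starProd_assoc Δ _ _ _ hΔ (R.assoc x.n y.n z.n) z.hom)).trans ?_
  rw [Category.assoc, starProd_comp, Category.assoc, eqToHom_trans, eqToHom_refl,
    Category.comp_id]
  rfl

/-- By `σ_eq` the structure map is multiplication by `ι₁`, which is carried over to the right factor
of `stab_eq_starProd`. -/
lemma stab_eq_star {V : C} (x : Rep E V) : x.stab = R.star (ρ_ V).inv x R.unitRep := by
  refine Rep.mk_eq (Nat.add_comm _ _) rfl ?_
  rw [eqToHom_refl, Category.comp_id, stab_eq_starProd, R.σ_eq]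
  have h := starProd_comp_comp (ρ_ V).inv x.hom ((λ_ (T ⊗ 𝟙_ C)).hom ≫ (ρ_ T).hom)
    (k' := 1) (𝟙 _) R.ι₁ (R.mul x.n 1)
  rw [Category.comp_id, MonoidalCategory.id_tensorHom] at h
  exact congrArg (V ◁ tcast T _ ≫ ·) h.symm

lemma star_stab (Δ : W ⟶ P ⊗ Q) (x : Rep E P) (y : Rep E Q) :
    R.star Δ x y.stab = (R.star Δ x y).stab := by
  rw [R.stab_eq_star y, R.stab_eq_star]
  exact (R.star_assoc (by simp) _ _ _).symm

lemma permRel_sgn (s : TSign T) {V : C} {ε : ℤˣ} (η : ℤˣ) {x y : Rep E V}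
    (h : R.PermRel ε x y) : R.PermRel ε (x.sgn s η) (y.sgn s η) := by
  obtain ⟨γ, hγ, rfl⟩ := h
  exact ⟨γ, hγ, congrArg (Rep.mk _ _) (Category.assoc _ _ _).symm⟩

/-- By equivariance a permutation `γ` of the right factor becomes `1 × γ` on the product, which has
the same sign. -/
lemma permRel_star (Δ : W ⟶ P ⊗ Q) {ε : ℤˣ} (x : Rep E P) {y y' : Rep E Q}
    (h : R.PermRel ε y y') : R.PermRel ε (R.star Δ x y) (R.star Δ x y') := by
  obtain ⟨γ, hγ, rfl⟩ := h
  refine ⟨permSum 1 γ, (sign_permSum 1 γ).trans (by rw [map_one, one_mul, hγ]),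
    congrArg (Rep.mk _ _) ?_⟩
  have h := starProd_comp_comp Δ x.hom y.hom (𝟙 _) (R.perm y.n γ : E.X y.n ⟶ E.X y.n)
    (R.mul x.n y.n)
  have h' := R.equivariant x.n y.n 1 γ
  rw [map_one] at h'
  rw [Category.comp_id] at h
  refine h.trans ((congrArg (fun z => starProd Δ z x.hom y.hom) h').trans ?_)
  exact (starProd_comp _ _ _ _ _).symm

/-- Two signs arise from different sources: `n n'` from the block permutation on the target,
recorded in `PermRel`, and `k k'` from exchanging the blocks of `T` in the source. -/
lemma permRel_comm (s : TSign T) (Δ : W ⟶ P ⊗ Q) {x : Rep E P} {y : Rep E Q}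
    (h : R.Commutes x y) : R.PermRel ((-1) ^ (x.n * y.n)) (R.star Δ x y)
      ((R.star (Δ ≫ (β_ P Q).hom) y x).sgn s ((-1) ^ (x.k * y.k))) := by
  refine ⟨blockPerm x.n y.n, sign_blockPerm _ _, ?_⟩
  refine (Rep.mk_eq (Nat.add_comm _ _) (Nat.add_comm _ _) ?_).symm
  have := starProd_comm Δ _ x.hom y.hom _ h
  rw [s.append_swap, ← starProd_comp, onFirst_tcast, whiskerLeft_comp, Category.assoc] at this
  exact (Category.assoc _ _ _).trans this

lemma commutes_unitRep (x : Rep E P) : R.Commutes x R.unitRep := by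
  have h := R.central x.n
  have e1 : x.hom ⊗ₘ (((λ_ (T ⊗ 𝟙_ C)).hom ≫ (ρ_ T).hom) ≫ R.ι₁) =
      (x.hom ⊗ₘ ((λ_ (T ⊗ 𝟙_ C)).hom ≫ (ρ_ T).hom)) ≫ E.X x.n ◁ R.ι₁ := by
    rw [← MonoidalCategory.id_tensorHom, MonoidalCategory.tensorHom_comp_tensorHom,
      Category.comp_id]
  have e2 : (((λ_ (T ⊗ 𝟙_ C)).hom ≫ (ρ_ T).hom) ≫ R.ι₁) ⊗ₘ x.hom =
      (((λ_ (T ⊗ 𝟙_ C)).hom ≫ (ρ_ T).hom) ⊗ₘ x.hom) ≫ R.ι₁ ▷ E.X x.n := by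
    rw [← MonoidalCategory.tensorHom_id, MonoidalCategory.tensorHom_comp_tensorHom,
      Category.comp_id]
  change (x.hom ⊗ₘ (((λ_ (T ⊗ 𝟙_ C)).hom ≫ (ρ_ T).hom) ≫ R.ι₁)) ≫ R.mul x.n 1 ≫ _ =
    (β_ _ (𝟙_ C ⊗ (T ⊗ 𝟙_ C))).hom ≫
      ((((λ_ (T ⊗ 𝟙_ C)).hom ≫ (ρ_ T).hom) ≫ R.ι₁) ⊗ₘ x.hom) ≫ R.mul 1 x.n
  rw [e1, e2, Category.assoc, Category.assoc, ← BraidedCategory.braiding_naturality_assoc, ← h]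
  rfl

/-- Commute `ι₁` past `y` inside `x·(y·ι₁)` and reassociate to `(x·ι₁)·y`. This measures the failure
of the unsigned product to respect stabilisation of its left factor. -/
lemma permRel_stab_star (s : TSign T) (Δ : W ⟶ P ⊗ Q) (x : Rep E P) (y : Rep E Q) :
    R.PermRel ((-1) ^ y.n) (R.star Δ x y).stab ((R.star Δ x.stab y).sgn s ((-1) ^ y.k)) := by
  have h := R.permRel_star Δ x (R.permRel_comm s (ρ_ Q).inv (R.commutes_unitRep y))
  rw [R.star_sgn _ _ _ _ _ (Nat.le_add_left 1 y.k), ← R.stab_eq_star, R.star_stab] at h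
  have e : R.star Δ x.stab y =
      R.star Δ x (R.star ((ρ_ Q).inv ≫ (β_ Q (𝟙_ C)).hom) R.unitRep y) := by
    rw [R.stab_eq_star x]
    exact R.star_assoc (by simp) _ _ _
  rw [e]
  simpa [unitRep] using h

end RingStructure

end Representatives

/-! ### Biadditivity of the external product. -/

section Additivity

section

variable {C : Type u} [Category.{v} C] [HasZeroMorphisms C] [HasBinaryCoproducts C]
  {T : C} (c : Cogroup T)

lemma isUnital_homAdd (F : C ⥤ C) [PreservesColimitsOfShape (Discrete WalkingPair) F] (X : C) :
    EckmannHilton.IsUnital (homAdd c F (X := X)) 0 :=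
  EckmannHilton.AddZeroClass.IsUnital (_G := (homAddGroup c F
    X).toSubNegMonoid.toAddMonoid.toAddZeroClass)

/-- Reduces the additivity of an operation to writing it as `a ↦ φ ≫ G a ≫ m`, with `φ` natural in
the cogroup variable. -/
lemma comp_map_homAdd_comp {F F' G : C ⥤ C} [PreservesColimitsOfShape (Discrete WalkingPair) F]
    [PreservesColimitsOfShape (Discrete WalkingPair) F']
    [PreservesColimitsOfShape (Discrete WalkingPair) G] (φ : F ⟶ F' ⋙ G) {X Y : C}
    (m : G.obj X ⟶ Y) (a b : F'.obj T ⟶ X) :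
    φ.app T ≫ G.map (homAdd c F' a b) ≫ m =
      homAdd c F (φ.app T ≫ G.map a ≫ m) (φ.app T ≫ G.map b ≫ m) := by
  rw [map_homAdd, homAdd_comp]
  exact comp_homAdd c φ _ _

/-- The two additions on the morphisms out of `H(T, T)`, for a bifunctor `H`, agree. -/
lemma homAdd_bifunctor (H : C ⥤ C ⥤ C)
    [∀ B, PreservesColimitsOfShape (Discrete WalkingPair) (H.obj B)]
    [∀ B, PreservesColimitsOfShape (Discrete WalkingPair) (H.flip.obj B)] {X : C}
    (x y : (H.obj T).obj T ⟶ X) :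
    homAdd c (H.obj T) x y = homAdd c (H.flip.obj T) x y := by
  have h1 := isUnital_homAdd c (H.obj T) X
  have h2 := isUnital_homAdd c (H.flip.obj T) X
  refine congrFun (congrFun (EckmannHilton.mul h1 h2 fun a b z d => ?_) x) y
  -- The interchange law for Eckmann–Hilton: all four maps factor through `H(T ⨿ T, T)`, and the
  -- addition in the second variable is natural in the first.
  obtain ⟨m, rfl, rfl⟩ := exists_factor (H.flip.obj T) a b
  obtain ⟨n, rfl, rfl⟩ := exists_factor (H.flip.obj T) z d
  have e (i : T ⟶ T ⨿ T) : homAdd c (H.obj T) ((H.flip.obj T).map i ≫ m)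
      ((H.flip.obj T).map i ≫ n) =
      (H.flip.obj T).map i ≫ homAdd c (H.obj (T ⨿ T)) m n :=
    (comp_homAdd c (H.map i) m n).symm
  have e' : homAdd c (H.obj T)
      ((H.flip.obj T).map (c.comul ≫ coprod.desc coprod.inl coprod.inr) ≫ m)
      ((H.flip.obj T).map (c.comul ≫ coprod.desc coprod.inl coprod.inr) ≫ n) =
      (H.flip.obj T).map (c.comul ≫ coprod.desc coprod.inl coprod.inr) ≫
        homAdd c (H.obj (T ⨿ T)) m n := e _
  rw [e, e, homAdd_map, homAdd_map, homAdd_map, e']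

end

variable {C : Type u} [Category.{v} C] [MonoidalCategory C]
  [HasZeroMorphisms C] [HasBinaryCoproducts C]
  [∀ P : C, PreservesColimitsOfShape (Discrete WalkingPair) (tensorLeft P)]
  [∀ P : C, PreservesColimitsOfShape (Discrete WalkingPair) (tensorRight P)]
  {T : C} (c : Cogroup T)

/-- With at least two factors `T`, the endomorphism `u` can act on the second one and so does not
interfere with the cogroup structure on the first. -/
lemma onFirst_homAdd {V X : C} {u : T ⟶ T} (hu : u ▷ T = T ◁ u) {m : ℕ} (hm : 1 ≤ m)
    (x y : V ⊗ tpow T (m + 1) ⟶ X) :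
    V ◁ onFirst u (m + 1) ≫ homAdd c (sandwich V (tpow T m)) x y =
      homAdd c (sandwich V (tpow T m)) (V ◁ onFirst u (m + 1) ≫ x)
        (V ◁ onFirst u (m + 1) ≫ y) := by
  let ψ : sandwich V (tpow T m) ⟶ sandwich V (tpow T m) :=
    { app B := V ◁ (B ◁ onFirst u m)
      naturality B B' f := by
        change V ◁ (f ▷ _) ≫ V ◁ (B' ◁ onFirst u m) = V ◁ (B ◁ onFirst u m) ≫ V ◁ (f ▷ _)
        rw [← whiskerLeft_comp, ← whisker_exchange, whiskerLeft_comp] }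
  rw [← whiskerLeft_onFirst hu hm]
  exact comp_homAdd c ψ x y

/-- The bifunctor `(B, B') ↦ W ⊗ ((B ⊗ K) ⊗ (B' ⊗ K'))`. -/
def doubleSandwich (W K K' : C) : C ⥤ C ⥤ C where
  obj B := tensorRight K' ⋙ tensorLeft (B ⊗ K) ⋙ tensorLeft W
  map u :=
    { app B' := W ◁ ((u ▷ K) ▷ (B' ⊗ K'))
      naturality B B' f := by
        dsimp
        rw [← whiskerLeft_comp, whisker_exchange, whiskerLeft_comp] }

instance (W K K' B : C) : PreservesColimitsOfShape (Discrete WalkingPair)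
    ((doubleSandwich W K K').obj B) :=
  inferInstanceAs (PreservesColimitsOfShape (Discrete WalkingPair)
    (tensorRight K' ⋙ tensorLeft (B ⊗ K) ⋙ tensorLeft W))

instance (W K K' B : C) : PreservesColimitsOfShape (Discrete WalkingPair)
    ((doubleSandwich W K K').flip.obj B) :=
  inferInstanceAs (PreservesColimitsOfShape (Discrete WalkingPair)
    (tensorRight K ⋙ tensorRight (B ⊗ K') ⋙ tensorLeft W))

variable [SymmetricCategory C] {P Q W X X' Y : C} (Δ : W ⟶ P ⊗ Q) (μ : X ⊗ X' ⟶ Y)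

lemma starProd_homAdd_left {a k' : ℕ} (f₁ f₂ : P ⊗ tpow T (a + 1) ⟶ X)
    (g : Q ⊗ tpow T k' ⟶ X') :
    starProd Δ μ (k := a + 1) (homAdd c (sandwich P (tpow T a)) f₁ f₂) g =
      homAdd c (sandwich W (tpow T (k' + a))) (starProd Δ μ (k := a + 1) f₁ g)
        (starProd Δ μ (k := a + 1) f₂ g) := by
  let φ : sandwich W (tpow T (k' + a)) ⟶ sandwich P (tpow T a) ⋙ tensorRight (Q ⊗ tpow T k') :=
    { app B := (Δ ⊗ₘ (B ◁ (append T k' a).inv ≫ (α_ B (tpow T a) (tpow T k')).inv)) ≫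
        tensorμ P Q (B ⊗ tpow T a) (tpow T k')
      naturality B B' u := by
        have h := tensorμ_natural (𝟙 P) (𝟙 Q) (u ▷ tpow T a) (𝟙 (tpow T k'))
        change W ◁ (u ▷ _) ≫ _ = _ ≫ (P ◁ (u ▷ tpow T a)) ▷ (Q ⊗ tpow T k')
        simp only [MonoidalCategory.id_tensorHom, MonoidalCategory.tensorHom_id,
          id_whiskerRight] at h
        rw [Category.assoc, ← h, ← MonoidalCategory.id_tensorHom,
          ← MonoidalCategory.id_tensorHom (P ⊗ Q)]
        simp only [MonoidalCategory.tensorHom_comp_tensorHom_assoc, Category.assoc,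
          Category.id_comp, Category.comp_id, ← whisker_exchange_assoc,
          associator_inv_naturality_left] }
  have h (f : P ⊗ (T ⊗ tpow T a) ⟶ X) : starProd Δ μ (k := a + 1) f g =
      φ.app T ≫ (tensorRight (Q ⊗ tpow T k')).map f ≫ (X ◁ g ≫ μ) := by
    change (Δ ⊗ₘ (T ◁ (append T k' a).inv ≫ (α_ T (tpow T a) (tpow T k')).inv)) ≫
      tensorμ P Q (T ⊗ tpow T a) (tpow T k') ≫ (f ⊗ₘ g) ≫ μ =
      ((Δ ⊗ₘ (T ◁ (append T k' a).inv ≫ (α_ T (tpow T a) (tpow T k')).inv)) ≫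
      tensorμ P Q (T ⊗ tpow T a) (tpow T k')) ≫ f ▷ (Q ⊗ tpow T k') ≫ X ◁ g ≫ μ
    rw [MonoidalCategory.tensorHom_def f g]
    simp only [Category.assoc]
  refine (h _).trans ((comp_map_homAdd_comp c φ _ f₁ f₂).trans ?_)
  exact congrArg₂ (homAdd c (sandwich W (tpow T (k' + a)))) (h f₁).symm (h f₂).symm

/-- The addition of `g₁` and `g₂` uses the first `T` of the second block, that of the products the
first `T` of the first block. `ψ` exhibits the former, `homAdd_bifunctor` exchanges the two, and `θ`
regroups the blocks. -/
lemma starProd_homAdd_right {a a' : ℕ} (f : P ⊗ tpow T (a + 1) ⟶ X)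
    (g₁ g₂ : Q ⊗ tpow T (a' + 1) ⟶ X') :
    starProd Δ μ (k := a + 1) (k' := a' + 1) f (homAdd c (sandwich Q (tpow T a')) g₁ g₂) =
      homAdd c (sandwich W (tpow T (a' + 1 + a))) (starProd Δ μ (k := a + 1) (k' := a' + 1) f g₁)
        (starProd Δ μ (k := a + 1) (k' := a' + 1) f g₂) := by
  let H := doubleSandwich W (tpow T a) (tpow T a')
  let ψ : H.obj T ⟶ sandwich Q (tpow T a') ⋙ tensorLeft (P ⊗ tpow T (a + 1)) :=
    { app B := Δ ▷ _ ≫ tensorμ P Q (tpow T (a + 1)) (B ⊗ tpow T a')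
      naturality B B' u := by
        have h := tensorμ_natural (𝟙 P) (𝟙 Q) (𝟙 (tpow T (a + 1))) (u ▷ tpow T a')
        simp only [MonoidalCategory.id_tensorHom, MonoidalCategory.tensorHom_id,
          id_whiskerRight] at h
        change W ◁ (tpow T (a + 1) ◁ (u ▷ _)) ≫ Δ ▷ (tpow T (a + 1) ⊗ B' ⊗ tpow T a') ≫
          tensorμ P Q (tpow T (a + 1)) (B' ⊗ tpow T a') =
          (Δ ▷ (tpow T (a + 1) ⊗ B ⊗ tpow T a') ≫ tensorμ P Q (tpow T (a + 1)) (B ⊗ tpow T a')) ≫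
          (P ⊗ tpow T (a + 1)) ◁ (Q ◁ (u ▷ tpow T a'))
        rw [Category.assoc, ← h, whisker_exchange_assoc] }
  let θ : sandwich W (tpow T (a' + 1 + a)) ⟶ H.flip.obj T :=
    { app B := W ◁ (B ◁ (append T (a' + 1) a).inv ≫ (α_ B (tpow T a) (tpow T (a' + 1))).inv)
      naturality B B' u := by
        change W ◁ (u ▷ _) ≫ W ◁ (B' ◁ (append T (a' + 1) a).inv ≫ _) =
          W ◁ (B ◁ (append T (a' + 1) a).inv ≫ _) ≫ W ◁ ((u ▷ tpow T a) ▷ tpow T (a' + 1))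
        rw [← whiskerLeft_comp, ← whisker_exchange_assoc, ← whiskerLeft_comp, Category.assoc,
          associator_inv_naturality_left] }
  have h (g : Q ⊗ tpow T (a' + 1) ⟶ X') : starProd Δ μ f g =
      θ.app T ≫ ψ.app T ≫ (tensorLeft (P ⊗ tpow T (a + 1))).map g ≫ (f ▷ X' ≫ μ) := by
    change (Δ ⊗ₘ (append T (a' + 1) (a + 1)).inv) ≫
      tensorμ P Q (tpow T (a + 1)) (tpow T (a' + 1)) ≫ (f ⊗ₘ g) ≫ μ =
      W ◁ (append T (a' + 1) (a + 1)).inv ≫ (Δ ▷ (tpow T (a + 1) ⊗ tpow T (a' + 1)) ≫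
      tensorμ P Q (tpow T (a + 1)) (tpow T (a' + 1))) ≫
        (P ⊗ tpow T (a + 1)) ◁ g ≫ f ▷ X' ≫ μ
    rw [MonoidalCategory.tensorHom_def', MonoidalCategory.tensorHom_def']
    simp only [Category.assoc]
  refine (h _).trans ((congrArg (θ.app T ≫ ·) ((comp_map_homAdd_comp c ψ _ g₁ g₂).trans
    (homAdd_bifunctor c H _ _))).trans ?_)
  refine (comp_homAdd c θ _ _).trans ?_
  exact congrArg₂ (homAdd c (sandwich W (tpow T (a' + 1 + a)))) (h g₁).symm (h g₂).symm

end Additivity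

/-! ### Classes of representatives in the colimit. -/

section Classes

variable {C : Type u} [Category.{v} C] [MonoidalCategory C]
  [HasZeroMorphisms C] [HasBinaryCoproducts C]
  [∀ P : C, PreservesColimitsOfShape (Discrete WalkingPair) (tensorLeft P)]
  [∀ P : C, PreservesColimitsOfShape (Discrete WalkingPair) (tensorRight P)]
  {T : C} (c : Cogroup T) {E : TSpectrum C T} {V : C} {q : ℤ}

/-- The representative given by an element of a stage of the colimit. -/
def stageRep (E : TSpectrum C T) (V : C) (q : ℤ) (j : ℕ) (f : piStage c V E q j) : Rep E V :=
  ⟨(q - 2).toNat + j + 1 + 1, (2 - q).toNat + j, f⟩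

namespace Rep

/-- The class of a representative. -/
def cls (x : Rep E V) (hq : (x.k : ℤ) = q + x.n) (hk : 1 ≤ x.k) : StablePi c V E q :=
  StableHtpy.cls c hq hk x.hom

lemma cls_congr {x y : Rep E V} (h : x = y) (hq : (x.k : ℤ) = q + x.n) (hk : 1 ≤ x.k) :
    x.cls c hq hk = y.cls c (by rw [← h]; exact hq) (by rw [← h]; exact hk) := by
  subst h
  rfl

lemma exists_stageRep (x : Rep E V) (hq : (x.k : ℤ) = q + x.n) (hk : 2 ≤ x.k) :
    ∃ j f, x = stageRep c E V q j f := by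
  obtain ⟨k, n, f⟩ := x
  dsimp only at hq hk
  obtain ⟨j, rfl⟩ : ∃ j, n = (2 - q).toNat + j := ⟨n - (2 - q).toNat, by omega⟩
  obtain rfl : k = (q - 2).toNat + j + 1 + 1 := by omega
  exact ⟨j, f, rfl⟩

/-- The stages of the colimit start at `k = 2`, so `cls` stabilises once before entering it. Hence
the hypothesis concerns `x.stab` rather than `x`. -/
lemma cls_eq_of {x : Rep E V} (hq : (x.k : ℤ) = q + x.n) (hk : 1 ≤ x.k) {j : ℕ}
    {f : piStage c V E q j} (h : x.stab = stageRep c E V q j f) :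
    x.cls c hq hk = AddCommGroup.DirectLimit.of _ _ j f := by
  -- The stage index used by `cls` equals `j` only propositionally, so it is generalised to `j'`
  -- before substituting.
  have key (y : Rep E V) (hy : y = stageRep c E V q j f) (j' : ℕ)
      (h1 : (q - 2).toNat + j' + 1 + 1 = y.k) (h2 : y.n = (2 - q).toNat + j') :
      AddCommGroup.DirectLimit.of (piStage c V E q) (fun _ _ h => piStep c V E q h) j'
        (reindex (X := E.X) h1 h2 y.hom : piStage c V E q j') =
        AddCommGroup.DirectLimit.of _ _ j f := by
    subst hy
    obtain rfl : j = j' := by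
      simp only [stageRep] at h2
      omega
    congr 1
    have e (g : V ⊗ tpow T ((q - 2).toNat + j + 1 + 1) ⟶ E.X ((2 - q).toNat + j)) :
        V ◁ 𝟙 _ ≫ g ≫ 𝟙 _ = g := by simp
    exact e f
  exact key x.stab h _ _ _

lemma of_stabHom (j : ℕ) (f : piStage c V E q j) :
    AddCommGroup.DirectLimit.of (piStage c V E q) (fun _ _ h => piStep c V E q h) (j + 1)
      (stabHom c (E.σ _) _ f) = AddCommGroup.DirectLimit.of _ _ j f := by
  have h := AddCommGroup.DirectLimit.of_f (G := piStage c V E q)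
    (f := fun _ _ h => piStep c V E q h) (Nat.le_succ j) f
  rw [← h]
  have h' := piStep_succ c V E q (le_refl j)
  have h0 : piStep c V E q (le_refl j) = AddMonoidHom.id _ := Nat.leRec_self _ _
  rw [h0, AddMonoidHom.comp_id] at h'
  exact congrArg _ (DFunLike.congr_fun h' f).symm

lemma cls_stageRep (j : ℕ) (f : piStage c V E q j)
    (hq : ((stageRep c E V q j f).k : ℤ) = q + (stageRep c E V q j f).n)
    (hk : 1 ≤ (stageRep c E V q j f).k) :
    (stageRep c E V q j f).cls c hq hk = AddCommGroup.DirectLimit.of _ _ j f :=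
  (cls_eq_of c hq hk (j := j + 1) (f := stabHom c (E.σ _) _ f) rfl).trans (of_stabHom c j f)

lemma cls_stab (x : Rep E V) (hq : (x.k : ℤ) = q + x.n) (hk : 1 ≤ x.k) :
    x.stab.cls c (q := q) (by simp only [stab]; push_cast; omega) (by simp only [stab]; omega) =
      x.cls c hq hk := by
  obtain ⟨j, f, h⟩ := x.stab.exists_stageRep c (q := q) (by simp only [stab]; push_cast; omega)
    (by simp only [stab]; omega)
  rw [cls_eq_of c hq hk h, cls_congr c h, cls_stageRep]

lemma exists_cls (a : StablePi c V E q) : ∃ (x : Rep E V) (hq : (x.k : ℤ) = q + x.n)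
    (hk : 2 ≤ x.k), a = x.cls c hq (by omega) := by
  induction a using AddCommGroup.DirectLimit.induction_on with
  | ih j f =>
    exact ⟨stageRep c E V q j f, by simp only [stageRep]; omega, by simp only [stageRep]; omega,
      (cls_stageRep c j f _ _).symm⟩

/-- Includes `a = 0`, where the source is not a stage of the colimit; stabilisation is a
homomorphism into one. -/
lemma cls_add {n a : ℕ} (f g : Stage c V (E.X n) a) (hq : ((a + 1 : ℕ) : ℤ) = q + n) :
    cls c (⟨a + 1, n, (f + g : Stage c V (E.X n) a)⟩ : Rep E V) hq (Nat.le_add_left 1 a) =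
      cls c (⟨a + 1, n, f⟩ : Rep E V) hq (Nat.le_add_left 1 a) +
        cls c (⟨a + 1, n, g⟩ : Rep E V) hq (Nat.le_add_left 1 a) := by
  obtain ⟨j, hn⟩ : ∃ j, n + 1 = (2 - q).toNat + j := ⟨n + 1 - (2 - q).toNat, by omega⟩
  have ha : a + 1 = (q - 2).toNat + j + 1 := by omega
  have key {m b : ℕ} (hm : m = (2 - q).toNat + j) (hb : b = (q - 2).toNat + j + 1) :
      ∃ F : Stage c V (E.X m) b →+ piStage c V E q j, ∀ f,
        (⟨b + 1, m, f⟩ : Rep E V) = stageRep c E V q j (F f) := by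
    subst hm hb
    exact ⟨AddMonoidHom.id _, fun _ => rfl⟩
  obtain ⟨F, hF⟩ := key hn ha
  have h (f : Stage c V (E.X n) a) : (⟨a + 1, n, f⟩ : Rep E V).stab =
      stageRep c E V q j (F (stabHom c (E.σ n) a f)) := hF _
  rw [cls_eq_of c _ _ (h f), cls_eq_of c _ _ (h g), cls_eq_of c _ _ (h (f + g)), map_add, map_add,
    map_add]

/-- The image of a representative under a morphism of spectra. -/
def map {E' : TSpectrum C T} (φ : E.Hom E') (x : Rep E V) : Rep E' V :=
  ⟨x.k, x.n, x.hom ≫ φ.app x.n⟩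

lemma stab_map {E' : TSpectrum C T} (φ : E.Hom E') (x : Rep E V) :
    (x.map φ).stab = x.stab.map φ := by
  have := stab_natural (E.σ x.n) (E'.σ x.n) (𝟙 V) (φ.app x.n) _ (φ.comm x.n) x.hom
  simp only [id_whiskerRight, Category.id_comp] at this
  exact congrArg (Rep.mk _ _) this.symm

lemma piMap_cls {V' : C} {E' : TSpectrum C T} (α : V' ⟶ V) (φ : E.Hom E') (x : Rep E V)
    (hq : (x.k : ℤ) = q + x.n) (hk : 1 ≤ x.k) :
    piMap c α φ q (x.cls c hq hk) = ((x.pre α).map φ).cls c hq hk := by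
  rw [← cls_stab c x hq hk, ← cls_stab c ((x.pre α).map φ) hq hk]
  obtain ⟨j, f, h⟩ := x.stab.exists_stageRep c (q := q) (by simp only [stab]; push_cast; omega)
    (by simp only [stab]; omega)
  rw [cls_congr c h, cls_stageRep]
  let g : piStage c V' E' q j :=
    (α ▷ tpow T _ ≫ f ≫ φ.app _ : V' ⊗ tpow T ((q - 2).toNat + j + 1 + 1) ⟶ _)
  have h' : ((x.pre α).map φ).stab = stageRep c E' V' q j g := by
    rw [stab_map, stab_pre, h]
    exact congrArg (Rep.mk _ _) (Category.assoc _ _ _)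
  rw [cls_congr c h', cls_stageRep]
  exact AddCommGroup.DirectLimit.map_apply_of _ _ _

lemma piTwist_cls (u : T ⟶ T) (hu : u ▷ T = T ◁ u) (x : Rep E V)
    (hq : (x.k : ℤ) = q + x.n) (hk : 1 ≤ x.k) :
    piTwist c u hu (x.cls c hq hk) = (x.onFirst u).cls c hq hk := by
  rw [← cls_stab c x hq hk, ← cls_stab c (x.onFirst u) hq hk]
  obtain ⟨j, f, h⟩ := x.stab.exists_stageRep c (q := q) (by simp only [stab]; push_cast; omega)
    (by simp only [stab]; omega)
  rw [cls_congr c h, cls_stageRep]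
  let g : piStage c V E q j :=
    (V ◁ StableHtpy.onFirst u _ ≫ f : V ⊗ tpow T ((q - 2).toNat + j + 1 + 1) ⟶ _)
  have h' : (x.onFirst u).stab = stageRep c E V q j g := by
    rw [stab_onFirst _ _ hk, h]
    rfl
  rw [cls_congr c h', cls_stageRep]
  exact AddCommGroup.DirectLimit.map_apply_of _ _ _

/-- Semistability in usable form: on classes, a permutation of the target acts as its sign. -/
lemma cls_eq_of_permRel [SymmetricCategory C] (s : TSign T) (R : RingStructure E)
    (hs : ∀ h : ℕ → ℕ, Function.Injective h → ∀ x y : StablePi c V E q,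
      InjActsTo c s V E R.perm q h x y → y = x) {ε : ℤˣ} {x y : Rep E V}
    (h : R.PermRel ε x y) (hq : (x.k : ℤ) = q + x.n) (hk : 2 ≤ x.k)
    (hqy : (y.k : ℤ) = q + y.n) (hky : 1 ≤ y.k) :
    (y.sgn s ε).cls c hqy hky = x.cls c hq (by omega) := by
  obtain ⟨γ, rfl, rfl⟩ := h
  -- The permutation extended by the identity is an injection of `ℕ`; it agrees with `γ` on all `n`
  -- elements, so no stabilisation is needed and `j = 0`.
  let h : ℕ → ℕ := fun i => if hi : i < x.n then γ ⟨i, hi⟩ else i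
  refine hs h ?_ _ _ ⟨x.k, x.n, 0, hq, hk, x.hom, γ, fun i => ?_, rfl, rfl⟩
  · intro a b hab
    simp only [h] at hab
    split_ifs at hab with h1 h2 h2
    · simpa using γ.injective (Fin.ext hab)
    · have := (γ ⟨a, h1⟩).2
      omega
    · have := (γ ⟨b, h2⟩).2
      omega
    · exact hab
  · simp only [h]
    rw [dif_pos i.2]
    rfl

end Rep

end Classes

/-! ### The product of stable homotopy groups. -/

section Products

variable {C : Type u} [Category.{v} C] [MonoidalCategory C] [SymmetricCategory C]
  [HasZeroMorphisms C] [HasBinaryCoproducts C]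
  [∀ P : C, PreservesColimitsOfShape (Discrete WalkingPair) (tensorLeft P)]
  [∀ P : C, PreservesColimitsOfShape (Discrete WalkingPair) (tensorRight P)]
  {T : C} (c : Cogroup T)

section

variable {P Q W X X' Y : C} (Δ : W ⟶ P ⊗ Q) (μ : X ⊗ X' ⟶ Y) (u : T ⟶ T)

/-- The external product twisted by an endomorphism of the first factor `T`. -/
def stageStar {a a' : ℕ} (f : Stage c P X a) (g : Stage c Q X' a') : Stage c W Y (a' + 1 + a) :=
  W ◁ onFirst u (a' + 1 + (a + 1)) ≫ starProd Δ μ (k := a + 1) (k' := a' + 1) f g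

variable {u} (hu : u ▷ T = T ◁ u)
include hu

lemma stageStar_add_left {a a' : ℕ} (f₁ f₂ : Stage c P X a) (g : Stage c Q X' a') :
    stageStar c Δ μ u (f₁ + f₂) g = stageStar c Δ μ u f₁ g + stageStar c Δ μ u f₂ g :=
  (congrArg (W ◁ onFirst u (a' + 1 + (a + 1)) ≫ ·) (starProd_homAdd_left c Δ μ f₁ f₂ g)).trans
    (onFirst_homAdd c hu (m := a' + 1 + a) (by omega) _ _)

lemma stageStar_add_right {a a' : ℕ} (f : Stage c P X a) (g₁ g₂ : Stage c Q X' a') :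
    stageStar c Δ μ u f (g₁ + g₂) = stageStar c Δ μ u f g₁ + stageStar c Δ μ u f g₂ :=
  (congrArg (W ◁ onFirst u (a' + 1 + (a + 1)) ≫ ·) (starProd_homAdd_right c Δ μ f g₁ g₂)).trans
    (onFirst_homAdd c hu (m := a' + 1 + a) (by omega) _ _)

end

lemma StablePi.lift_compat {E : TSpectrum C T} {V : C} {q : ℤ} {A : Type*} [AddCommGroup A]
    (g : ∀ j, piStage c V E q j →+ A)
    (hg : ∀ j x, g (j + 1) (stabHom c (E.σ _) _ x) = g j x) (i j : ℕ) (h : i ≤ j)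
    (x : piStage c V E q i) : g j (piStep c V E q h x) = g i x := by
  induction j, h using Nat.le_induction with
  | base => simp [piStep]
  | succ j h ih =>
    rw [piStep_succ c V E q h]
    exact (hg j _).trans ih

namespace RingStructure

variable {E : TSpectrum C T} (R : RingStructure E) (s : TSign T) {P Q W : C} (Δ : W ⟶ P ⊗ Q)

/-- The product of representatives with its sign. -/
def prod (q' : ℤ) (x : Rep E P) (y : Rep E Q) : Rep E W :=
  (R.star Δ x y).sgn s (q' * x.n).negOnePow

variable {q q' : ℤ}

section

variable {R s Δ} {x : Rep E P} {y : Rep E Q}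

lemma prod_degree (hx : (x.k : ℤ) = q + x.n) (hy : (y.k : ℤ) = q' + y.n) :
    ((R.prod s Δ q' x y).k : ℤ) = q + q' + (R.prod s Δ q' x y).n := by
  simp only [prod, Rep.sgn, Rep.onFirst, star]
  push_cast
  omega

lemma one_le_prod (hk : 1 ≤ x.k) : 1 ≤ (R.prod s Δ q' x y).k := by
  simp only [prod, Rep.sgn, Rep.onFirst, star]
  omega

end

/-- The sign `(-1)^(q'n)` involves only the degree of `y` and the level of `x`, so stabilising `y`
does not change it. -/
lemma prod_stab (x : Rep E P) (y : Rep E Q) (hk : 1 ≤ x.k) :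
    R.prod s Δ q' x y.stab = (R.prod s Δ q' x y).stab := by
  rw [prod, prod, R.star_stab, Rep.stab_sgn]
  simp only [star]
  omega

/-- The action of injections is trivial on the stable homotopy groups with coefficients in `V`. -/
def SemistableAt (V : C) : Prop := ∀ (q : ℤ) (h : ℕ → ℕ), Function.Injective h →
  ∀ x y : StablePi c V E q, InjActsTo c s V E R.perm q h x y → y = x

variable {R s} in
lemma SemistableAt.cls_eq {V : C} (hs : R.SemistableAt c s V) {ε : ℤˣ} {x y : Rep E V}
    (h : R.PermRel ε x y) (hq : (x.k : ℤ) = q + x.n) (hk : 2 ≤ x.k)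
    (hqy : (y.k : ℤ) = q + y.n) (hky : 1 ≤ y.k) :
    (y.sgn s ε).cls c hqy hky = x.cls c hq (by omega) :=
  Rep.cls_eq_of_permRel c s R (hs q) h hq hk hqy hky

variable (hs : R.SemistableAt c s W)

include hs in
-- The decisive compatibility. By `permRel_stab_star` and semistability the unsigned products differ
-- by `(-1)^(k' + n') = (-1)^q'`, and the built-in sign changes by the same factor when `n` grows by
-- one.
lemma cls_stab_prod (x : Rep E P) (y : Rep E Q) (hx : (x.k : ℤ) = q + x.n)
    (hy : (y.k : ℤ) = q' + y.n) (hk : 1 ≤ x.k) :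
    (R.prod s Δ q' x.stab y).cls c (q := q + q')
        (prod_degree (by simp only [Rep.stab]; push_cast; omega) hy)
        (one_le_prod (by simp only [Rep.stab]; omega)) =
      (R.prod s Δ q' x y).cls c (prod_degree hx hy) (one_le_prod hk) := by
  have h := R.permRel_sgn s (q' * x.n).negOnePow (R.permRel_stab_star s Δ x y)
  have hd := prod_degree (R := R) (s := s) (Δ := Δ) hx hy
  have h1 := hs.cls_eq c (q := q + q') h
    (by simp only [Rep.sgn, Rep.onFirst, Rep.stab, star]; push_cast; omega)
    (by simp only [Rep.sgn, Rep.onFirst, Rep.stab, star]; omega)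
    (by simp only [Rep.sgn, Rep.onFirst, Rep.stab, star]; push_cast; omega)
    (by simp only [Rep.sgn, Rep.onFirst, Rep.stab, star]; omega)
  rw [← Rep.cls_stab c _ hd (one_le_prod hk)]
  have e1 : (R.prod s Δ q' x y).stab = (R.star Δ x y).stab.sgn s (q' * x.n).negOnePow :=
    Rep.stab_sgn s _ _ (by simp only [star]; omega)
  have e2 : R.prod s Δ q' x.stab y =
      (((R.star Δ x.stab y).sgn s ((-1) ^ y.k)).sgn s (q' * x.n).negOnePow).sgn s
        ((-1) ^ y.n) := by
    rw [Rep.sgn_sgn, Rep.sgn_sgn, prod]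
    congr 1
    have h3 : ∀ m : ℕ, ((-1 : ℤˣ) ^ m) = (m : ℤ).negOnePow := fun m => by
      rw [Int.negOnePow_def]; rfl
    rw [h3, h3, ← Int.negOnePow_add, ← Int.negOnePow_add, hy]
    rw [Int.negOnePow_eq_iff]
    -- With `k' = q' + n'`, the exponents `q'(n + 1)` and `n' + q'n + k'` differ by `-2n'`.
    refine ⟨-y.n, ?_⟩
    simp only [Rep.stab]
    push_cast
    ring
  rw [Rep.cls_congr c e1, Rep.cls_congr c e2, h1]

/-- The product on stages of the colimits. -/
def prodStage (i j : ℕ) (f : piStage c P E q i) (g : piStage c Q E q' j) :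
    StablePi c W E (q + q') :=
  (R.prod s Δ q' (stageRep c E P q i f) (stageRep c E Q q' j g)).cls c
    (prod_degree (by simp only [stageRep]; omega) (by simp only [stageRep]; omega))
    (one_le_prod (by simp only [stageRep]; omega))

lemma prodStage_add_left (i j : ℕ) (f f' : piStage c P E q i) (g : piStage c Q E q' j) :
    R.prodStage c s Δ i j (f + f') g =
      R.prodStage c s Δ i j f g + R.prodStage c s Δ i j f' g := by
  have h := stageStar_add_left c Δ (R.mul ((2 - q).toNat + i) ((2 - q').toNat + j))
    (s.ofUnit_whisker (q' * ((2 - q).toNat + i : ℕ)).negOnePow) f f' g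
  refine Eq.trans ?_ (Rep.cls_add c (E := E) (q := q + q')
    (n := (2 - q).toNat + i + ((2 - q').toNat + j))
    (a := (q' - 2).toNat + j + 1 + 1 + ((q - 2).toNat + i + 1)) _ _ (by push_cast; omega))
  exact Rep.cls_congr c (congrArg (Rep.mk _ _) h) _ _

lemma prodStage_add_right (i j : ℕ) (f : piStage c P E q i) (g g' : piStage c Q E q' j) :
    R.prodStage c s Δ i j f (g + g') =
      R.prodStage c s Δ i j f g + R.prodStage c s Δ i j f g' := by
  have h := stageStar_add_right c Δ (R.mul ((2 - q).toNat + i) ((2 - q').toNat + j))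
    (s.ofUnit_whisker (q' * ((2 - q).toNat + i : ℕ)).negOnePow) f g g'
  refine Eq.trans ?_ (Rep.cls_add c (E := E) (q := q + q')
    (n := (2 - q).toNat + i + ((2 - q').toNat + j))
    (a := (q' - 2).toNat + j + 1 + 1 + ((q - 2).toNat + i + 1)) _ _ (by push_cast; omega))
  exact Rep.cls_congr c (congrArg (Rep.mk _ _) h) _ _

lemma prodStage_stabHom_right (i j : ℕ) (f : piStage c P E q i) (g : piStage c Q E q' j) :
    R.prodStage c s Δ i (j + 1) f (stabHom c (E.σ _) _ g) = R.prodStage c s Δ i j f g := by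
  have h := R.prod_stab s Δ (q' := q') (stageRep c E P q i f) (stageRep c E Q q' j g)
    (by simp only [stageRep]; omega)
  have hd : ((R.prod s Δ q' (stageRep c E P q i f) (stageRep c E Q q' j g)).k : ℤ) =
      q + q' + (R.prod s Δ q' (stageRep c E P q i f) (stageRep c E Q q' j g)).n :=
    prod_degree (by simp only [stageRep]; omega) (by simp only [stageRep]; omega)
  have hk : 1 ≤ (R.prod s Δ q' (stageRep c E P q i f) (stageRep c E Q q' j g)).k :=
    one_le_prod (by simp only [stageRep]; omega)
  exact (Rep.cls_congr c h (prod_degree (by simp only [stageRep]; omega)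
    (by simp only [stageRep, Rep.stab]; omega))
    (one_le_prod (by simp only [stageRep]; omega))).trans
    (Rep.cls_stab c _ hd hk)

include hs in
lemma prodStage_stabHom_left (i j : ℕ) (f : piStage c P E q i) (g : piStage c Q E q' j) :
    R.prodStage c s Δ (i + 1) j (stabHom c (E.σ _) _ f) g = R.prodStage c s Δ i j f g :=
  R.cls_stab_prod c s Δ hs (stageRep c E P q i f) (stageRep c E Q q' j g)
    (by simp only [stageRep]; omega) (by simp only [stageRep]; omega)
    (by simp only [stageRep]; omega)

/-- The product with an element of a stage of the colimit. -/
def prodRight (q' : ℤ) (i : ℕ) (f : piStage c P E q i) :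
    StablePi c Q E q' →+ StablePi c W E (q + q') :=
  AddCommGroup.DirectLimit.lift _ _ _
    (fun j => AddMonoidHom.mk' (fun g => R.prodStage c s Δ i j f g)
      (R.prodStage_add_right c s Δ i j f))
    (StablePi.lift_compat c _ fun j g => R.prodStage_stabHom_right c s Δ i j f g)

lemma prodRight_of (i j : ℕ) (f : piStage c P E q i) (g : piStage c Q E q' j) :
    R.prodRight c s Δ q' i f (AddCommGroup.DirectLimit.of _ _ j g) =
      R.prodStage c s Δ i j f g :=
  AddCommGroup.DirectLimit.lift_of _ _ _ _ _

/-- The product of stable homotopy groups. -/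
def prodHom (q q' : ℤ) :
    StablePi c P E q →+ StablePi c Q E q' →+ StablePi c W E (q + q') :=
  AddCommGroup.DirectLimit.lift _ _ _
    (fun i => AddMonoidHom.mk' (fun f => R.prodRight c s Δ q' i f) (fun f f' => by
      refine AddMonoidHom.ext fun y => ?_
      induction y using AddCommGroup.DirectLimit.induction_on with
      | ih j g =>
        rw [AddMonoidHom.add_apply, prodRight_of, prodRight_of, prodRight_of]
        exact R.prodStage_add_left c s Δ i j f f' g))
    -- Compatibility in the left variable; this is where the construction of the pairing uses
    -- semistability.
    (StablePi.lift_compat c _ fun i f => by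
      refine AddMonoidHom.ext fun y => ?_
      induction y using AddCommGroup.DirectLimit.induction_on with
      | ih j g =>
        refine (R.prodRight_of c s Δ (i + 1) j _ g).trans ?_
        refine (R.prodStage_stabHom_left c s Δ hs i j f g).trans ?_
        exact (R.prodRight_of c s Δ i j f g).symm)

lemma prodHom_of (i j : ℕ) (f : piStage c P E q i) (g : piStage c Q E q' j) :
    R.prodHom c s Δ hs q q' (AddCommGroup.DirectLimit.of _ _ i f)
      (AddCommGroup.DirectLimit.of _ _ j g) = R.prodStage c s Δ i j f g := by
  refine Eq.trans ?_ (R.prodRight_of c s Δ i j f g)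
  exact DFunLike.congr_fun (AddCommGroup.DirectLimit.lift_of _ _ _ _ f) _

/-- Representatives with `k = 1` lie on no stage of the colimit, so both factors are stabilised
first and the product is brought back by `cls_stab_prod` and `prod_stab`. -/
lemma prodHom_cls (x : Rep E P) (y : Rep E Q) (hx : (x.k : ℤ) = q + x.n)
    (hy : (y.k : ℤ) = q' + y.n) (hk : 1 ≤ x.k) (hk' : 1 ≤ y.k) :
    R.prodHom c s Δ hs q q' (x.cls c hx hk) (y.cls c hy hk') =
      (R.prod s Δ q' x y).cls c (prod_degree hx hy) (one_le_prod hk) := by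
  have hx' : (x.stab.k : ℤ) = q + x.stab.n := by simp only [Rep.stab]; push_cast; omega
  have hy' : (y.stab.k : ℤ) = q' + y.stab.n := by simp only [Rep.stab]; push_cast; omega
  have hkx : 1 ≤ x.stab.k := by simp only [Rep.stab]; omega
  obtain ⟨i, f, h⟩ := x.stab.exists_stageRep c hx' (by simp only [Rep.stab]; omega)
  obtain ⟨j, g, h'⟩ := y.stab.exists_stageRep c hy' (by simp only [Rep.stab]; omega)
  rw [Rep.cls_eq_of c hx hk h, Rep.cls_eq_of c hy hk' h', prodHom_of, ← R.cls_stab_prod c s Δ hs,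
    ← Rep.cls_stab c (R.prod s Δ q' x.stab y) (prod_degree hx' hy) (one_le_prod hkx),
    ← Rep.cls_congr c (R.prod_stab s Δ x.stab y hkx) (prod_degree hx' hy') (one_le_prod hkx)]
  · exact Rep.cls_congr c (by rw [h, h']) _ _
  all_goals assumption

end RingStructure

end Products

/-! ### Graded comultiplications and the format of bigraded rings. -/

lemma neg_one_pow_eq_negOnePow (m : ℕ) : (-1 : ℤˣ) ^ m = (m : ℤ).negOnePow := by
  rw [Int.negOnePow_def]
  rfl

/-- A comultiplication and a counit on a family of objects graded by a monoid. -/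
structure GradedComon {C : Type u} [Category.{v} C] [MonoidalCategory C] {N : Type w}
    [AddCommMonoid N] (P : N → C) where
  δ (r r' : N) : P (r + r') ⟶ P r ⊗ P r'
  ε : P 0 ⟶ 𝟙_ C
  coassoc (r r' r'' : N) : δ (r + r') r'' ≫ δ r r' ▷ P r'' ≫ (α_ _ _ _).hom =
    eqToHom (congrArg P (add_assoc r r' r'')) ≫ δ r (r' + r'') ≫ P r ◁ δ r' r''
  counit_right (r : N) : δ r 0 ≫ P r ◁ ε = eqToHom (congrArg P (add_zero r)) ≫ (ρ_ (P r)).inv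
  counit_left (r : N) : δ 0 r ≫ ε ▷ P r = eqToHom (congrArg P (zero_add r)) ≫ (λ_ (P r)).inv

/-- A graded ring structure on a family of groups indexed by a monoid and the integers. -/
@[reducible] def bigradedRing {N : Type*} [AddCommMonoid N] {A : N → ℤ → Type*}
    [∀ r q, AddCommGroup (A r q)]
    (mul : ∀ r r' q q', A r q →+ A r' q' →+ A (r + r') (q + q')) (one : A 0 0)
    (one_mul : ∀ r q (x : A r q), GradedMonoid.mk (A := fun p : N × ℤ => A p.1 p.2)
      (0 + r, 0 + q) (mul _ _ _ _ one x) = GradedMonoid.mk (r, q) x)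
    (mul_one : ∀ r q (x : A r q), GradedMonoid.mk (A := fun p : N × ℤ => A p.1 p.2)
      (r + 0, q + 0) (mul _ _ _ _ x one) = GradedMonoid.mk (r, q) x)
    (mul_assoc : ∀ r r' r'' q q' q'' (x : A r q) (y : A r' q') (z : A r'' q''),
      GradedMonoid.mk (A := fun p : N × ℤ => A p.1 p.2) (r + r' + r'', q + q' + q'')
        (mul (r + r') r'' (q + q') q'' (mul r r' q q' x y) z) =
      GradedMonoid.mk (r + (r' + r''), q + (q' + q''))
        (mul r (r' + r'') q (q' + q'') x (mul r' r'' q' q'' y z))) :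
    DirectSum.GRing fun p : N × ℤ => A p.1 p.2 :=
  letI : GradedMonoid.GMul fun p : N × ℤ => A p.1 p.2 := ⟨fun x y => mul _ _ _ _ x y⟩
  letI : GradedMonoid.GOne fun p : N × ℤ => A p.1 p.2 := ⟨one⟩
  { mul_zero x := (mul _ _ _ _ x).map_zero
    zero_mul y := DFunLike.congr_fun (mul _ _ _ _).map_zero y
    mul_add x := (mul _ _ _ _ x).map_add
    add_mul x x' y := DFunLike.congr_fun ((mul _ _ _ _).map_add x x') y
    one_mul := fun ⟨_, x⟩ => one_mul _ _ x
    mul_one := fun ⟨_, x⟩ => mul_one _ _ x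
    mul_assoc := fun ⟨_, x⟩ ⟨_, y⟩ ⟨_, z⟩ => mul_assoc _ _ _ _ _ _ x y z
    natCast n := n • one
    natCast_zero := zero_nsmul _
    natCast_succ n := succ_nsmul _ n
    intCast n := n • one
    intCast_ofNat n := natCast_zsmul _ n
    intCast_negSucc_ofNat n := negSucc_zsmul _ n }

lemma bigradedRing_mul {N : Type*} [AddCommMonoid N] {A : N → ℤ → Type*}
    [∀ r q, AddCommGroup (A r q)]
    (mul : ∀ r r' q q', A r q →+ A r' q' →+ A (r + r') (q + q')) (one : A 0 0)
    (one_mul : ∀ r q (x : A r q), GradedMonoid.mk (A := fun p : N × ℤ => A p.1 p.2)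
      (0 + r, 0 + q) (mul _ _ _ _ one x) = GradedMonoid.mk (r, q) x)
    (mul_one : ∀ r q (x : A r q), GradedMonoid.mk (A := fun p : N × ℤ => A p.1 p.2)
      (r + 0, q + 0) (mul _ _ _ _ x one) = GradedMonoid.mk (r, q) x)
    (mul_assoc : ∀ r r' r'' q q' q'' (x : A r q) (y : A r' q') (z : A r'' q''),
      GradedMonoid.mk (A := fun p : N × ℤ => A p.1 p.2) (r + r' + r'', q + q' + q'')
        (mul (r + r') r'' (q + q') q'' (mul r r' q q' x y) z) =
      GradedMonoid.mk (r + (r' + r''), q + (q' + q''))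
        (mul r (r' + r'') q (q' + q'') x (mul r' r'' q' q'' y z))) :
    ∀ (r r' : N) (q q' : ℤ) (x : A r q) (y : A r' q'),
      (bigradedRing mul one one_mul mul_one mul_assoc).mul (i := (r, q)) (j := (r', q')) x y =
        mul r r' q q' x y :=
  fun _ _ _ _ _ _ => rfl

/-! ### The graded ring axioms, signs, commutativity and naturality. -/

section GradedRings

variable {C : Type u} [Category.{v} C] [MonoidalCategory C] [SymmetricCategory C]
  [HasZeroMorphisms C] [HasBinaryCoproducts C]
  [∀ P : C, PreservesColimitsOfShape (Discrete WalkingPair) (tensorLeft P)]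
  [∀ P : C, PreservesColimitsOfShape (Discrete WalkingPair) (tensorRight P)]
  {T : C} (c : Cogroup T) {E : TSpectrum C T} {N : Type w} [AddCommMonoid N] {P : N → C}

/-- Turns equalities between different graded pieces into equalities of representatives. The degree
`q` does not enter the type `Rep`, so only the source object needs a transport. -/
lemma Rep.mk_cls_eq {p p' : N × ℤ} (hp : p.1 = p'.1) (hp' : p.2 = p'.2) {x : Rep E (P p.1)}
    {x' : Rep E (P p'.1)} (h : x = x'.pre (eqToHom (congrArg P hp)))
    (hq : (x.k : ℤ) = p.2 + x.n) (hk : 1 ≤ x.k)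
    (hq' : (x'.k : ℤ) = p'.2 + x'.n) (hk' : 1 ≤ x'.k) :
    GradedMonoid.mk (A := fun p : N × ℤ => StablePi c (P p.1) E p.2) p (x.cls c hq hk) =
      GradedMonoid.mk p' (x'.cls c hq' hk') := by
  obtain ⟨r, q⟩ := p
  obtain ⟨r', q'⟩ := p'
  dsimp only at hp hp'
  subst hp hp'
  rw [eqToHom_refl, pre_id] at h
  subst h
  rfl

namespace RingStructure

variable (R : RingStructure E) (s : TSign T)

/-- Commuting `ι₁` past `y` turns the product into `y.stab` at the cost of `(-1)^(k + n) = (-1)^q`,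
the sign in the product of the unit (at level 1) with `y`. -/
lemma cls_unit_star {V : C} (hs : R.SemistableAt c s V) {q : ℤ} (y : Rep E V)
    (hq : (y.k : ℤ) = q + y.n) (hk : 1 ≤ y.k) :
    ((R.star (λ_ V).inv R.unitRep y).sgn s q.negOnePow).cls c (q := q)
        (by simp only [star, Rep.sgn, Rep.onFirst, unitRep]; push_cast; omega)
        (by simp only [star, Rep.sgn, Rep.onFirst, unitRep]; omega) = y.cls c hq hk := by
  have h := R.permRel_comm s (ρ_ V).inv (R.commutes_unitRep y)
  rw [← R.stab_eq_star, show (ρ_ V).inv ≫ (β_ V (𝟙_ C)).hom = (λ_ V).inv by simp] at h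
  have h1 := hs.cls_eq c (q := q) h (by simp only [Rep.stab]; push_cast; omega)
    (by simp only [Rep.stab]; omega)
    (by simp only [star, Rep.sgn, Rep.onFirst, unitRep]; push_cast; omega)
    (by simp only [star, Rep.sgn, Rep.onFirst, unitRep]; omega)
  rw [Rep.cls_stab c y hq hk] at h1
  refine Eq.trans ?_ h1
  refine Rep.cls_congr c ?_ _ _
  rw [Rep.sgn_sgn, neg_one_pow_eq_negOnePow, neg_one_pow_eq_negOnePow, ← Int.negOnePow_add]
  congr 1
  rw [Int.negOnePow_eq_iff]
  refine ⟨-y.n, ?_⟩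
  simp only [unitRep]
  push_cast
  rw [hq]
  ring

/-- Holds already for representatives: the exponents `q''(n + n') + q'n` and `(q' + q'')n + q''n'`
are equal, and `star` is associative. -/
lemma prod_assoc {V W W' Q Q' Z : C} {Δ : W ⟶ V ⊗ Q} {Δ' : W' ⟶ W ⊗ Q'} {Δ₂ : W' ⟶ V ⊗ Z}
    {Δ₃ : Z ⟶ Q ⊗ Q'} (hΔ : Δ' ≫ Δ ▷ Q' ≫ (α_ _ _ _).hom = Δ₂ ≫ V ◁ Δ₃) {q' q'' : ℤ}
    (x : Rep E V) (y : Rep E Q) (z : Rep E Q') (hy : (y.k : ℤ) = q' + y.n) (hkx : 1 ≤ x.k)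
    (hky : 1 ≤ y.k) :
    R.prod s Δ' q'' (R.prod s Δ q' x y) z = R.prod s Δ₂ (q' + q'') x (R.prod s Δ₃ q'' y z) := by
  rw [prod, prod, prod, prod, R.sgn_star _ _ _ _ _ (by simp only [star]; omega),
    R.star_sgn _ _ _ _ _ (by simp only [star]; omega), R.star_assoc hΔ, Rep.sgn_sgn, Rep.sgn_sgn,
    ← Int.negOnePow_add, ← Int.negOnePow_add]
  congr 2
  simp only [Rep.sgn, Rep.onFirst, star]
  push_cast
  ring

variable {R s} (G : GradedComon P) (hs : ∀ r, R.SemistableAt c s (P r))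

/-- The multiplication of the graded ring. -/
def gMul (r r' : N) (q q' : ℤ) : StablePi c (P r) E q →+ StablePi c (P r') E q' →+
    StablePi c (P (r + r')) E (q + q') :=
  R.prodHom c s (G.δ r r') (hs _) q q'

lemma degree_unitRep_pre {V : C} (e : V ⟶ 𝟙_ C) :
    ((R.unitRep.pre e).k : ℤ) = 0 + (R.unitRep.pre e).n := by
  simp [Rep.pre, unitRep]

lemma one_le_unitRep_pre {V : C} (e : V ⟶ 𝟙_ C) : 1 ≤ (R.unitRep.pre e).k := by
  simp [Rep.pre, unitRep]

variable (R) in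
/-- The unit of the graded ring. -/
def gOne : StablePi c (P (0 : N)) E 0 :=
  (R.unitRep.pre G.ε).cls c (degree_unitRep_pre _) (one_le_unitRep_pre _)

lemma gMul_one (r : N) (q : ℤ) (x : StablePi c (P r) E q) :
    GradedMonoid.mk (A := fun p : N × ℤ => StablePi c (P p.1) E p.2) (r + 0, q + 0)
      (gMul c G hs r 0 q 0 x (gOne c R G)) = GradedMonoid.mk (r, q) x := by
  obtain ⟨x, hx, hk, rfl⟩ := Rep.exists_cls c x
  rw [gMul, gOne, prodHom_cls]
  -- The unit has degree 0, so no sign appears, and multiplying by it is stabilisation.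
  have h : R.prod s (G.δ r 0) 0 x (R.unitRep.pre G.ε) =
      x.stab.pre (eqToHom (congrArg P (add_zero r))) := by
    have h1 := R.star_pre (𝟙 _) G.ε (G.δ r 0) x R.unitRep
    rw [MonoidalCategory.id_tensorHom, G.counit_right, Rep.pre_id] at h1
    rw [prod, h1, zero_mul, Int.negOnePow_zero, Rep.sgn_one, R.stab_eq_star, R.pre_star]
  rw [← Rep.cls_stab c x hx (by omega)]
  exact Rep.mk_cls_eq c (p := (r + 0, q + 0)) (p' := (r, q)) (add_zero r) (add_zero q) h _ _ _ _

lemma one_gMul (r : N) (q : ℤ) (x : StablePi c (P r) E q) :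
    GradedMonoid.mk (A := fun p : N × ℤ => StablePi c (P p.1) E p.2) (0 + r, 0 + q)
      (gMul c G hs 0 r 0 q (gOne c R G) x) = GradedMonoid.mk (r, q) x := by
  obtain ⟨x, hx, hk, rfl⟩ := Rep.exists_cls c x
  rw [gMul, gOne, prodHom_cls, ← R.cls_unit_star c s (hs r) x hx (by omega)]
  refine Rep.mk_cls_eq c (p := (0 + r, 0 + q)) (p' := (r, q)) (zero_add r) (zero_add q) ?_ _ _ _ _
  have h1 := R.star_pre G.ε (𝟙 _) (G.δ 0 r) R.unitRep x
  rw [MonoidalCategory.tensorHom_id, G.counit_left, Rep.pre_id] at h1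
  rw [prod, h1, Rep.sgn_pre, R.pre_star]
  simp [Rep.pre, unitRep]

lemma gMul_assoc (r r' r'' : N) (q q' q'' : ℤ) (x : StablePi c (P r) E q)
    (y : StablePi c (P r') E q') (z : StablePi c (P r'') E q'') :
    GradedMonoid.mk (A := fun p : N × ℤ => StablePi c (P p.1) E p.2)
        (r + r' + r'', q + q' + q'')
        (gMul c G hs (r + r') r'' (q + q') q'' (gMul c G hs r r' q q' x y) z) =
      GradedMonoid.mk (r + (r' + r''), q + (q' + q''))
        (gMul c G hs r (r' + r'') q (q' + q'') x (gMul c G hs r' r'' q' q'' y z)) := by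
  obtain ⟨x, hx, hkx, rfl⟩ := Rep.exists_cls c x
  obtain ⟨y, hy, hky, rfl⟩ := Rep.exists_cls c y
  obtain ⟨z, hz, hkz, rfl⟩ := Rep.exists_cls c z
  simp only [gMul, prodHom_cls]
  refine Rep.mk_cls_eq c (p := (r + r' + r'', q + q' + q''))
    (p' := (r + (r' + r''), q + (q' + q'')))
    (add_assoc _ _ _) (add_assoc _ _ _) ?_ _ _ _ _
  -- The transport between the two bracketings of the index is made part of the diagonal `Δ₂`;
  -- coassociativity then has the form that `prod_assoc` requires.
  have h := R.prod_assoc s (q'' := q'') (Δ₂ := eqToHom (congrArg P (add_assoc r r' r'')) ≫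
    G.δ r (r' + r'')) ((G.coassoc r r' r'').trans (Category.assoc _ _ _).symm) x y z hy
    (by omega) (by omega)
  rw [h, prod, ← R.pre_star, ← Rep.sgn_pre]
  rfl

/-- The graded ring of stable homotopy groups. -/
@[reducible] def gRing : DirectSum.GRing fun p : N × ℤ => StablePi c (P p.1) E p.2 :=
  bigradedRing (A := fun r q => StablePi c (P r) E q) (gMul c G hs) (gOne c R G)
    (one_gMul c G hs) (gMul_one c G hs) (gMul_assoc c G hs)

lemma gRing_mul (r r' : N) (q q' : ℤ) (x : StablePi c (P r) E q) (y : StablePi c (P r') E q') :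
    (gRing c G hs).mul (i := (r, q)) (j := (r', q')) x y = gMul c G hs r r' q q' x y :=
  bigradedRing_mul (A := fun r q => StablePi c (P r) E q) (gMul c G hs) (gOne c R G)
    (one_gMul c G hs) (gMul_one c G hs) (gMul_assoc c G hs) r r' q q' x y

lemma piTwist_gMul_left (r r' : N) (q q' : ℤ) (x : StablePi c (P r) E q)
    (y : StablePi c (P r') E q') (ε : ℤˣ) :
    piTwist c (s.ofUnit ε) (s.ofUnit_whisker ε) (gMul c G hs r r' q q' x y) =
      gMul c G hs r r' q q' (piTwist c (s.ofUnit ε) (s.ofUnit_whisker ε) x) y := by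
  obtain ⟨x, hx, hkx, rfl⟩ := Rep.exists_cls c x
  obtain ⟨y, hy, hky, rfl⟩ := Rep.exists_cls c y
  have h : R.prod s (G.δ r r') q' (x.sgn s ε) y = (R.prod s (G.δ r r') q' x y).sgn s ε := by
    rw [prod, prod, R.sgn_star _ _ _ _ _ (by omega), Rep.sgn_sgn, Rep.sgn_sgn, mul_comm]
    rfl
  rw [Rep.piTwist_cls, gMul, prodHom_cls, Rep.piTwist_cls]
  exact ((prodHom_cls c R s _ _ (x.sgn s ε) y hx hy _ _).trans (Rep.cls_congr c h _ _)).symm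

lemma piTwist_gMul_right (r r' : N) (q q' : ℤ) (x : StablePi c (P r) E q)
    (y : StablePi c (P r') E q') (ε : ℤˣ) :
    piTwist c (s.ofUnit ε) (s.ofUnit_whisker ε) (gMul c G hs r r' q q' x y) =
      gMul c G hs r r' q q' x (piTwist c (s.ofUnit ε) (s.ofUnit_whisker ε) y) := by
  obtain ⟨x, hx, hkx, rfl⟩ := Rep.exists_cls c x
  obtain ⟨y, hy, hky, rfl⟩ := Rep.exists_cls c y
  have h : R.prod s (G.δ r r') q' x (y.sgn s ε) = (R.prod s (G.δ r r') q' x y).sgn s ε := by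
    rw [prod, prod, R.star_sgn _ _ _ _ _ (by omega), Rep.sgn_sgn, Rep.sgn_sgn, mul_comm]
  rw [Rep.piTwist_cls, gMul, prodHom_cls, Rep.piTwist_cls]
  exact ((prodHom_cls c R s _ _ x (y.sgn s ε) hx hy _ _).trans (Rep.cls_congr c h _ _)).symm

/-- Only one of the representatives need be special: `h` asks that these two commute, which covers
commutative ring spectra and central maps alike. The map `t` measures the failure of `G.δ` to be
cocommutative. -/
lemma gMul_comm {r r' : N} {q q' : ℤ} {t : P (r + r') ⟶ P (r' + r)}
    (ht : G.δ r r' ≫ (β_ _ _).hom = t ≫ G.δ r' r) (x : Rep E (P r)) (y : Rep E (P r'))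
    (hx : (x.k : ℤ) = q + x.n) (hkx : 1 ≤ x.k) (hy : (y.k : ℤ) = q' + y.n) (hky : 1 ≤ y.k)
    (h : R.Commutes x y) :
    GradedMonoid.mk (A := fun p : N × ℤ => StablePi c (P p.1) E p.2) (r + r', q + q')
        (gMul c G hs r r' q q' (x.cls c hx hkx) (y.cls c hy hky)) =
      GradedMonoid.mk (r + r', q' + q)
        (piTwist c (s.ofUnit (q * q').negOnePow) (s.ofUnit_whisker _)
          (piMap c t ⟨fun _ => 𝟙 _, fun _ => by simp⟩ (q' + q)
            (gMul c G hs r' r q' q (y.cls c hy hky) (x.cls c hx hkx)))) := by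
  have h1 := (hs (r + r')).cls_eq c (q := q + q')
    (R.permRel_sgn s (q' * x.n).negOnePow (R.permRel_comm s (G.δ r r') h))
    (by simp only [Rep.sgn, Rep.onFirst, star]; push_cast; omega)
    (by simp only [Rep.sgn, Rep.onFirst, star]; omega)
    (by simp only [Rep.sgn, Rep.onFirst, star]; push_cast; omega)
    (by simp only [Rep.sgn, Rep.onFirst, star]; omega)
  have h2 : R.prod s (G.δ r r') q' x y = (R.star (G.δ r r') x y).sgn s (q' * x.n).negOnePow := rfl
  rw [gMul, gMul, prodHom_cls, prodHom_cls, Rep.piMap_cls]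
  refine (congrArg _ h1.symm).trans (Eq.trans ?_
    (congrArg (GradedMonoid.mk _) (Rep.piTwist_cls c _ _ _ _ _).symm))
  refine Rep.mk_cls_eq c (p := (r + r', q + q')) (p' := (r + r', q' + q)) rfl (add_comm _ _)
    ?_ _ _ _ _
  rw [eqToHom_refl, Rep.pre_id]
  have h3 (z : Rep E (P (r + r'))) : z.map ⟨fun _ => 𝟙 _, fun _ => by simp⟩ = z := by
    simp [Rep.map]
  rw [h3, prod, Rep.sgn_pre, R.pre_star, ← ht]
  change _ = ((R.star (G.δ r r' ≫ (β_ (P r) (P r')).hom) y x).sgn s _).sgn s _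
  rw [Rep.sgn_sgn, Rep.sgn_sgn, Rep.sgn_sgn, neg_one_pow_eq_negOnePow, neg_one_pow_eq_negOnePow,
    ← Int.negOnePow_add, ← Int.negOnePow_add, ← Int.negOnePow_add]
  congr 1
  rw [Int.negOnePow_eq_iff]
  push_cast
  rw [hx, hy]
  -- Half the difference between `nn' + q'n + kk'` and `qq' + qn'`, where `k = q + n` and `k' = q' +
  -- n'`.
  refine ⟨q' * x.n + x.n * y.n, ?_⟩
  ring

lemma piMap_gOne {E' : TSpectrum C T} {R' : RingStructure E'} (φ : E.Hom E')
    (h : R.ι₁ ≫ φ.app 1 = R'.ι₁) :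
    piMap c (𝟙 _) φ 0 (gOne c R G) = gOne c R' G := by
  rw [gOne, Rep.piMap_cls]
  refine Rep.cls_congr c ?_ _ _
  simp [Rep.map, Rep.pre, unitRep, h]

lemma piMap_gMul {E' : TSpectrum C T} {R' : RingStructure E'}
    (hs' : ∀ r, R'.SemistableAt c s (P r)) (φ : E.Hom E')
    (h : ∀ n m, R.mul n m ≫ φ.app (n + m) = (φ.app n ⊗ₘ φ.app m) ≫ R'.mul n m)
    (r r' : N) (q q' : ℤ) (x : StablePi c (P r) E q) (y : StablePi c (P r') E q') :
    piMap c (𝟙 _) φ (q + q') (gMul c G hs r r' q q' x y) =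
      gMul c G hs' r r' q q' (piMap c (𝟙 _) φ q x) (piMap c (𝟙 _) φ q' y) := by
  obtain ⟨x, hx, hkx, rfl⟩ := Rep.exists_cls c x
  obtain ⟨y, hy, hky, rfl⟩ := Rep.exists_cls c y
  have e : (R.prod s (G.δ r r') q' x y).map φ =
      R'.prod s (G.δ r r') q' (x.map φ) (y.map φ) := by
    refine congrArg (Rep.mk _ _) ((Category.assoc _ _ _).trans (congrArg (_ ◁ _ ≫ ·) ?_))
    refine (starProd_comp _ _ _ _ _).trans ?_
    refine (congrArg (fun μ => starProd (G.δ r r') μ x.hom y.hom) (h x.n y.n)).trans ?_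
    exact (starProd_comp_comp _ _ _ _ _ _).symm
  have hl : piMap c (𝟙 _) φ (q + q') (gMul c G hs r r' q q' (x.cls c hx (by omega))
      (y.cls c hy (by omega))) = ((R.prod s (G.δ r r') q' x y).map φ).cls c _ _ :=
    (congrArg _ (prodHom_cls c R s _ _ x y hx hy _ _)).trans ((Rep.piMap_cls c _ φ _ _ _).trans
      (Rep.cls_congr c (congrArg _ (Rep.pre_id _)) _ _))
  have hr {V : C} {q : ℤ} (z : Rep E V) (hz : (z.k : ℤ) = q + z.n) (hk : 1 ≤ z.k) :
      piMap c (𝟙 _) φ q (z.cls c hz hk) = (z.map φ).cls c hz hk :=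
    (Rep.piMap_cls c _ φ _ _ _).trans (Rep.cls_congr c (congrArg _ (Rep.pre_id _)) _ _)
  refine hl.trans (Eq.trans ?_ (congrArg₂ (fun a b => gMul c G hs' r r' q q' a b)
    (hr x hx (by omega)) (hr y hy (by omega))).symm)
  exact (Rep.cls_congr c e _ _).trans
    (prodHom_cls c R' s _ _ (x.map φ) (y.map φ) hx hy _ _).symm

end RingStructure

end GradedRings

/-! ### The graded comultiplication on the objects `F r ⊗ U`. -/

lemma eqToHom_obj_tensor {C : Type u} [Category.{v} C] [MonoidalCategory C] {N : Type w}
    (F : Discrete N ⥤ C) (U : C) {r r' : N} (h : r = r') :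
    eqToHom (congrArg (fun r => F.obj ⟨r⟩ ⊗ U) h) =
      F.map (eqToHom (congrArg Discrete.mk h)) ⊗ₘ 𝟙 U := by
  subst h
  simp

section Comonoids

variable {C : Type u} [Category.{v} C] [MonoidalCategory C] [SymmetricCategory C]

lemma tensorδ_eq_tensorμ (X₁ X₂ Y₁ Y₂ : C) :
    tensorδ X₁ X₂ Y₁ Y₂ = tensorμ X₁ Y₁ X₂ Y₂ := by
  simp only [tensorδ, tensorμ, SymmetricCategory.braiding_swap_eq_inv_braiding]

/-- By symmetry the inverse of an interchange is again an interchange, so the coherence laws for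
`tensorμ` on algebras can be reversed for coalgebras. -/
lemma tensorμ_tensorμ (X₁ X₂ Y₁ Y₂ : C) :
    tensorμ X₁ X₂ Y₁ Y₂ ≫ tensorμ X₁ Y₁ X₂ Y₂ = 𝟙 _ := by
  rw [← tensorδ_eq_tensorμ X₁ X₂ Y₁ Y₂, tensorμ_tensorδ]

/-- This is `tensor_associativity` with every interchange moved to the other side by
`tensorμ_tensorμ`. -/
lemma tensorμ_coassoc (A B D U V W : C) :
    tensorμ (A ⊗ B) D (U ⊗ V) W ≫ tensorμ A B U V ▷ (D ⊗ W) ≫ (α_ _ _ _).hom =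
      ((α_ A B D).hom ⊗ₘ (α_ U V W).hom) ≫ tensorμ A (B ⊗ D) U (V ⊗ W) ≫
        (A ⊗ U) ◁ tensorμ B D V W := by
  have h := tensor_associativity A U B V D W
  have h1 : (α_ (A ⊗ U) (B ⊗ V) (D ⊗ W)).hom = tensorμ A U B V ▷ (D ⊗ W) ≫
      tensorμ (A ⊗ B) (U ⊗ V) D W ≫ ((α_ A B D).hom ⊗ₘ (α_ U V W).hom) ≫
      tensorμ A (B ⊗ D) U (V ⊗ W) ≫ (A ⊗ U) ◁ tensorμ B D V W := by
    have h2 := congrArg (· ≫ tensorμ A (B ⊗ D) U (V ⊗ W) ≫ (A ⊗ U) ◁ tensorμ B D V W) h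
    simp only [Category.assoc] at h2
    rw [h2, reassoc_of% tensorμ_tensorμ, ← whiskerLeft_comp, tensorμ_tensorμ, whiskerLeft_id,
      Category.comp_id]
  rw [h1, ← comp_whiskerRight_assoc, tensorμ_tensorμ, id_whiskerRight, Category.id_comp,
    reassoc_of% tensorμ_tensorμ]

lemma tensorμ_counit_right (A U : C) :
    ((ρ_ A).inv ⊗ₘ (ρ_ U).inv) ≫ tensorμ A (𝟙_ C) U (𝟙_ C) ≫ (A ⊗ U) ◁ (λ_ (𝟙_ C)).hom =
      (ρ_ (A ⊗ U)).inv := by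
  rw [← cancel_mono (ρ_ (A ⊗ U)).hom, Iso.inv_hom_id, tensor_right_unitality]
  simp only [Category.assoc, ← whiskerLeft_comp_assoc, Iso.hom_inv_id, whiskerLeft_id,
    Category.id_comp, reassoc_of% tensorμ_tensorμ]
  simp

lemma tensorμ_counit_left (A U : C) :
    ((λ_ A).inv ⊗ₘ (λ_ U).inv) ≫ tensorμ (𝟙_ C) A (𝟙_ C) U ≫ (λ_ (𝟙_ C)).hom ▷ (A ⊗ U) =
      (λ_ (A ⊗ U)).inv := by
  rw [← cancel_mono (λ_ (A ⊗ U)).hom, Iso.inv_hom_id, tensor_left_unitality]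
  simp only [Category.assoc, ← comp_whiskerRight_assoc, Iso.hom_inv_id, id_whiskerRight,
    Category.id_comp, reassoc_of% tensorμ_tensorμ]
  simp

section

variable (U : C) [ComonObj U] {X X₁ X₂ X₃ X₁₂ X₂₃ X' : C}

/-- Coassociativity is checked separately on the graded part and on `U`, after the interchanges are
collected by `tensorμ_coassoc`. The map `a` is the slot for the transport between the two
bracketings of a degree. -/
lemma tensor_comul_coassoc {d₁ : X ⟶ X₁₂ ⊗ X₃} {d₂ : X₁₂ ⟶ X₁ ⊗ X₂} {d₃ : X' ⟶ X₁ ⊗ X₂₃}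
    {d₄ : X₂₃ ⟶ X₂ ⊗ X₃} {a : X ⟶ X'}
    (h : d₁ ≫ d₂ ▷ X₃ ≫ (α_ _ _ _).hom = a ≫ d₃ ≫ X₁ ◁ d₄) :
    ((d₁ ⊗ₘ ComonObj.comul (X := U)) ≫ tensorμ _ _ _ _) ≫
        ((d₂ ⊗ₘ ComonObj.comul (X := U)) ≫ tensorμ _ _ _ _) ▷ (X₃ ⊗ U) ≫ (α_ _ _ _).hom =
      (a ⊗ₘ 𝟙 U) ≫ ((d₃ ⊗ₘ ComonObj.comul (X := U)) ≫ tensorμ _ _ _ _) ≫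
        (X₁ ⊗ U) ◁ ((d₄ ⊗ₘ ComonObj.comul (X := U)) ≫ tensorμ _ _ _ _) := by
  have h1 := tensorμ_natural d₂ (𝟙 X₃) (ComonObj.comul (X := U)) (𝟙 U)
  have h2 := tensorμ_natural (𝟙 X₁) d₄ (𝟙 U) (ComonObj.comul (X := U))
  rw [MonoidalCategory.id_tensorHom_id, MonoidalCategory.tensorHom_id,
    MonoidalCategory.tensorHom_id, MonoidalCategory.tensorHom_id] at h1
  rw [MonoidalCategory.id_tensorHom_id, MonoidalCategory.id_tensorHom,
    MonoidalCategory.id_tensorHom, MonoidalCategory.id_tensorHom] at h2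
  simp only [comp_whiskerRight, whiskerLeft_comp, Category.assoc]
  rw [← reassoc_of% h1, tensorμ_coassoc, ← reassoc_of% h2]
  simp only [MonoidalCategory.tensorHom_comp_tensorHom_assoc, h,
    ← ComonObj.comul_assoc, Category.id_comp]

lemma tensor_comul_counit {d : X ⟶ X₁ ⊗ X₂} {e : X₂ ⟶ 𝟙_ C} {a : X ⟶ X₁}
    (h : d ≫ X₁ ◁ e = a ≫ (ρ_ X₁).inv) :
    ((d ⊗ₘ ComonObj.comul (X := U)) ≫ tensorμ _ _ _ _) ≫
        (X₁ ⊗ U) ◁ ((e ⊗ₘ ComonObj.counit (X := U)) ≫ (λ_ (𝟙_ C)).hom) =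
      (a ⊗ₘ 𝟙 U) ≫ (ρ_ (X₁ ⊗ U)).inv := by
  have h2 := tensorμ_natural (𝟙 X₁) e (𝟙 U) (ComonObj.counit (X := U))
  rw [MonoidalCategory.id_tensorHom_id, MonoidalCategory.id_tensorHom,
    MonoidalCategory.id_tensorHom, MonoidalCategory.id_tensorHom] at h2
  rw [whiskerLeft_comp, Category.assoc, ← reassoc_of% h2,
    MonoidalCategory.tensorHom_comp_tensorHom_assoc, h, ComonObj.comul_counit,
    ← tensorμ_counit_right, MonoidalCategory.tensorHom_comp_tensorHom_assoc, Category.id_comp]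

lemma tensor_counit_comul {d : X ⟶ X₁ ⊗ X₂} {e : X₁ ⟶ 𝟙_ C} {a : X ⟶ X₂}
    (h : d ≫ e ▷ X₂ = a ≫ (λ_ X₂).inv) :
    ((d ⊗ₘ ComonObj.comul (X := U)) ≫ tensorμ _ _ _ _) ≫
        ((e ⊗ₘ ComonObj.counit (X := U)) ≫ (λ_ (𝟙_ C)).hom) ▷ (X₂ ⊗ U) =
      (a ⊗ₘ 𝟙 U) ≫ (λ_ (X₂ ⊗ U)).inv := by
  have h2 := tensorμ_natural e (𝟙 X₂) (ComonObj.counit (X := U)) (𝟙 U)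
  rw [MonoidalCategory.id_tensorHom_id, MonoidalCategory.tensorHom_id,
    MonoidalCategory.tensorHom_id, MonoidalCategory.tensorHom_id] at h2
  rw [comp_whiskerRight, Category.assoc, ← reassoc_of% h2,
    MonoidalCategory.tensorHom_comp_tensorHom_assoc, h, ComonObj.counit_comul,
    ← tensorμ_counit_left, MonoidalCategory.tensorHom_comp_tensorHom_assoc, Category.id_comp]

end

variable {N : Type w} [AddCommMonoid N] (F : Discrete N ⥤ C) [F.Monoidal] (U : C) [ComonObj U]

/-- The comultiplication on the objects `F r ⊗ U` for a monoidal functor `F` and a comonoid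
`U`. -/
def gradedComon : GradedComon fun r => F.obj ⟨r⟩ ⊗ U where
  δ r r' := (Functor.OplaxMonoidal.δ F ⟨r⟩ ⟨r'⟩ ⊗ₘ ComonObj.comul) ≫ tensorμ _ _ _ _
  ε := (Functor.OplaxMonoidal.η F ⊗ₘ ComonObj.counit) ≫ (λ_ (𝟙_ C)).hom
  coassoc r r' r'' := by
    rw [eqToHom_obj_tensor F U (add_assoc r r' r'')]
    refine tensor_comul_coassoc U ?_
    refine (Functor.OplaxMonoidal.associativity F ⟨r⟩ ⟨r'⟩ ⟨r''⟩).trans ?_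
    congr 2
  counit_right r := by
    rw [eqToHom_obj_tensor F U (add_zero r)]
    refine tensor_comul_counit U ?_
    -- Parallel morphisms of `Discrete N` are equal, so the transport composed with the inverse
    -- unitor is an identity.
    rw [Functor.OplaxMonoidal.right_unitality, ← Functor.map_comp_assoc,
      Subsingleton.elim (_ ≫ (ρ_ (⟨r⟩ : Discrete N)).inv) (𝟙 _)]
    exact ((congrArg (· ≫ _) (F.map_id _)).trans (Category.id_comp _)).symm
  counit_left r := by
    rw [eqToHom_obj_tensor F U (zero_add r)]
    refine tensor_counit_comul U ?_
    rw [Functor.OplaxMonoidal.left_unitality, ← Functor.map_comp_assoc,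
      Subsingleton.elim (_ ≫ (λ_ (⟨r⟩ : Discrete N)).inv) (𝟙 _)]
    exact ((congrArg (· ≫ _) (F.map_id _)).trans (Category.id_comp _)).symm

end Comonoids

lemma cast_add_eq {k n k' n' : ℕ} {q q' : ℤ} (hq : (k : ℤ) = q + n) (hq' : (k' : ℤ) = q' + n') :
    ((k' + k : ℕ) : ℤ) = q + q' + (n + n' : ℕ) := by
  omega

/-! ### Transfer of ring spectra along a braided functor. -/

section MapLax

variable {D : Type*} [Category* D] [MonoidalCategory D] [SymmetricCategory D]
  {C : Type u} [Category.{v} C] [MonoidalCategory C] [SymmetricCategory C]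
  (L : D ⥤ C) [L.Braided] {T : D} (R : SymRingSpectrum D T)

section

open Functor.LaxMonoidal

lemma whiskerLeft_map_μ {A B X Z : D} (f : A ⟶ B) (m : X ⊗ B ⟶ Z) :
    μ L X A ≫ L.map (X ◁ f ≫ m) = L.obj X ◁ L.map f ≫ μ L X B ≫ L.map m := by
  rw [μ_natural_right_assoc, L.map_comp]

lemma tensorHom_map_μ {A A' X X' Y Z : D} {f : A ⟶ X} {f' : A' ⟶ X'} {m : X ⊗ X' ⟶ Z}
    {m' : A ⊗ A' ⟶ Y} {g : Y ⟶ Z} (h : (f ⊗ₘ f') ≫ m = m' ≫ g) :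
    (L.map f ⊗ₘ L.map f') ≫ μ L X X' ≫ L.map m = (μ L A A' ≫ L.map m') ≫ L.map g := by
  rw [μ_natural_assoc, ← L.map_comp, h, L.map_comp, Category.assoc]

/-- The separate `e'` allows the conclusion to carry an `eqToHom` of the target category instead of
the image of one. -/
lemma μ_map_assoc {X Y Z V W W' V' : D} {m : X ⊗ Y ⟶ V} {m' : V ⊗ Z ⟶ W} {n : Y ⊗ Z ⟶ V'}
    {n' : X ⊗ V' ⟶ W'} {e : W' ⟶ W} (h : m ▷ Z ≫ m' = (α_ X Y Z).hom ≫ X ◁ n ≫ n' ≫ e)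
    {e' : L.obj W' ⟶ L.obj W} (he : e' = L.map e) :
    (μ L X Y ≫ L.map m) ▷ L.obj Z ≫ μ L V Z ≫ L.map m' =
      (α_ _ _ _).hom ≫ L.obj X ◁ (μ L Y Z ≫ L.map n) ≫ (μ L X V' ≫ L.map n') ≫ e' := by
  rw [comp_whiskerRight, Category.assoc, μ_natural_left_assoc, ← L.map_comp, h, whiskerLeft_comp,
    Category.assoc, Category.assoc, μ_natural_right_assoc, L.map_comp, associativity_assoc,
    L.map_comp, L.map_comp, he]

/-- The common source of the commutation lemmas below, obtained by taking `f` or `g` or both to be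
identities. Arbitrary maps `p`, `q` of `C` are allowed in front because representatives need not
come from `D`. -/
lemma μ_map_comm {A B X Y Z Z' : D} {P Q : C} {f : A ⟶ X} {g : B ⟶ Y} {m : X ⊗ Y ⟶ Z'}
    {σ : Z' ⟶ Z'} {e : Z' ⟶ Z} {m' : Y ⊗ X ⟶ Z}
    (h : (f ⊗ₘ g) ≫ m ≫ σ ≫ e = (β_ A B).hom ≫ (g ⊗ₘ f) ≫ m')
    (p : P ⟶ L.obj A) (q : Q ⟶ L.obj B) {e' : L.obj Z' ⟶ L.obj Z} (he : e' = L.map e) :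
    ((p ≫ L.map f) ⊗ₘ (q ≫ L.map g)) ≫ (μ L X Y ≫ L.map m) ≫ L.map σ ≫ e' =
      (β_ P Q).hom ≫ ((q ≫ L.map g) ⊗ₘ (p ≫ L.map f)) ≫ μ L Y X ≫ L.map m' := by
  rw [← MonoidalCategory.tensorHom_comp_tensorHom, ← MonoidalCategory.tensorHom_comp_tensorHom, he]
  simp only [Category.assoc]
  rw [μ_natural_assoc, μ_natural_assoc, ← L.map_comp, ← L.map_comp, ← L.map_comp, h,
    L.map_comp, Functor.LaxBraided.braided_assoc, BraidedCategory.braiding_naturality_assoc,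
    L.map_comp]

lemma μ_map_unit_comm {B X Y Z Z' : D} {g : B ⟶ Y} {m : X ⊗ Y ⟶ Z'} {σ : Z' ⟶ Z'} {e : Z' ⟶ Z}
    {m' : Y ⊗ X ⟶ Z} (h : X ◁ g ≫ m ≫ σ ≫ e = (β_ X B).hom ≫ g ▷ X ≫ m')
    {e' : L.obj Z' ⟶ L.obj Z} (he : e' = L.map e) :
    L.obj X ◁ L.map g ≫ (μ L X Y ≫ L.map m) ≫ L.map σ ≫ e' =
      (β_ _ _).hom ≫ L.map g ▷ L.obj X ≫ μ L Y X ≫ L.map m' := by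
  rw [← MonoidalCategory.id_tensorHom, ← MonoidalCategory.tensorHom_id] at h
  have h' := μ_map_comm L h (𝟙 _) (𝟙 _) he
  rwa [L.map_id, Category.id_comp, Category.id_comp, MonoidalCategory.id_tensorHom,
    MonoidalCategory.tensorHom_id] at h'

lemma μ_map_central_comm {A X Y Z Z' : D} {P Q : C} {f : A ⟶ X} {m : X ⊗ Y ⟶ Z'} {σ : Z' ⟶ Z'}
    {e : Z' ⟶ Z} {m' : Y ⊗ X ⟶ Z} (h : f ▷ Y ≫ m ≫ σ ≫ e = (β_ A Y).hom ≫ Y ◁ f ≫ m')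
    (p : P ⟶ L.obj A) (q : Q ⟶ L.obj Y) {e' : L.obj Z' ⟶ L.obj Z} (he : e' = L.map e) :
    ((p ≫ L.map f) ⊗ₘ q) ≫ (μ L X Y ≫ L.map m) ≫ L.map σ ≫ e' =
      (β_ P Q).hom ≫ (q ⊗ₘ (p ≫ L.map f)) ≫ μ L Y X ≫ L.map m' := by
  rw [← MonoidalCategory.id_tensorHom, ← MonoidalCategory.tensorHom_id] at h
  have h' := μ_map_comm L h p q he
  rwa [L.map_id, Category.comp_id] at h'

lemma μ_map_mul_comm {X Y Z Z' : D} {P Q : C} {m : X ⊗ Y ⟶ Z'} {σ : Z' ⟶ Z'} {e : Z' ⟶ Z}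
    {m' : Y ⊗ X ⟶ Z} (h : m ≫ σ ≫ e = (β_ X Y).hom ≫ m')
    (p : P ⟶ L.obj X) (q : Q ⟶ L.obj Y) {e' : L.obj Z' ⟶ L.obj Z} (he : e' = L.map e) :
    (p ⊗ₘ q) ≫ (μ L X Y ≫ L.map m) ≫ L.map σ ≫ e' =
      (β_ P Q).hom ≫ (q ⊗ₘ p) ≫ μ L Y X ≫ L.map m' := by
  have h1 : 𝟙 X ▷ Y ≫ m ≫ σ ≫ e = (β_ X Y).hom ≫ Y ◁ 𝟙 X ≫ m' := by
    rw [id_whiskerRight, Category.id_comp, whiskerLeft_id, Category.id_comp, h]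
  have h' := μ_map_central_comm L h1 p q he
  rwa [L.map_id, Category.comp_id] at h'

end

/-- The ring structure on the image of a symmetric ring spectrum. -/
def SymRingSpectrum.ringStructure : RingStructure (R.spectrum.mapLax L) where
  perm n := (L.mapEnd (R.X n)).comp (R.perm n)
  mul n m := Functor.LaxMonoidal.μ L (R.X n) (R.X m) ≫ L.map (R.mul n m)
  ι₁ := L.map R.ι₁
  σ_eq _ := whiskerLeft_map_μ L _ _
  equivariant _ _ γ δ := tensorHom_map_μ L (R.equivariant _ _ γ δ)
  assoc n m l := μ_map_assoc L (R.assoc n m l) (eqToHom_map L _).symm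
  central n := μ_map_unit_comm L (R.central n) (eqToHom_map L _).symm

variable {R}

/-- Centrality is tested against the whole level `R.X m` in `D`, so by naturality it passes to every
`y` in `C`, even one that is not the image of a map of `D`. -/
lemma SymRingSpectrum.IsCentral.commutes {A : D} {n : ℕ} {f : A ⟶ R.X n} (hf : R.IsCentral f)
    {P Q : C} (y : Rep (R.spectrum.mapLax L) Q) {k : ℕ} (p : P ⊗ tpow (L.obj T) k ⟶ L.obj A) :
    (R.ringStructure L).Commutes (⟨k, n, p ≫ L.map f⟩ : Rep (R.spectrum.mapLax L) P) y :=
  μ_map_central_comm L (hf y.n) p y.hom (eqToHom_map L _).symm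

lemma SymRingSpectrum.IsCommutative.commutes (hR : R.IsCommutative) {P Q : C}
    (x : Rep (R.spectrum.mapLax L) P) (y : Rep (R.spectrum.mapLax L) Q) :
    (R.ringStructure L).Commutes x y :=
  μ_map_mul_comm L (hR x.n y.n) x.hom y.hom (eqToHom_map L _).symm

end MapLax

/-! ### The graded ring of a semistable symmetric ring spectrum. -/

section Final

variable {D : Type u} [Category.{v} D] [MonoidalCategory D] [SymmetricCategory D]
  [MonoidalClosed D] [ModelCategory D] [HasZeroObject D] [MonoidalModelCategory D]
  [(weakEquivalences D).IsMonoidal]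
  {T : D} (c : Cogroup ((toHo D).obj T)) (s : TSign ((toHo D).obj T))
  {N : Type w} [AddCommMonoid N] (S : Discrete N ⥤ D) [S.Monoidal]
  (U : D) [ComonObj U] [IsCommComonObj U]

/-- The comultiplication on the objects `𝕊^r ⊗ U` of the homotopy category. -/
abbrev sphereComon : GradedComon fun r => sphere S r U :=
  letI : ComonObj ((toHo D).obj U) := Functor.obj.instComonObj U (toHo D)
  gradedComon (S ⋙ toHo D) ((toHo D).obj U)

variable {U}

lemma map_comul_comm : ((toHo D).map (ComonObj.comul (X := U)) ≫
    Functor.OplaxMonoidal.δ (toHo D) U U) ≫ (β_ _ _).hom =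
      (toHo D).map (ComonObj.comul (X := U)) ≫ Functor.OplaxMonoidal.δ (toHo D) U U := by
  conv_rhs => rw [← IsCommComonObj.comul_comm U, Functor.map_comp, Functor.map_braiding]
  simp

variable (U) in
-- `U` is cocommutative, so exchanging the two outputs affects only the spheres, where it is the
-- symmetry defining `tMap`.
lemma sphereComon_comm (r r' : N) : (sphereComon S U).δ r r' ≫ (β_ _ _).hom =
    (toHo D).map (Functor.OplaxMonoidal.δ S ⟨r⟩ ⟨r'⟩ ≫
      (β_ (S.obj ⟨r⟩) (S.obj ⟨r'⟩)).hom ≫ Functor.LaxMonoidal.μ S ⟨r'⟩ ⟨r⟩) ▷ (toHo D).obj U ≫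
      (sphereComon S U).δ r' r := by
  have h := map_comul_comm (U := U)
  have h1 : (toHo D).map (Functor.OplaxMonoidal.δ S ⟨r⟩ ⟨r'⟩ ≫
      (β_ (S.obj ⟨r⟩) (S.obj ⟨r'⟩)).hom ≫ Functor.LaxMonoidal.μ S ⟨r'⟩ ⟨r⟩) ≫
      (toHo D).map (Functor.OplaxMonoidal.δ S ⟨r'⟩ ⟨r⟩) ≫ Functor.OplaxMonoidal.δ (toHo D) _ _ =
      ((toHo D).map (Functor.OplaxMonoidal.δ S ⟨r⟩ ⟨r'⟩) ≫ Functor.OplaxMonoidal.δ (toHo D) _ _) ≫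
        (β_ _ _).hom := by
    rw [← Functor.map_comp_assoc, Category.assoc, Category.assoc, Functor.Monoidal.μ_δ,
      Category.comp_id, Functor.map_comp, Functor.map_braiding]
    simp
  change (((_ ≫ _) ⊗ₘ (_ ≫ _)) ≫ tensorμ _ _ _ _) ≫ _ =
    _ ≫ ((((toHo D).map (Functor.OplaxMonoidal.δ S ⟨r'⟩ ⟨r⟩) ≫
      Functor.OplaxMonoidal.δ (toHo D) _ _) ⊗ₘ (_ ≫ _)) ≫ tensorμ _ _ _ _)
  rw [Category.assoc, tensorμ_braiding, MonoidalCategory.tensorHom_comp_tensorHom_assoc,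
    ← MonoidalCategory.tensorHom_id, MonoidalCategory.tensorHom_comp_tensorHom_assoc,
    Category.id_comp]
  exact congrArg (· ≫ _) (congrArg₂ (· ⊗ₘ ·) h1.symm h)

lemma unstableProd_eq (R : SymRingSpectrum D T) (q' : ℤ) {r r' : N}
    {k n k' n' : ℕ} (f : sphere S r U ⊗ tpow ((toHo D).obj T) k ⟶ (hoSpectrum R).X n)
    (g : sphere S r' U ⊗ tpow ((toHo D).obj T) k' ⟶ (hoSpectrum R).X n') :
    unstableProd s S R q' f g =
      (sphere S (r + r') U) ◁ onFirst (s.ofUnit (q' * n).negOnePow) (k' + k) ≫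
        starProd ((sphereComon S U).δ r r') ((R.ringStructure (toHo D)).mul n n') f g :=
  (prodRep_eq _ _ map_comul_comm _ _ f g).trans (by rw [s.pow_eq_ofUnit]; rfl)

variable {S} in
lemma IsSemistable.semistableAt {B' : ObjectProperty D} {R : SymRingSpectrum D T}
    (hR : IsSemistable c s S B' R) (hU : B' U) (r : N) :
    (R.ringStructure (toHo D)).SemistableAt c s (sphere S r U) :=
  hR U hU r

lemma piTwist_congr {C : Type u} [Category.{v} C] [MonoidalCategory C]
    [HasZeroMorphisms C] [HasBinaryCoproducts C]
    [∀ P : C, PreservesColimitsOfShape (Discrete WalkingPair) (tensorLeft P)]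
    [∀ P : C, PreservesColimitsOfShape (Discrete WalkingPair) (tensorRight P)]
    {T V : C} (c : Cogroup T) {E : TSpectrum C T} {q : ℤ} {u u' : T ⟶ T} (h : u = u')
    (hu : u ▷ T = T ◁ u) (hu' : u' ▷ T = T ◁ u') :
    (piTwist c u hu : StablePi c V E q →+ StablePi c V E q) = piTwist c u' hu' := by
  subst h
  rfl

/-- The graded ring `π_{*,*}^U(R)`. -/
@[reducible] def piRing {B' : ObjectProperty D} (hU : B' U) (R : SymRingSpectrum D T)
    (hR : IsSemistable c s S B' R) : DirectSum.GRing (gradedPi c S U R) :=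
  RingStructure.gRing (P := fun r => sphere S r U) (R := R.ringStructure (toHo D)) c
    (sphereComon S U) (fun r => hR.semistableAt c s hU r)

variable {B' : ObjectProperty D} (hU : B' U) (R : SymRingSpectrum D T)
  (hR : IsSemistable c s S B' R)

lemma stageProd_eq (q' : ℤ) {r r' : N} {n n' a a' : ℕ}
    (f : Stage c (sphere S r U) ((hoSpectrum R).X n) a)
    (g : Stage c (sphere S r' U) ((hoSpectrum R).X n') a') :
    stageProd c s S q' f g =
      stageStar c ((sphereComon S U).δ r r') ((R.ringStructure (toHo D)).mul n n')
        (s.ofUnit (q' * n).negOnePow) f g :=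
  unstableProd_eq s S R q' f g

lemma signMap_eq {R : SymRingSpectrum D T} {r : N} {q : ℤ} (m : ℤ) (x : ringPi c S U R r q) :
    signMap c s S m x = piTwist c (s.ofUnit m.negOnePow) (s.ofUnit_whisker _) x :=
  DFunLike.congr_fun (piTwist_congr c (s.pow_eq_ofUnit m) _ _) x

lemma piMul_piRing {r r' : N} {q q' : ℤ} (x : ringPi c S U R r q) (y : ringPi c S U R r' q') :
    piMul (piRing c s S hU R hR) x y =
      RingStructure.gMul (P := fun r => sphere S r U) (R := R.ringStructure (toHo D)) c
        (sphereComon S U) (fun r => hR.semistableAt c s hU r) r r' q q' x y :=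
  RingStructure.gRing_mul (P := fun r => sphere S r U) (R := R.ringStructure (toHo D)) c
        (sphereComon S U) (fun r => hR.semistableAt c s hU r) r r' q q' x y

lemma mk_unstableProd (q' : ℤ) {r r' : N} (x : Rep (hoSpectrum R) (sphere S r U))
    (y : Rep (hoSpectrum R) (sphere S r' U)) :
    (⟨y.k + x.k, x.n + y.n, unstableProd s S R q' x.hom y.hom⟩ :
        Rep (hoSpectrum R) (sphere S (r + r') U)) =
      (R.ringStructure (toHo D)).prod s ((sphereComon S U).δ r r') q' x y :=
  congrArg (Rep.mk _ _) (unstableProd_eq s S R q' x.hom y.hom)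

lemma piMul_cls {r r' : N} {q q' : ℤ} {k n k' n' : ℕ} (hq : (k : ℤ) = q + n) (hk : 1 ≤ k)
    (hq' : (k' : ℤ) = q' + n') (hk' : 1 ≤ k')
    (f : sphere S r U ⊗ tpow ((toHo D).obj T) k ⟶ (hoSpectrum R).X n)
    (g : sphere S r' U ⊗ tpow ((toHo D).obj T) k' ⟶ (hoSpectrum R).X n') :
    piMul (piRing c s S hU R hR) (cls c hq hk f) (cls c hq' hk' g) =
      cls c (cast_add_eq hq hq') (Nat.le_add_left_of_le hk) (unstableProd s S R q' f g) := by
  have h := RingStructure.prodHom_cls c (R.ringStructure (toHo D)) s ((sphereComon S U).δ r r')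
    (hR.semistableAt c s hU (r + r')) (⟨k, n, f⟩ : Rep (hoSpectrum R) (sphere S r U))
    (⟨k', n', g⟩ : Rep (hoSpectrum R) (sphere S r' U)) hq hq' hk hk'
  have h' := Rep.cls_congr c (mk_unstableProd s S R q'
    (⟨k, n, f⟩ : Rep (hoSpectrum R) (sphere S r U))
    (⟨k', n', g⟩ : Rep (hoSpectrum R) (sphere S r' U))) (q := q + q')
    (cast_add_eq hq hq')
    (Nat.le_add_left_of_le hk)
  rw [piMul_piRing]
  exact h.trans h'.symm

lemma signMap_piMul {r r' : N} {q q' : ℤ} (x : ringPi c S U R r q) (y : ringPi c S U R r' q') :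
    signMap c s S 1 (piMul (piRing c s S hU R hR) x y) =
        piMul (piRing c s S hU R hR) (signMap c s S 1 x) y ∧
      signMap c s S 1 (piMul (piRing c s S hU R hR) x y) =
        piMul (piRing c s S hU R hR) x (signMap c s S 1 y) := by
  rw [signMap_eq, signMap_eq, signMap_eq, piMul_piRing, piMul_piRing, piMul_piRing]
  exact ⟨RingStructure.piTwist_gMul_left (P := fun r => sphere S r U) c (sphereComon S U)
      (fun r => hR.semistableAt c s hU r) r r' q q' x y _,
    RingStructure.piTwist_gMul_right (P := fun r => sphere S r U) c (sphereComon S U)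
      (fun r => hR.semistableAt c s hU r) r r' q q' x y _⟩

/-- The common core of the commutative and the central case; they differ only in why the chosen
representative of the left factor commutes with everything. -/
lemma piMul_comm_of_commutes {r r' : N} {q q' : ℤ} (x : Rep (hoSpectrum R) (sphere S r U))
    (hx : (x.k : ℤ) = q + x.n) (hkx : 1 ≤ x.k) (y : ringPi c S U R r' q')
    (h : ∀ y : Rep (hoSpectrum R) (sphere S r' U), (R.ringStructure (toHo D)).Commutes x y) :
    GradedMonoid.mk (A := gradedPi c S U R) (r + r', q + q')
        (piMul (piRing c s S hU R hR) (x.cls c hx hkx) y) =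
      GradedMonoid.mk (A := gradedPi c S U R) (r + r', q' + q)
        (signMap c s S (q * q') (tMap c S r' r (q' + q)
          (piMul (piRing c s S hU R hR) y (x.cls c hx hkx)))) := by
  rw [signMap_eq, piMul_piRing, piMul_piRing]
  obtain ⟨y, hy, hky, rfl⟩ := Rep.exists_cls c y
  exact RingStructure.gMul_comm (P := fun r => sphere S r U) c (sphereComon S U)
    (fun r => hR.semistableAt c s hU r) (sphereComon_comm S U r r') x y hx hkx hy (by omega) (h y)

lemma piMul_comm {r r' : N} {q q' : ℤ} (x : ringPi c S U R r q) (y : ringPi c S U R r' q')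
    (h : R.IsCommutative ∨ ∃ (k n : ℕ) (hq : (k : ℤ) = q + n) (hk : 1 ≤ k)
      (f : (S.obj ⟨r⟩ ⊗ U) ⊗ tpow T k ⟶ R.X n),
      R.IsCentral f ∧ x = cls c hq hk (repOfHom S f)) :
    GradedMonoid.mk (A := gradedPi c S U R) (r + r', q + q')
        (piMul (piRing c s S hU R hR) x y) =
      GradedMonoid.mk (A := gradedPi c S U R) (r + r', q' + q)
        (signMap c s S (q * q') (tMap c S r' r (q' + q)
          (piMul (piRing c s S hU R hR) y x))) := by
  rcases h with h | ⟨k, n, hq, hk, f, hf, rfl⟩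
  · obtain ⟨x, hx, hkx, rfl⟩ := Rep.exists_cls c x
    exact piMul_comm_of_commutes c s S hU R hR x hx (by omega) y fun y => h.commutes (toHo D) x y
  · refine piMul_comm_of_commutes c s S hU R hR ⟨k, n, repOfHom S f⟩ hq hk y fun y => ?_
    -- `repOfHom S f` is the image of `f` precomposed with the monoidal comparison maps, which play
    -- the role of the arbitrary map `p`.
    have h := hf.commutes (toHo D) y
      ((Functor.LaxMonoidal.μ (toHo D) _ _ ⊗ₘ tpowComparison (toHo D) T k) ≫
        Functor.LaxMonoidal.μ (toHo D) _ _)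
    exact Eq.mp (congrArg (fun z => (R.ringStructure (toHo D)).Commutes
      (⟨k, n, z⟩ : Rep (hoSpectrum R) (sphere S r U)) y) (Category.assoc _ _ _)) h

variable {R} {R' : SymRingSpectrum D T} (hR' : IsSemistable c s S B' R') (φ : R.Hom R')

lemma ringPiMap_piOne : ringPiMap c S φ 0 0 (piOne (piRing c s S hU R hR)) =
    piOne (piRing c s S hU R' hR') :=
  RingStructure.piMap_gOne (P := fun r => sphere S r U) c (R := R.ringStructure (toHo D))
    (R' := R'.ringStructure (toHo D)) (sphereComon S U) (φ.spectrum.mapLax (toHo D))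
    (((toHo D).map_comp _ _).symm.trans (congrArg _ φ.unit₁))

lemma ringPiMap_piMul {r r' : N} {q q' : ℤ} (x : ringPi c S U R r q) (y : ringPi c S U R r' q') :
    ringPiMap c S φ (r + r') (q + q') (piMul (piRing c s S hU R hR) x y) =
      piMul (piRing c s S hU R' hR') (ringPiMap c S φ r q x) (ringPiMap c S φ r' q' y) := by
  rw [piMul_piRing, piMul_piRing]
  exact RingStructure.piMap_gMul (P := fun r => sphere S r U) c (sphereComon S U)
    (fun r => hR.semistableAt c s hU r) (fun r => hR'.semistableAt c s hU r)
    (φ.spectrum.mapLax (toHo D)) (fun n m => (tensorHom_map_μ (toHo D) (φ.mul n m).symm).symm)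
    r r' q q' x y

end Final

end StableHtpy
end

theorem mainTheorem11 {D : Type u} [Category.{v} D] [MonoidalCategory D] [SymmetricCategory D]
    [MonoidalClosed D] [ModelCategory D] [HasZeroObject D] [MonoidalModelCategory D]
    [(weakEquivalences D).IsMonoidal]
    (T : D) [IsCofibrant T] (c : Cogroup ((toHo D).obj T)) (s : TSign ((toHo D).obj T))
    {N : Type w} [AddCommMonoid N] (S : Discrete N ⥤ D) [S.Monoidal]
    (hS : ∀ r : N, IsCofibrant (S.obj ⟨r⟩))
    (B' : ObjectProperty D) (hB' : ∀ V, B' V → IsCofibrant V)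
    (U : D) (hU : B' U) [ComonObj U] [IsCommComonObj U] :
    ∃ ring : ∀ R : SymRingSpectrum D T, IsSemistable c s S B' R →
        DirectSum.GRing (gradedPi c S U R),
      ∀ (R : SymRingSpectrum D T) (hR : IsSemistable c s S B' R),
        -- the product of representatives is biadditive
        (∀ (q' : ℤ) (r r' : N) (a n a' n' : ℕ)
            (f f₁ f₂ : Stage c (sphere S r U) ((hoSpectrum R).X n) a)
            (g g₁ g₂ : Stage c (sphere S r' U) ((hoSpectrum R).X n') a'),
          stageProd c s S q' (f₁ + f₂) g =
            stageProd c s S q' f₁ g + stageProd c s S q' f₂ g ∧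
          stageProd c s S q' f (g₁ + g₂) =
            stageProd c s S q' f g₁ + stageProd c s S q' f g₂) ∧
        -- it induces the product of the graded ring
        (∀ (r r' : N) (q q' : ℤ) (k n k' n' : ℕ) (hq : (k : ℤ) = q + n) (hk : 1 ≤ k)
            (hq' : (k' : ℤ) = q' + n') (hk' : 1 ≤ k')
            (f : sphere S r U ⊗ tpow ((toHo D).obj T) k ⟶ (hoSpectrum R).X n)
            (g : sphere S r' U ⊗ tpow ((toHo D).obj T) k' ⟶ (hoSpectrum R).X n'),
          piMul (ring R hR) (cls c hq hk f) (cls c hq' hk' g) =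
            cls c (by push_cast; omega) (by omega) (unstableProd s S R q' f g)) ∧
        -- compatibility with the sign
        (∀ (r r' : N) (q q' : ℤ) (x : ringPi c S U R r q) (y : ringPi c S U R r' q'),
          signMap c s S 1 (piMul (ring R hR) x y) =
            piMul (ring R hR) (signMap c s S 1 x) y ∧
          signMap c s S 1 (piMul (ring R hR) x y) =
            piMul (ring R hR) x (signMap c s S 1 y)) ∧
        -- graded commutativity
        (∀ (r r' : N) (q q' : ℤ) (x : ringPi c S U R r q) (y : ringPi c S U R r' q'),
          (R.IsCommutative ∨
            ∃ (k n : ℕ) (hq : (k : ℤ) = q + n) (hk : 1 ≤ k)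
              (f : (S.obj ⟨r⟩ ⊗ U) ⊗ tpow T k ⟶ R.X n),
              R.IsCentral f ∧ x = cls c hq hk (repOfHom S f)) →
          GradedMonoid.mk (A := gradedPi c S U R) (r + r', q + q') (piMul (ring R hR) x y) =
            GradedMonoid.mk (A := gradedPi c S U R) (r + r', q' + q)
              (signMap c s S (q * q') (tMap c S r' r (q' + q) (piMul (ring R hR) y x)))) ∧
        -- naturality
        (∀ (R' : SymRingSpectrum D T) (hR' : IsSemistable c s S B' R') (φ : R.Hom R'),
          ringPiMap c S φ 0 0 (piOne (ring R hR)) = piOne (ring R' hR') ∧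
          ∀ (r r' : N) (q q' : ℤ) (x : ringPi c S U R r q) (y : ringPi c S U R r' q'),
            ringPiMap c S φ (r + r') (q + q') (piMul (ring R hR) x y) =
              piMul (ring R' hR') (ringPiMap c S φ r q x) (ringPiMap c S φ r' q' y)) := by
  refine ⟨fun R hR => piRing c s S hU R hR, fun R hR => ⟨?_, ?_, ?_, ?_, ?_⟩⟩
  · intro q' r r' a n a' n' f f₁ f₂ g g₁ g₂
    simp only [stageProd_eq]
    exact ⟨stageStar_add_left c _ _ (s.ofUnit_whisker _) f₁ f₂ g,
      stageStar_add_right c _ _ (s.ofUnit_whisker _) f g₁ g₂⟩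
  · intro r r' q q' k n k' n' hq hk hq' hk' f g
    exact piMul_cls c s S hU R hR hq hk hq' hk' f g
  · intro r r' q q' x y
    exact signMap_piMul c s S hU R hR x y
  · intro r r' q q' x y h
    exact piMul_comm c s S hU R hR x y h
  · intro R' hR' φ
    exact ⟨ringPiMap_piOne c s S hU hR hR' φ, fun r r' q q' x y =>
      ringPiMap_piMul c s S hU hR hR' φ x y⟩
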